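/- For a tempered distribution $f$ on $\mathbb R$ let $\widehat f$ be its Fourier transform, with the convention $\widehat f(\xi)=\int e^{-ix\xi}f(x)\,dx$, and for $\sigma\in\mathbb R$ let $H^\sigma=H^\sigma(\mathbb R)$ be the Sobolev space with the norm $\|f\|_\sigma^2=\int_{\mathbb R}(1+\xi^2)^\sigma|\widehat f(\xi)|^2\,d\xi$. Let $\rho\ge 2$, $s>\tfrac12$, and let $l:\mathbb R\to\mathbb R$ be measurable and even, with constants $c_1,c_2>0$ such that $$c_1^2(1+\xi^2)^{\rho/2}\le l(\xi)\le c_2^2(1+\xi^2)^{\rho/2}\qquad(\xi\in\mathbb R).$$ Let $L$ be the operator given by $\widehat{Lv}(\xi)=l(\xi)\widehat v(\xi)$. Let $g\in C^{[s]+1}(\mathbb R)$ be real-valued ($[s]$ is the integer part of $s$), $\varphi\in H^s$ and $\psi\in H^{s-1-\rho/2}$. Consider the Cauchy problem $$u_{tt}-Lu_{xx}=(g(u))_{xx},\quad x\in\mathbb R,\ t>0,\qquad u(x,0)=\varphi(x),\quad u_t(x,0)=\psi(x).$$ For $0<T\le\infty$, a solution on $[0,T)$ is a real-valued $u\in C([0,T),H^s)\cap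 C^1([0,T),H^{s-1-\rho/2})$ that attains the initial data and satisfies the equation in the sense of distributions in $x$ at every time $t\in[0,T)$ (that is, for every Schwartz function $\chi$, $t\mapsto\langle u_t(t),\chi\rangle$ is differentiable on $[0,T)$, one-sidedly at $t=0$, with derivative $\langle (Lu(t))_{xx}+(g(u(t)))_{xx},\chi\rangle$). Let $u$ be a solution on the maximal time interval $[0,T_{\max})$, $0<T_{\max}\le\infty$; that is, no solution on $[0,T)$ with $T>T_{\max}$ extends $u$. If $T_{\max}<\infty$, then $$\limsup_{t\to T_{\max}^-}\Bigl[\|u(t)\|_s+\|u_t(t)\|_{s-1-\rho/2}\Bigr]=\infty .$$ -/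

import Mathlib

open MeasureTheory Filter Topology
open scoped ENNReal FourierTransform SchwartzMap

namespace NonlocalWave

/-- The tempered distribution `f` is (integration against) the function `v`. -/
def Represents (f : 𝓢'(ℝ, ℂ)) (v : ℝ → ℂ) : Prop :=
  ∀ χ : 𝓢(ℝ, ℂ), Integrable (fun x : ℝ => χ x * v x) ∧ f χ = ∫ x : ℝ, χ x * v x

/-- The Fourier transform of `f`, with the convention `f̂(ξ) = ∫ exp(-i x ξ) f(x) dx`, is the
function `w`. (Mathlib's transform `𝓕` has the kernel `exp(-2 π i x η)`, so that
`(𝓕 f)(η) = f̂(2 π η)`. With this convention `∂ₓ` has the symbol `i ξ`.) -/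
def HasFourierTransform (f : 𝓢'(ℝ, ℂ)) (w : ℝ → ℂ) : Prop :=
  Represents (𝓕 f) (fun η : ℝ => w (2 * Real.pi * η))

/-- The norm of `H^s(ℝ)`, `‖f‖_s = (∫ (1 + ξ²)^s |f̂(ξ)|² dξ)^(1/2)`, as an extended nonnegative
real number defined for every tempered distribution: it is `∞` if `f̂` is not a function. (The
function `f̂` is unique up to null sets, so that the infimum is over equal values.) -/
noncomputable def sobolevENorm (s : ℝ) (f : 𝓢'(ℝ, ℂ)) : ℝ≥0∞ :=
  ⨅ (w : ℝ → ℂ) (_ : HasFourierTransform f w),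
    eLpNorm (fun ξ : ℝ => (((1 + ξ ^ 2) ^ (s / 2) : ℝ) : ℂ) * w ξ) 2 volume

/-- `f ∈ H^s(ℝ)`. -/
def MemH (s : ℝ) (f : 𝓢'(ℝ, ℂ)) : Prop := sobolevENorm s f < ∞

/-- `u ∈ C(I, H^s)`. -/
def ContinuousOnH (s : ℝ) (I : Set ℝ) (u : ℝ → 𝓢'(ℝ, ℂ)) : Prop :=
  ∀ t ∈ I, MemH s (u t) ∧ Tendsto (fun τ => sobolevENorm s (u τ - u t)) (𝓝[I] t) (𝓝 0)

/-- On `I`, `u` is differentiable in time with derivative `v`, the difference quotients converging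
in `H^s` (one-sidedly at an end point that belongs to `I`). -/
def HasTimeDerivOnH (s : ℝ) (I : Set ℝ) (u v : ℝ → 𝓢'(ℝ, ℂ)) : Prop :=
  ∀ t ∈ I, Tendsto
    (fun τ : ℝ => sobolevENorm s (((((τ - t)⁻¹ : ℝ) : ℂ)) • (u τ - u t) - v t))
    (𝓝[I \ {t}] t) (𝓝 0)

/-- `h = L f`, where `L` is the operator with the symbol `l`: `ĥ(ξ) = l(ξ) f̂(ξ)`. -/
def IsMultiplierImage (l : ℝ → ℝ) (f h : 𝓢'(ℝ, ℂ)) : Prop :=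
  ∃ w : ℝ → ℂ, HasFourierTransform f w ∧ HasFourierTransform h (fun ξ => (l ξ : ℂ) * w ξ)

/-- `h = g(f)`, where `f` is a real-valued function and `g(f)` is the pointwise composition. -/
def IsComposition (g : ℝ → ℝ) (f h : 𝓢'(ℝ, ℂ)) : Prop :=
  ∃ v : ℝ → ℝ, Represents f (fun x => (v x : ℂ)) ∧ Represents h (fun x => (g (v x) : ℂ))

/-- The second derivative `f_xx` of a tempered distribution. -/
noncomputable def dxx (f : 𝓢'(ℝ, ℂ)) : 𝓢'(ℝ, ℂ) :=
  TemperedDistribution.derivCLM ℂ (TemperedDistribution.derivCLM ℂ f)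

/-- `u`, with time derivative `ut`, is a (real-valued) solution in
`C(I, H^s) ∩ C¹(I, H^{s-1-ρ/2})` of the Cauchy problem
`u_tt - L u_xx = (g(u))_xx`, `u(0) = φ`, `u_t(0) = ψ`. The equation holds in the sense of
distributions in `x` at every time: `t ↦ ⟨u_t(t), χ⟩` is differentiable with derivative
`⟨(L u(t))_xx + (g(u(t)))_xx, χ⟩` for every Schwartz function `χ`. -/
structure IsSolutionOn (ρ s : ℝ) (l g : ℝ → ℝ) (φ ψ : 𝓢'(ℝ, ℂ)) (I : Set ℝ)
    (u ut : ℝ → 𝓢'(ℝ, ℂ)) : Prop where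
  continuousOn : ContinuousOnH s I u
  continuousOn_deriv : ContinuousOnH (s - 1 - ρ / 2) I ut
  hasTimeDeriv : HasTimeDerivOnH (s - 1 - ρ / 2) I u ut
  initial : u 0 = φ
  initial_deriv : ut 0 = ψ
  equation : ∀ t ∈ I, ∃ Lu gu : 𝓢'(ℝ, ℂ),
    IsMultiplierImage l (u t) Lu ∧ IsComposition g (u t) gu ∧
      ∀ χ : 𝓢(ℝ, ℂ), HasDerivWithinAt (fun τ : ℝ => ut τ χ) ((dxx Lu + dxx gu) χ) I t

/-- The time interval `[0, T)`, where `T = ∞` is allowed. -/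
def timeInterval (T : EReal) : Set ℝ := {t : ℝ | 0 ≤ t ∧ (t : EReal) < T}

/-- `[0, Tmax)` is the maximal interval of existence of the solution `u`: `u` is a solution on
`[0, Tmax)`, and no solution on a longer interval extends it. -/
def IsMaximalSolution (ρ s : ℝ) (l g : ℝ → ℝ) (φ ψ : 𝓢'(ℝ, ℂ)) (Tmax : EReal)
    (u ut : ℝ → 𝓢'(ℝ, ℂ)) : Prop :=
  0 < Tmax ∧ IsSolutionOn ρ s l g φ ψ (timeInterval Tmax) u ut ∧
    ∀ T : EReal, Tmax < T → ¬ ∃ v vt : ℝ → 𝓢'(ℝ, ℂ),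
      IsSolutionOn ρ s l g φ ψ (timeInterval T) v vt ∧ ∀ t ∈ timeInterval Tmax, v t = u t

end NonlocalWave

/-!
The theorem follows from an extension principle: a solution on `[0, T)`, `T < ∞`, which is bounded
in `H^s` extends to a longer interval. If the limit superior is finite, then the solution is
bounded in `H^s` (near `T` by assumption, before by continuity, `exists_bound_of_limsup_ne_top`),
and the extension contradicts maximality.

*The linear part.* The map `sob σ` parametrizes `H^σ` by `L²` on the Fourier side. In these
coordinates the equation is an ordinary differential equation for each frequency, with `ω(ξ) = |ξ|
√l(ξ)` and the fundamental solutions `cos(tω)` and `sin(tω)/ω`. Since `ω` is comparable to `|ξ| (1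
+ ξ²)^(ρ/4)`, the second one gains `1 + ρ/2` derivatives (`Admissible.exists_wt_mul_sinS_le`). As
`ρ ≥ 2`, this makes up for the two derivatives in `g(u)_xx`, and also for the initial velocity
being in `H^(s-1-ρ/2)` only. All operators in the variation of constants formula are therefore
strongly continuous families of bounded multipliers on `L²`. Bounded solutions satisfy this formula
(`Admissible.exists_mild_of_isSolutionOn`: weak time derivatives are strong ones in a sufficiently
weak norm by `hasDerivAt_of_weak`, and the free wave with the data `u(τ)`, `u_t(τ)` at time `τ` is
differentiated in `τ` in `Admissible.eq_duhA`). Conversely, the formula yields solutions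
(`Admissible.isSolutionOn_of_mild`).

*The nonlinearity.* For `g` of class `C^([s]+1)`, the map `u ↦ g(u) - g(0)` is bounded on bounded
sets of `H^s` (`exists_hsq_comp_le`). For `s ≤ 1` this holds because Lipschitz maps increase
differences by at most a constant factor, and differences characterize the `H^s` norm
(`hsq_compLp_le`). For larger `s` it follows by induction from the chain rule (`IsDeriv.comp`) and
the product estimate (`hsq_mul_le`). The constant `g(0)` is not in `H^s`, but it is annihilated by
`∂ₓ²`. Differences of the nonlinear term are estimated only in `L²`, where it is Lipschitz
continuous on bounded sets of `H^s` (`exists_nonlinearity`). So `g(u) - g(0)` enters as a bounded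
function of time with values in `H^s` whose continuity is used only in `L²`. It is strongly
measurable in `H^s` (`stronglyMeasurable_of_mulR`), so that the Duhamel integral exists in `H^s`
and is continuous there.

*The extension.* On `[T, T + δ]` the formula is a fixed point equation. For small `δ` its right
hand side is a contraction in `C([T, T + δ], L²)`, and it maps functions with values in a ball of
`H^s` to such functions. Balls of `H^s` are closed in `L²` (`exists_of_tendsto_mulR_wt`), hence the
fixed point is bounded in `H^s`, and the formula shows that it is continuous there
(`Admissible.exists_extension`). Solutions stay real-valued because all symbols are even: on the
Fourier side this is Hermitian symmetry (`IsHerm`).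
-/

namespace NonlocalWave

/-! ### Tempered distributions given by functions -/

theorem Represents.apply_eq {f : 𝓢'(ℝ, ℂ)} {v : ℝ → ℂ} (h : Represents f v) (χ : 𝓢(ℝ, ℂ)) :
    f χ = ∫ x : ℝ, χ x * v x := (h χ).2

/-- The function `v` is integrable near `x`: test against a bump function which is `1` near `x`. -/
theorem Represents.locallyIntegrable {f : 𝓢'(ℝ, ℂ)} {v : ℝ → ℂ} (h : Represents f v) :
    LocallyIntegrable v := by
  intro x
  obtain ⟨b⟩ : Nonempty (ContDiffBump x) := inferInstance
  have hg₁ : HasCompactSupport (Complex.ofRealCLM ∘ b) := b.hasCompactSupport.comp_left rfl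
  have hg₂ : ContDiff ℝ ((⊤ : ℕ∞) : WithTop ℕ∞) (Complex.ofRealCLM ∘ b) := by
    exact Complex.ofRealCLM.contDiff.comp b.contDiff
  refine ⟨Metric.closedBall x b.rIn, Metric.closedBall_mem_nhds x b.rIn_pos, ?_⟩
  have h1 := ((h (hg₁.toSchwartzMap hg₂)).1).integrableOn (s := Metric.closedBall x b.rIn)
  refine h1.congr_fun (fun y hy => ?_) Metric.isClosed_closedBall.measurableSet
  simp [b.one_of_mem_closedBall hy]

theorem Represents.ae_eq {f : 𝓢'(ℝ, ℂ)} {v w : ℝ → ℂ} (hv : Represents f v)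
    (hw : Represents f w) : v =ᵐ[volume] w := by
  apply ae_eq_of_integral_contDiff_smul_eq hv.locallyIntegrable hw.locallyIntegrable
  intro g g_smooth g_cpt
  have hg₁ : HasCompactSupport (Complex.ofRealCLM ∘ g) := g_cpt.comp_left rfl
  have hg₂ : ContDiff ℝ ((⊤ : ℕ∞) : WithTop ℕ∞) (Complex.ofRealCLM ∘ g) := by fun_prop
  have h1 := hv.apply_eq (hg₁.toSchwartzMap hg₂)
  have h2 := hw.apply_eq (hg₁.toSchwartzMap hg₂)
  rw [h1] at h2
  simpa using h2

theorem Represents.congr {f : 𝓢'(ℝ, ℂ)} {v w : ℝ → ℂ} (hv : Represents f v)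
    (h : v =ᵐ[volume] w) : Represents f w := by
  intro χ
  have h' : (fun x => χ x * v x) =ᵐ[volume] fun x => χ x * w x := by
    filter_upwards [h] with x hx
    rw [hx]
  exact ⟨(hv χ).1.congr h', by rw [(hv χ).2, integral_congr_ae h']⟩

theorem Represents.unique {f g : 𝓢'(ℝ, ℂ)} {v : ℝ → ℂ} (hf : Represents f v)
    (hg : Represents g v) : f = g := by
  ext χ
  rw [hf.apply_eq, hg.apply_eq]

/-! ### The weights and the parametrization of `H^σ` by `L²` -/

/-- The Hilbert space `L²(ℝ; ℂ)`. -/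
abbrev L2 : Type := Lp ℂ 2 (volume : Measure ℝ)

/-- The weight `(1 + ξ²)^(σ/2)` at the frequency `ξ = 2 π η`. -/
noncomputable def wt (σ η : ℝ) : ℝ := (1 + (2 * Real.pi * η) ^ 2) ^ (σ / 2)

theorem wt_pos (σ η : ℝ) : 0 < wt σ η := by unfold wt; positivity

theorem wt_ne_zero (σ η : ℝ) : wt σ η ≠ 0 := (wt_pos σ η).ne'

theorem wt_add (σ τ η : ℝ) : wt (σ + τ) η = wt σ η * wt τ η := by
  unfold wt
  rw [← Real.rpow_add (by positivity)]
  ring_nf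

theorem wt_zero (η : ℝ) : wt 0 η = 1 := by simp [wt]

theorem wt_neg_mul (σ η : ℝ) : wt (-σ) η * wt σ η = 1 := by
  rw [← wt_add]; simp [wt_zero]

theorem wt_mul_neg (σ η : ℝ) : wt σ η * wt (-σ) η = 1 := by
  rw [← wt_add]; simp [wt_zero]

theorem wt_mono {σ τ : ℝ} (h : σ ≤ τ) (η : ℝ) : wt σ η ≤ wt τ η :=
  Real.rpow_le_rpow_of_exponent_le (by nlinarith [sq_nonneg (2 * Real.pi * η)]) (by linarith)

theorem wt_le_one {σ : ℝ} (hσ : σ ≤ 0) (η : ℝ) : wt σ η ≤ 1 := by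
  rw [← wt_zero η]; exact wt_mono hσ η

theorem wt_neg_eq (σ η : ℝ) : wt σ (-η) = wt σ η := by simp [wt]

theorem continuous_wt (σ : ℝ) : Continuous (wt σ) := by
  unfold wt
  refine Continuous.rpow_const (by fun_prop) (fun x => Or.inl (by positivity))

theorem measurable_wt (σ : ℝ) : Measurable (wt σ) := (continuous_wt σ).measurable

theorem wt_two (η : ℝ) : wt 2 η = 1 + (2 * Real.pi * η) ^ 2 := by simp [wt]

theorem hasTemperateGrowth_wt (σ : ℝ) : (fun η => (wt σ η : ℂ)).HasTemperateGrowth := by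
  have h := Function.hasTemperateGrowth_one_add_norm_sq_rpow ℝ (σ / 2)
  have h2 : (fun η : ℝ => (2 * Real.pi) * η).HasTemperateGrowth := by fun_prop
  have h3 := h.comp h2
  have h4 : (wt σ).HasTemperateGrowth := by
    have : wt σ = (fun x : ℝ => (1 + ‖x‖ ^ 2) ^ (σ / 2)) ∘ fun η : ℝ => (2 * Real.pi) * η := by
      funext η
      simp only [wt, Function.comp, Real.norm_eq_abs, sq_abs]
    rw [this]
    exact h3
  fun_prop

/-- The element of `H^σ` whose Fourier transform is `(1 + ξ²)^(-σ/2) a`. This parametrizes `H^σ`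
by `L²`, in the frequency variable `η = ξ / 2π` of Mathlib's Fourier transform. -/
noncomputable def sob (σ : ℝ) : L2 →L[ℂ] 𝓢'(ℝ, ℂ) :=
  FourierTransform.fourierInvCLM ℂ 𝓢'(ℝ, ℂ) ∘L
    TemperedDistribution.smulLeftCLM ℂ (fun η => (wt (-σ) η : ℂ)) ∘L
      Lp.toTemperedDistributionCLM ℂ volume 2

theorem fourier_sob (σ : ℝ) (a : L2) :
    𝓕 (sob σ a) = TemperedDistribution.smulLeftCLM ℂ (fun η => (wt (-σ) η : ℂ))
      (a : 𝓢'(ℝ, ℂ)) := by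
  simp [sob]

theorem represents_coe (a : L2) : Represents (a : 𝓢'(ℝ, ℂ)) a := by
  intro χ
  refine ⟨?_, by simp⟩
  exact MemLp.integrable_mul (p := 2) (q := 2) (χ.memLp 2 volume) (Lp.memLp a)

theorem represents_smulLeft {f : 𝓢'(ℝ, ℂ)} {v m : ℝ → ℂ} (hf : Represents f v)
    (hm : m.HasTemperateGrowth) :
    Represents (TemperedDistribution.smulLeftCLM ℂ m f) (fun η => m η * v η) := by
  intro χ
  have h := hf (SchwartzMap.smulLeftCLM ℂ m χ)
  have e : (fun x => (SchwartzMap.smulLeftCLM ℂ m χ) x * v x) = fun x => χ x * (m x * v x) := by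
    funext x
    rw [SchwartzMap.smulLeftCLM_apply_apply hm]
    simp only [smul_eq_mul]
    ring
  rw [e] at h
  exact ⟨h.1, by rw [TemperedDistribution.smulLeftCLM_apply_apply]; exact h.2⟩

theorem represents_fourier_sob (σ : ℝ) (a : L2) :
    Represents (𝓕 (sob σ a)) (fun η => (wt (-σ) η : ℂ) * a η) := by
  rw [fourier_sob]
  exact represents_smulLeft (represents_coe a) (hasTemperateGrowth_wt _)

theorem fourier_injective {f g : 𝓢'(ℝ, ℂ)} (h : 𝓕 f = 𝓕 g) : f = g := by
  have := congrArg (fun x => 𝓕⁻ x) h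
  simpa using this

theorem eq_sob_of_represents {σ : ℝ} {a : L2} {f : 𝓢'(ℝ, ℂ)}
    (h : Represents (𝓕 f) (fun η => (wt (-σ) η : ℂ) * a η)) : f = sob σ a :=
  fourier_injective (h.unique (represents_fourier_sob σ a))

theorem sob_injective (σ : ℝ) : Function.Injective (sob σ) := by
  intro a b h
  have h1 := (represents_fourier_sob σ a)
  rw [h] at h1
  have h2 := h1.ae_eq (represents_fourier_sob σ b)
  apply Lp.ext
  filter_upwards [h2] with η hη
  exact mul_left_cancel₀ (by exact_mod_cast wt_ne_zero _ _) hη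

/-- `√(2π)`, which relates the `L²` norms in the frequencies `ξ` and `η = ξ / 2π`. -/
noncomputable def freqConst : ℝ≥0∞ := ENNReal.ofReal (2 * Real.pi) ^ (1 / 2 : ℝ)

theorem freqConst_ne_zero : freqConst ≠ 0 := by
  unfold freqConst
  have : ENNReal.ofReal (2 * Real.pi) ≠ 0 := by
    simp [Real.pi_pos]
  simp [Real.pi_pos]

theorem freqConst_ne_top : freqConst ≠ ∞ := by
  unfold freqConst
  exact ENNReal.rpow_ne_top_of_nonneg (by norm_num) ENNReal.ofReal_ne_top

theorem lintegral_comp_two_pi (F : ℝ → ℝ≥0∞) :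
    ∫⁻ ξ, F ξ = ENNReal.ofReal (2 * Real.pi) * ∫⁻ η, F (2 * Real.pi * η) := by
  have h := Measure.map_addHaar_smul (volume : Measure ℝ) (r := 2 * Real.pi) (by positivity)
  have h2 : ∫⁻ η, F (2 * Real.pi * η) = ∫⁻ y,
      F y ∂(Measure.map (fun x : ℝ => (2 * Real.pi) • x) volume) := by
    rw [← MeasurableEquiv.coe_smul₀ (by positivity : (2 * Real.pi) ≠ 0), lintegral_map_equiv]
    simp
  rw [h2, h]
  simp only [Module.finrank_self, pow_one, lintegral_smul_measure, smul_eq_mul]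
  rw [← mul_assoc, ← ENNReal.ofReal_mul (by positivity), abs_of_pos (by positivity),
    mul_inv_cancel₀ (by positivity)]
  simp

theorem eLpNorm_comp_two_pi (F : ℝ → ℂ) :
    eLpNorm F 2 volume = freqConst * eLpNorm (fun η => F (2 * Real.pi * η)) 2 volume := by
  rw [eLpNorm_eq_lintegral_rpow_enorm_toReal (by norm_num) (by norm_num),
    eLpNorm_eq_lintegral_rpow_enorm_toReal (by norm_num) (by norm_num),
    lintegral_comp_two_pi (fun x => ‖F x‖ₑ ^ (2 : ℝ≥0∞).toReal),
    ENNReal.mul_rpow_of_nonneg _ _ (by norm_num)]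
  rfl

theorem sobolevENorm_of_hasFourierTransform (σ : ℝ) {f : 𝓢'(ℝ, ℂ)} {w : ℝ → ℂ}
    (hw : HasFourierTransform f w) : sobolevENorm σ f =
      freqConst * eLpNorm (fun η => (wt σ η : ℂ) * w (2 * Real.pi * η)) 2 volume := by
  have key : ∀ w' : ℝ → ℂ, HasFourierTransform f w' →
      eLpNorm (fun ξ : ℝ => (((1 + ξ ^ 2) ^ (σ / 2) : ℝ) : ℂ) * w' ξ) 2 volume =
      freqConst * eLpNorm (fun η => (wt σ η : ℂ) * w (2 * Real.pi * η)) 2 volume := by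
    intro w' hw'
    rw [eLpNorm_comp_two_pi]
    congr 1
    apply eLpNorm_congr_ae
    filter_upwards [Represents.ae_eq hw' hw] with η hη
    simp only [hη, wt]
  unfold sobolevENorm
  apply le_antisymm
  · exact (iInf₂_le w hw).trans (key w hw).le
  · exact le_iInf₂ fun w' hw' => (key w' hw').ge

theorem hasFourierTransform_sob (σ : ℝ) (a : L2) :
    HasFourierTransform (sob σ a)
      (fun ξ => (wt (-σ) ((2 * Real.pi)⁻¹ * ξ) : ℂ) * a ((2 * Real.pi)⁻¹ * ξ)) := by
  unfold HasFourierTransform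
  have : ∀ η : ℝ, (2 * Real.pi)⁻¹ * (2 * Real.pi * η) = η := fun η => by
    field_simp
  simp only [this]
  exact represents_fourier_sob σ a

theorem sobolevENorm_sob (σ : ℝ) (a : L2) : sobolevENorm σ (sob σ a) = freqConst * ‖a‖ₑ := by
  rw [sobolevENorm_of_hasFourierTransform σ (hasFourierTransform_sob σ a), Lp.enorm_def]
  congr 1
  apply eLpNorm_congr_ae
  filter_upwards with η
  have : (2 * Real.pi)⁻¹ * (2 * Real.pi * η) = η := by field_simp
  rw [this, ← mul_assoc]
  have h := wt_mul_neg σ η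
  rw [← Complex.ofReal_mul, h]
  simp

theorem memH_sob (σ : ℝ) (a : L2) : MemH σ (sob σ a) := by
  unfold MemH
  rw [sobolevENorm_sob]
  exact ENNReal.mul_lt_top freqConst_ne_top.lt_top enorm_lt_top

/-- Together with `memH_sob` and `sobolevENorm_sob`: up to a factor in the norm, `sob σ` is an
isometry of `L²` onto `H^σ`. -/
theorem MemH.exists_eq_sob {σ : ℝ} {f : 𝓢'(ℝ, ℂ)} (hf : MemH σ f) : ∃ a, f = sob σ a := by
  have hf' : sobolevENorm σ f < ∞ := hf
  simp only [MemH, sobolevENorm, iInf_lt_iff] at hf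
  obtain ⟨w, hw, -⟩ := hf
  rw [sobolevENorm_of_hasFourierTransform σ hw] at hf'
  have hm : MemLp (fun η => (wt σ η : ℂ) * w (2 * Real.pi * η)) 2 volume := by
    refine ⟨?_, ?_⟩
    · refine AEStronglyMeasurable.mul ?_ (Represents.locallyIntegrable hw).aestronglyMeasurable
      exact (Complex.continuous_ofReal.comp (continuous_wt σ)).aestronglyMeasurable
    · exact lt_of_not_ge fun h => by
        rw [top_le_iff] at h
        rw [h, ENNReal.mul_top freqConst_ne_zero] at hf'
        exact lt_irrefl _ hf'
  refine ⟨hm.toLp, eq_sob_of_represents ?_⟩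
  refine Represents.congr hw ?_
  filter_upwards [hm.coeFn_toLp] with η hη
  rw [hη, ← mul_assoc, ← Complex.ofReal_mul, wt_neg_mul]
  simp

/-! ### Multiplication operators on `L²` -/

/-- Bounded measurable symbols. -/
def BddSymbol (m : ℝ → ℂ) : Prop := Measurable m ∧ ∃ C : ℝ, ∀ η, ‖m η‖ ≤ C

theorem BddSymbol.memLp {m : ℝ → ℂ} (hm : BddSymbol m) (f : L2) :
    MemLp (fun η => m η * f η) 2 volume := by
  obtain ⟨hm, C, hC⟩ := hm
  refine (Lp.memLp f).of_le_mul (c := C)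
      (hm.aestronglyMeasurable.mul (Lp.aestronglyMeasurable f)) ?_
  filter_upwards with η
  rw [norm_mul]
  gcongr
  exact hC η

theorem BddSymbol.mul {m n : ℝ → ℂ} (hm : BddSymbol m) (hn : BddSymbol n) :
    BddSymbol (fun η => m η * n η) := by
  obtain ⟨hm, C, hC⟩ := hm
  obtain ⟨hn, D, hD⟩ := hn
  refine ⟨hm.mul hn, C * D, fun η => ?_⟩
  rw [norm_mul]
  exact mul_le_mul (hC η) (hD η) (norm_nonneg _) ((norm_nonneg _).trans (hC η))

open Classical in
/-- Multiplication by the symbol `m` on `L²`; the zero operator if `m` is not a bounded measurable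
function. -/
noncomputable def mulOp (m : ℝ → ℂ) : L2 →L[ℂ] L2 :=
  if hm : BddSymbol m then
    LinearMap.mkContinuous
      { toFun := fun f => (hm.memLp f).toLp
        map_add' := fun f g => by
          rw [← MemLp.toLp_add]
          apply MemLp.toLp_congr
          filter_upwards [Lp.coeFn_add f g] with η hη
          rw [hη]; simp [mul_add]
        map_smul' := fun c f => by
          rw [RingHom.id_apply, ← MemLp.toLp_const_smul]
          apply MemLp.toLp_congr
          filter_upwards [Lp.coeFn_smul c f] with η hη
          rw [hη]; simp; ring }
      hm.2.choose (fun f => by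
        apply Lp.norm_le_mul_norm_of_ae_le_mul
        filter_upwards [(hm.memLp f).coeFn_toLp] with η hη
        simp only [LinearMap.coe_mk, AddHom.coe_mk, hη, norm_mul]
        gcongr
        exact hm.2.choose_spec η)
  else 0

theorem coeFn_mulOp {m : ℝ → ℂ} (hm : BddSymbol m) (f : L2) :
    mulOp m f =ᵐ[volume] fun η => m η * f η := by
  have : mulOp m f = (hm.memLp f).toLp := by
    unfold mulOp
    rw [dif_pos hm]
    rfl
  rw [this]
  exact (hm.memLp f).coeFn_toLp

theorem norm_mulOp_le {m : ℝ → ℂ} (hm : BddSymbol m) {C : ℝ} (hC : ∀ η, ‖m η‖ ≤ C) (f : L2) :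
    ‖mulOp m f‖ ≤ C * ‖f‖ := by
  apply Lp.norm_le_mul_norm_of_ae_le_mul
  filter_upwards [coeFn_mulOp hm f] with η hη
  rw [hη, norm_mul]
  gcongr
  exact hC η

theorem mulOp_mulOp {m n : ℝ → ℂ} (hm : BddSymbol m) (hn : BddSymbol n) (f : L2) :
    mulOp m (mulOp n f) = mulOp (fun η => m η * n η) f := by
  apply Lp.ext
  filter_upwards [coeFn_mulOp hm (mulOp n f), coeFn_mulOp hn f, coeFn_mulOp (hm.mul hn) f]
    with η h1 h2 h3
  rw [h1, h2, h3, mul_assoc]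

theorem mulOp_comm {m n : ℝ → ℂ} (hm : BddSymbol m) (hn : BddSymbol n) (f : L2) :
    mulOp m (mulOp n f) = mulOp n (mulOp m f) := by
  rw [mulOp_mulOp hm hn, mulOp_mulOp hn hm]
  congr 2
  funext η
  ring

theorem bddSymbol_one : BddSymbol (fun _ => 1) := ⟨measurable_const, 1, by simp⟩

theorem mulOp_one (f : L2) : mulOp (fun _ => 1) f = f := by
  apply Lp.ext
  filter_upwards [coeFn_mulOp bddSymbol_one f] with η hη
  rw [hη, one_mul]

/-! ### The Fourier transform on `L²` -/

/-- The character `x ↦ exp(2 π i h x)`. -/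
noncomputable def chr (h x : ℝ) : ℂ := Complex.exp ((2 * Real.pi * h * x : ℝ) * Complex.I)

theorem norm_chr (h x : ℝ) : ‖chr h x‖ = 1 := Complex.norm_exp_ofReal_mul_I _

theorem continuous_chr (h : ℝ) : Continuous (chr h) := by unfold chr; fun_prop

theorem bddSymbol_chr (h : ℝ) : BddSymbol (chr h) :=
  ⟨(continuous_chr h).measurable, 1, fun η => (norm_chr h η).le⟩

theorem conj_chr (h x : ℝ) : (starRingEnd ℂ) (chr h x) = chr h (-x) := by
  unfold chr
  rw [← Complex.exp_conj, map_mul, Complex.conj_I, Complex.conj_ofReal]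
  congr 1
  push_cast
  ring

theorem conj_chr' (h x : ℝ) : (starRingEnd ℂ) (chr h x) = chr (-h) x := by
  unfold chr
  rw [← Complex.exp_conj, map_mul, Complex.conj_I, Complex.conj_ofReal]
  congr 1
  push_cast
  ring

theorem chr_comm (h x : ℝ) : chr h x = chr x h := by
  unfold chr
  congr 3
  ring

theorem chr_add_left (g h x : ℝ) : chr (g + h) x = chr g x * chr h x := by
  unfold chr
  rw [← Complex.exp_add]
  congr 1
  push_cast
  ring

theorem fourier_eq_integral_chr (f : ℝ → ℂ) (η : ℝ) : 𝓕 f η = ∫ x, chr (-η) x * f x := by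
  rw [Real.fourier_real_eq_integral_exp_smul]
  congr 1
  funext x
  simp only [chr, smul_eq_mul]
  congr 4
  ring

theorem fourierInv_eq_integral_chr (f : ℝ → ℂ) (x : ℝ) : 𝓕⁻ f x = ∫ η, chr x η * f η := by
  rw [Real.fourierInv_eq_fourier_neg, fourier_eq_integral_chr, neg_neg]

theorem integral_fourier_mul (f g : ℝ → ℂ) (hf : Integrable f) (hg : Integrable g) :
    ∫ η, 𝓕 f η * g η = ∫ x, f x * 𝓕 g x := by
  have := VectorFourier.integral_fourierIntegral_smul_eq_flip (L := innerₗ ℝ) (μ := volume)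
    (ν := volume) (f := f) (g := g) Real.continuous_fourierChar continuous_inner hf hg
  simpa using! this

/-- The tempered distribution given by an integrable function has as Fourier transform the
classical Fourier integral. -/
theorem represents_fourier_of_integrable {f : 𝓢'(ℝ, ℂ)} {v : ℝ → ℂ} (hf : Represents f v)
    (hv : Integrable v) : Represents (𝓕 f) (𝓕 v) := by
  intro χ
  have hc : Continuous (𝓕 v) := by
    exact VectorFourier.fourierIntegral_continuous Real.continuous_fourierChar
      (by exact continuous_inner) hv
  constructor
  · refine χ.integrable.mul_bdd (c := ∫ x, ‖v x‖) hc.aestronglyMeasurable ?_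
    filter_upwards with x
    exact VectorFourier.norm_fourierIntegral_le_integral_norm _ _ _ _ _
  · rw [TemperedDistribution.fourier_apply, hf.apply_eq, SchwartzMap.fourier_coe]
    exact integral_fourier_mul _ _ χ.integrable hv

theorem represents_fourier_coe (f : L2) : Represents (𝓕 (f : 𝓢'(ℝ, ℂ))) (𝓕 f : L2) := by
  rw [Lp.fourier_toTemperedDistribution_eq]
  exact represents_coe _

theorem coeFn_fourier_of_integrable {f : L2} (hf : Integrable f) :
    (𝓕 f : L2) =ᵐ[volume] 𝓕 (f : ℝ → ℂ) :=
  (represents_fourier_coe f).ae_eq (represents_fourier_of_integrable (represents_coe f) hf)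

/-- The analogue of `represents_fourier_of_integrable` for the inverse transform. -/
theorem represents_fourierInv_of_integrable {f : 𝓢'(ℝ, ℂ)} {v : ℝ → ℂ} (hf : Represents f v)
    (hv : Integrable v) : Represents (𝓕⁻ f) (𝓕⁻ v) := by
  have e : 𝓕⁻ v = 𝓕 (fun x => v (-x)) := Real.fourierInv_eq_fourier_comp_neg v
  have hv' : Integrable (fun x => v (-x)) := hv.comp_neg
  intro χ
  have hc : Continuous (𝓕⁻ v) := by
    rw [e]
    exact VectorFourier.fourierIntegral_continuous Real.continuous_fourierChar
      (by exact continuous_inner) hv'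
  constructor
  · refine χ.integrable.mul_bdd (c := ∫ x, ‖v (-x)‖) hc.aestronglyMeasurable ?_
    filter_upwards with x
    rw [e]
    exact VectorFourier.norm_fourierIntegral_le_integral_norm _ _ _ _ _
  · rw [TemperedDistribution.fourierInv_apply, hf.apply_eq, SchwartzMap.fourierInv_coe, e,
      ← integral_fourier_mul _ _ χ.integrable hv', ← integral_neg_eq_self]
    simp only [Real.fourierInv_eq_fourier_neg, neg_neg]

/-- Identities between continuous maps on `L²` need only be checked on `L¹ ∩ L²`, where the Fourier
transform is given by an integral. -/
theorem L2_ext_dense {Φ Ψ : L2 → L2} (hΦ : Continuous Φ) (hΨ : Continuous Ψ)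
    (h : ∀ f : L2, Integrable f → Φ f = Ψ f) : Φ = Ψ := by
  have hd := SchwartzMap.denseRange_toLpCLM (E := ℝ) (F := ℂ) (p := 2) (μ := volume)
    ENNReal.ofNat_ne_top
  refine DenseRange.equalizer hd hΦ hΨ (funext fun χ => ?_)
  apply h
  exact (χ.integrable (μ := volume)).congr (χ.coeFn_toLp 2 volume).symm

/-- Complex conjugation on `L²`. -/
noncomputable def conjL : L2 →L[ℝ] L2 := (Complex.conjCLE : ℂ →L[ℝ] ℂ).compLpL 2 volume

theorem coeFn_conjL (f : L2) : conjL f =ᵐ[volume] fun x => (starRingEnd ℂ) (f x) := by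
  filter_upwards [(Complex.conjCLE : ℂ →L[ℝ] ℂ).coeFn_compLpL (p := 2) (μ := volume) f] with x hx
  exact hx

/-- The map `f ↦ (x ↦ f (c - x))` on `L²`. -/
noncomputable def reflL (c : ℝ) : L2 →ₗᵢ[ℝ] L2 :=
  Lp.compMeasurePreservingₗᵢ ℝ (fun x => c - x) (Measure.measurePreserving_sub_left volume c)

theorem coeFn_reflL (c : ℝ) (f : L2) : reflL c f =ᵐ[volume] fun x => f (c - x) :=
  Lp.coeFn_compMeasurePreserving f (Measure.measurePreserving_sub_left volume c)

/-- The translation `f ↦ (x ↦ f (x + h))` on `L²`. -/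
noncomputable def transL (h : ℝ) : L2 →ₗᵢ[ℝ] L2 :=
  Lp.compMeasurePreservingₗᵢ ℝ (fun x => x + h) (measurePreserving_add_right volume h)

theorem coeFn_transL (h : ℝ) (f : L2) : transL h f =ᵐ[volume] fun x => f (x + h) :=
  Lp.coeFn_compMeasurePreserving f (measurePreserving_add_right volume h)

theorem continuous_fourier_L2 : Continuous (fun f : L2 => (𝓕 f : L2)) :=
  (Lp.fourierTransformₗᵢ ℝ ℂ).continuous

theorem fourier_transL (h : ℝ) (f : L2) : (𝓕 (transL h f) : L2) = mulOp (chr h) (𝓕 f) := by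
  have := L2_ext_dense (Φ := fun f => 𝓕 (transL h f)) (Ψ := fun f => mulOp (chr h) (𝓕 f))
    (continuous_fourier_L2.comp (transL h).continuous)
    ((mulOp (chr h)).continuous.comp continuous_fourier_L2) ?_
  · exact congrFun this f
  intro f hf
  have hi : Integrable (transL h f) :=
    (hf.comp_add_right h).congr (coeFn_transL h f).symm
  apply Lp.ext
  filter_upwards [coeFn_fourier_of_integrable hi, coeFn_mulOp (bddSymbol_chr h) (𝓕 f),
    coeFn_fourier_of_integrable hf] with η h1 h2 h3
  rw [h1, h2, h3, Real.fourier_congr_ae (coeFn_transL h f), fourier_eq_integral_chr,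
    fourier_eq_integral_chr, ← integral_const_mul,
    ← integral_add_right_eq_self (fun x => chr h η * (chr (-η) x * f x)) h]
  congr 1
  funext x
  rw [← mul_assoc]
  congr 1
  rw [chr_comm h η]
  simp only [chr, ← Complex.exp_add]
  congr 1
  push_cast
  ring

/-- The Fourier transform of `x ↦ exp(2 π i c x) * conj (f x)` is `ζ ↦ conj (f̂ (c - ζ))`. -/
theorem fourier_chr_conjL (c : ℝ) (f : L2) :
    (𝓕 (mulOp (chr c) (conjL f)) : L2) = conjL (reflL c (𝓕 f)) := by
  have := L2_ext_dense (Φ := fun f => 𝓕 (mulOp (chr c) (conjL f)))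
    (Ψ := fun f => conjL (reflL c (𝓕 f)))
    (continuous_fourier_L2.comp ((mulOp (chr c)).continuous.comp conjL.continuous))
    (conjL.continuous.comp ((reflL c).continuous.comp continuous_fourier_L2)) ?_
  · exact congrFun this f
  intro f hf
  have e1 : mulOp (chr c) (conjL f) =ᵐ[volume] fun x => chr c x * (starRingEnd ℂ) (f x) := by
    filter_upwards [coeFn_mulOp (bddSymbol_chr c) (conjL f), coeFn_conjL f] with x h1 h2
    rw [h1, h2]
  have hi : Integrable (mulOp (chr c) (conjL f)) := by
    refine Integrable.congr ?_ e1.symm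
    refine Integrable.bdd_mul (c := 1) ?_ (continuous_chr c).aestronglyMeasurable
      (Eventually.of_forall fun x => (norm_chr c x).le)
    exact (Complex.conjCLE : ℂ →L[ℝ] ℂ).integrable_comp hf
  have e3 := (Measure.measurePreserving_sub_left volume c).quasiMeasurePreserving.ae_eq_comp
    (coeFn_fourier_of_integrable hf)
  apply Lp.ext
  filter_upwards [coeFn_fourier_of_integrable hi, coeFn_conjL (reflL c (𝓕 f)),
    coeFn_reflL c (𝓕 f), e3] with η h1 h2 h3 h4
  simp only [Function.comp] at h4
  rw [h1, h2, h3, h4, Real.fourier_congr_ae e1, fourier_eq_integral_chr,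
    fourier_eq_integral_chr, ← integral_conj]
  congr 1
  funext x
  rw [map_mul, conj_chr', ← mul_assoc, ← chr_add_left]
  congr 2
  ring

theorem chr_zero_left (x : ℝ) : chr 0 x = 1 := by simp [chr]

theorem fourier_conjL (f : L2) : (𝓕 (conjL f) : L2) = conjL (reflL 0 (𝓕 f)) := by
  rw [← fourier_chr_conjL]
  congr 1
  have : chr 0 = fun _ => 1 := funext chr_zero_left
  rw [this, mulOp_one]

theorem coeFn_fourierInv_of_integrable {F : L2} (hF : Integrable F) :
    (𝓕⁻ F : L2) =ᵐ[volume] 𝓕⁻ (F : ℝ → ℂ) := by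
  refine Represents.ae_eq (f := 𝓕⁻ (F : 𝓢'(ℝ, ℂ))) ?_
    (represents_fourierInv_of_integrable (represents_coe F) hF)
  rw [Lp.fourierInv_toTemperedDistribution_eq]
  exact represents_coe _

/-- Parseval's formula for a product of two `L²` functions. -/
theorem integral_chr_mul_mul (c : ℝ) (f g : L2) :
    ∫ x, chr (-c) x * (f x * g x) = ∫ ζ, (𝓕 f : L2) (c - ζ) * (𝓕 g : L2) ζ := by
  have h := Lp.inner_fourier_eq (mulOp (chr c) (conjL f)) g
  rw [L2.inner_def, L2.inner_def, fourier_chr_conjL] at h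
  have e1 : ∫ x, chr (-c) x * (f x * g x) =
      ∫ x, inner ℂ ((mulOp (chr c) (conjL f) : L2) x) (g x) := by
    apply integral_congr_ae
    filter_upwards [coeFn_mulOp (bddSymbol_chr c) (conjL f), coeFn_conjL f] with x h1 h2
    rw [h1, h2]
    simp only [RCLike.inner_apply, map_mul, conj_chr', Complex.conj_conj]
    ring
  have e2 : ∫ ζ, (𝓕 f : L2) (c - ζ) * (𝓕 g : L2) ζ =
      ∫ ζ, inner ℂ ((conjL (reflL c (𝓕 f)) : L2) ζ) ((𝓕 g : L2) ζ) := by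
    apply integral_congr_ae
    filter_upwards [coeFn_conjL (reflL c (𝓕 f)), coeFn_reflL c (𝓕 f)] with x h1 h2
    rw [h1, h2]
    simp only [RCLike.inner_apply, Complex.conj_conj]
    ring
  rw [e1, e2, h]

/-! ### Sobolev norms of `L²` functions -/

/-- The square of the `H^σ` norm of an `L²` function (up to the factor `2π`). -/
noncomputable def hsq (σ : ℝ) (f : L2) : ℝ≥0∞ :=
  ∫⁻ η, ENNReal.ofReal (wt (2 * σ) η) * ‖(𝓕 f : L2) η‖ₑ ^ 2

/-- The square of the homogeneous `H^σ` seminorm of an `L²` function (up to the factor `2π`). -/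
noncomputable def homsq (σ : ℝ) (f : L2) : ℝ≥0∞ :=
  ∫⁻ η, ENNReal.ofReal (|2 * Real.pi * η| ^ (2 * σ)) * ‖(𝓕 f : L2) η‖ₑ ^ 2

theorem enorm_sq_eq_lintegral (f : L2) : ‖f‖ₑ ^ 2 = ∫⁻ x, ‖f x‖ₑ ^ 2 := by
  rw [Lp.enorm_def, eLpNorm_eq_lintegral_rpow_enorm_toReal (by norm_num) (by norm_num)]
  simp only [ENNReal.toReal_ofNat, ← ENNReal.rpow_natCast, ← ENNReal.rpow_mul]
  norm_num

theorem enorm_fourier (f : L2) : ‖(𝓕 f : L2)‖ₑ = ‖f‖ₑ := by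
  rw [← ofReal_norm, ← ofReal_norm, Lp.norm_fourier_eq]

theorem measurable_coe_L2 (f : L2) : Measurable (f : ℝ → ℂ) :=
  (Lp.stronglyMeasurable f).measurable

theorem hsq_zero (f : L2) : hsq 0 f = ‖f‖ₑ ^ 2 := by
  rw [← enorm_fourier, enorm_sq_eq_lintegral]
  simp [hsq, wt_zero]

theorem hsq_mono {σ τ : ℝ} (h : σ ≤ τ) (f : L2) : hsq σ f ≤ hsq τ f := by
  unfold hsq
  gcongr
  exact wt_mono (by linarith) _

theorem homsq_le_hsq {σ : ℝ} (hσ : 0 ≤ σ) (f : L2) : homsq σ f ≤ hsq σ f := by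
  unfold homsq hsq
  gcongr with η
  unfold wt
  rw [Real.rpow_mul (abs_nonneg _)]
  have : |2 * Real.pi * η| ^ (2 : ℝ) = (2 * Real.pi * η) ^ 2 := by
    rw [Real.rpow_two, sq_abs]
  rw [this, mul_div_cancel_left₀ _ (by norm_num)]
  exact Real.rpow_le_rpow (by positivity) (by linarith) hσ

theorem hsq_le_add_homsq {σ : ℝ} (hσ : 0 ≤ σ) (hσ1 : σ ≤ 1) (f : L2) :
    hsq σ f ≤ ‖f‖ₑ ^ 2 + homsq σ f := by
  rw [← hsq_zero]
  unfold homsq hsq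
  rw [← lintegral_add_left (by
    have := measurable_coe_L2 (𝓕 f : L2)
    have := measurable_wt (2 * 0)
    fun_prop)]
  refine lintegral_mono fun η => ?_
  simp only [← add_mul]
  gcongr
  rw [← ENNReal.ofReal_add (wt_pos _ _).le (by positivity)]
  apply ENNReal.ofReal_le_ofReal
  rw [mul_zero, wt_zero]
  unfold wt
  rw [Real.rpow_mul (abs_nonneg _)]
  have : |2 * Real.pi * η| ^ (2 : ℝ) = (2 * Real.pi * η) ^ 2 := by
    rw [Real.rpow_two, sq_abs]
  rw [this, mul_div_cancel_left₀ _ (by norm_num)]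
  refine (Real.rpow_add_le_add_rpow zero_le_one (by positivity) hσ hσ1).trans ?_
  simp

/-- Plancherel's formula for differences. -/
theorem enorm_transL_sub_sq (h : ℝ) (f : L2) :
    ‖transL h f - f‖ₑ ^ 2 = ∫⁻ η, ‖chr h η - 1‖ₑ ^ 2 * ‖(𝓕 f : L2) η‖ₑ ^ 2 := by
  rw [← enorm_fourier, enorm_sq_eq_lintegral]
  apply lintegral_congr_ae
  have e : (𝓕 (transL h f - f) : L2) = mulOp (chr h) (𝓕 f) - 𝓕 f := by
    rw [← fourier_transL]
    exact (Lp.fourierTransformₗᵢ ℝ ℂ).map_sub _ _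
  rw [e]
  filter_upwards [Lp.coeFn_sub (mulOp (chr h) (𝓕 f)) (𝓕 f : L2),
    coeFn_mulOp (bddSymbol_chr h) (𝓕 f)] with η h1 h2
  rw [h1, Pi.sub_apply, h2, ← mul_pow, ← enorm_mul]
  congr 2
  ring

theorem norm_chr_sub_one_le (h η : ℝ) : ‖chr h η - 1‖ ≤ |2 * Real.pi * h * η| := by
  have := Real.norm_exp_I_mul_ofReal_sub_one_le (x := 2 * Real.pi * h * η)
  rw [mul_comm] at this
  exact this

theorem norm_chr_sub_one_le_two (h η : ℝ) : ‖chr h η - 1‖ ≤ 2 := by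
  refine (norm_sub_le _ _).trans ?_
  rw [norm_chr]
  norm_num

theorem norm_chr_sub_one_abs (h η : ℝ) : ‖chr h |η| - 1‖ = ‖chr h η - 1‖ := by
  rcases abs_choice η with e | e
  · rw [e]
  · rw [e, ← conj_chr, ← Complex.norm_conj (chr h η - 1)]
    simp

theorem measurable_chr_uncurry : Measurable (fun p : ℝ × ℝ => chr p.1 p.2) := by
  unfold chr
  fun_prop

/-- The integral that relates differences and the homogeneous Sobolev seminorm. -/
noncomputable def gagliardo (s η : ℝ) : ℝ≥0∞ :=
  ∫⁻ h in Set.Ioi 0, ENNReal.ofReal (h ^ (-1 - 2 * s)) * ‖chr h η - 1‖ₑ ^ 2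

theorem lintegral_Ioi_comp_mul {c : ℝ} (hc : 0 < c) (F : ℝ → ℝ≥0∞) :
    ∫⁻ x in Set.Ioi 0, F x = ENNReal.ofReal c * ∫⁻ x in Set.Ioi 0, F (c * x) := by
  rw [← lintegral_indicator measurableSet_Ioi, ← lintegral_indicator measurableSet_Ioi]
  have h := Measure.map_addHaar_smul (volume : Measure ℝ) hc.ne'
  have e : ∀ x, (Set.Ioi (0 : ℝ)).indicator (fun x => F (c * x)) x =
      (Set.Ioi (0 : ℝ)).indicator F (c • x) := by
    intro x
    simp only [Set.indicator, Set.mem_Ioi, smul_eq_mul]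
    have : 0 < c * x ↔ 0 < x := mul_pos_iff_of_pos_left hc
    simp only [this]
  simp_rw [e]
  have h2 : ∫⁻ x, (Set.Ioi (0 : ℝ)).indicator F (c • x) =
      ∫⁻ y, (Set.Ioi (0 : ℝ)).indicator F y ∂(Measure.map (fun x : ℝ => c • x) volume) := by
    rw [← MeasurableEquiv.coe_smul₀ hc.ne', lintegral_map_equiv]
    simp
  rw [h2, h]
  simp only [Module.finrank_self, pow_one, lintegral_smul_measure, smul_eq_mul]
  rw [← mul_assoc, ← ENNReal.ofReal_mul hc.le, abs_of_pos (by positivity),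
    mul_inv_cancel₀ hc.ne']
  simp

/-- The homogeneity of `gagliardo`, by the substitution `h ↦ |η| h`. -/
theorem gagliardo_eq {s : ℝ} (hs : 0 < s) (η : ℝ) :
    gagliardo s η = ENNReal.ofReal (|η| ^ (2 * s)) * gagliardo s 1 := by
  rcases eq_or_ne η 0 with rfl | hη
  · have : (0 : ℝ) ^ (2 * s) = 0 := Real.zero_rpow (by positivity)
    simp [gagliardo, chr, this]
  have hη' : 0 < |η| := abs_pos.mpr hη
  unfold gagliardo
  rw [lintegral_Ioi_comp_mul hη' (fun h => ENNReal.ofReal (h ^ (-1 - 2 * s)) * ‖chr h 1 - 1‖ₑ ^ 2),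
    ← mul_assoc, ← ENNReal.ofReal_mul (by positivity),
        ← lintegral_const_mul' _ _ ENNReal.ofReal_ne_top]
  apply setLIntegral_congr_fun measurableSet_Ioi
  intro h hh
  have hh' : (0 : ℝ) < h := hh
  simp only
  rw [← mul_assoc, ← ENNReal.ofReal_mul (by positivity)]
  have e1 : h ^ (-1 - 2 * s) = |η| ^ (2 * s) * |η| * (|η| * h) ^ (-1 - 2 * s) := by
    rw [Real.mul_rpow hη'.le hh'.le, ← Real.rpow_add_one hη'.ne', ← mul_assoc,
      ← Real.rpow_add hη']
    have : 2 * s + 1 + (-1 - 2 * s) = 0 := by ring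
    rw [this, Real.rpow_zero, one_mul]
  have e2 : chr (|η| * h) 1 = chr h |η| := by
    unfold chr
    congr 3
    ring
  rw [e2, ← ofReal_norm, ← ofReal_norm (chr h |η| - 1), norm_chr_sub_one_abs]
  congr 2

/-- The integrand is `O(h^(1-2s))` at `0` and `O(h^(-1-2s))` at infinity. -/
theorem gagliardo_one_lt_top {s : ℝ} (hs : 0 < s) (hs1 : s < 1) : gagliardo s 1 < ∞ := by
  unfold gagliardo
  rw [← Set.Ioc_union_Ioi_eq_Ioi (zero_le_one (α := ℝ)),
    lintegral_union measurableSet_Ioi (by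
      rw [Set.disjoint_left]; intro x hx hx'; exact not_lt.mpr hx.2 hx')]
  apply ENNReal.add_lt_top.mpr ⟨?_, ?_⟩
  · have h1 : IntegrableOn (fun h : ℝ => (2 * Real.pi) ^ 2 * h ^ (1 - 2 * s)) (Set.Ioc 0 1) := by
      apply Integrable.const_mul
      have := intervalIntegral.intervalIntegrable_rpow' (a := 0) (b := 1)
        (show -1 < 1 - 2 * s by linarith)
      rwa [intervalIntegrable_iff_integrableOn_Ioc_of_le zero_le_one] at this
    refine lt_of_le_of_lt ?_ h1.lintegral_lt_top
    apply setLIntegral_mono' measurableSet_Ioc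
    intro h hh
    have hh0 : 0 < h := hh.1
    rw [← ofReal_norm, ← ENNReal.ofReal_pow (norm_nonneg _), ← ENNReal.ofReal_mul (by positivity)]
    apply ENNReal.ofReal_le_ofReal
    calc h ^ (-1 - 2 * s) * ‖chr h 1 - 1‖ ^ 2
        ≤ h ^ (-1 - 2 * s) * |2 * Real.pi * h * 1| ^ 2 := by
          gcongr; exact norm_chr_sub_one_le _ _
      _ = (2 * Real.pi) ^ 2 * (h ^ (-1 - 2 * s) * h ^ (2 : ℝ)) := by
          rw [sq_abs, Real.rpow_two]; ring
      _ = _ := by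
          rw [← Real.rpow_add hh0]; congr 2; ring
  · have h1 : IntegrableOn (fun h : ℝ => 4 * h ^ (-1 - 2 * s)) (Set.Ioi 1) := by
      apply Integrable.const_mul
      exact integrableOn_Ioi_rpow_of_lt (by linarith) zero_lt_one
    refine lt_of_le_of_lt ?_ h1.lintegral_lt_top
    apply setLIntegral_mono' measurableSet_Ioi
    intro h hh
    have hh0 : 0 < h := zero_lt_one.trans hh
    rw [← ofReal_norm, ← ENNReal.ofReal_pow (norm_nonneg _), ← ENNReal.ofReal_mul (by positivity)]
    apply ENNReal.ofReal_le_ofReal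
    rw [mul_comm]
    gcongr
    calc ‖chr h 1 - 1‖ ^ 2 ≤ 2 ^ 2 := by gcongr; exact norm_chr_sub_one_le_two _ _
      _ = 4 := by norm_num

theorem chr_ne_one {h : ℝ} (h0 : 0 < h) (h1 : h < 1) : chr h 1 ≠ 1 := by
  unfold chr
  rw [Ne, Complex.exp_eq_one_iff]
  rintro ⟨n, hn⟩
  have : (h : ℂ) = n := by
    have h2 : (2 * Real.pi * Complex.I : ℂ) ≠ 0 := Complex.two_pi_I_ne_zero
    apply mul_right_cancel₀ h2
    rw [← hn]
    push_cast
    ring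
  have h3 : h = n := by exact_mod_cast this
  rw [h3] at h0 h1
  have a : 0 < n := by exact_mod_cast h0
  have b : n < 1 := by exact_mod_cast h1
  omega

theorem gagliardo_one_ne_zero (s : ℝ) : gagliardo s 1 ≠ 0 := by
  unfold gagliardo
  have hm : Measurable (fun h : ℝ => ENNReal.ofReal (h ^ (-1 - 2 * s)) * ‖chr h 1 - 1‖ₑ ^ 2) := by
    unfold chr
    fun_prop
  rw [Ne, lintegral_eq_zero_iff hm]
  intro h0
  have h1 : ∀ᵐ h ∂volume, h ∈ Set.Ioi (0 : ℝ) →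
      ENNReal.ofReal (h ^ (-1 - 2 * s)) * ‖chr h 1 - 1‖ₑ ^ 2 = 0 :=
    (ae_restrict_iff' measurableSet_Ioi).mp h0
  have h2 : volume (Set.Ioo (0 : ℝ) 1) = 0 := by
    refine measure_mono_null (fun h hh => ?_) h1
    simp only [Set.mem_compl_iff, Set.mem_ofPred_eq, Classical.not_imp]
    refine ⟨hh.1, ?_⟩
    have h3 := Real.rpow_pos_of_pos hh.1 (-1 - 2 * s)
    have h4 : chr h 1 - 1 ≠ 0 := sub_ne_zero.mpr (chr_ne_one hh.1 hh.2)
    simp [h4, h3]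
  simp at h2

/-- The homogeneous seminorm in terms of differences (Gagliardo's seminorm). The differences are
not increased by Lipschitz maps, up to the Lipschitz constant. -/
theorem lintegral_transL_sub (s : ℝ) (hs : 0 < s) (f : L2) :
    ∫⁻ h in Set.Ioi 0, ENNReal.ofReal (h ^ (-1 - 2 * s)) * ‖transL h f - f‖ₑ ^ 2 =
      gagliardo s 1 * ENNReal.ofReal ((2 * Real.pi) ^ (-(2 * s))) * homsq s f := by
  have hmf := measurable_coe_L2 (𝓕 f : L2)
  simp_rw [enorm_transL_sub_sq]
  have e1 : ∀ h : ℝ,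
      ENNReal.ofReal (h ^ (-1 - 2 * s)) * ∫⁻ η, ‖chr h η - 1‖ₑ ^ 2 * ‖(𝓕 f : L2) η‖ₑ ^ 2
      = ∫⁻ η, ENNReal.ofReal (h ^ (-1 - 2 * s)) * ‖chr h η - 1‖ₑ ^ 2 * ‖(𝓕 f : L2) η‖ₑ ^ 2 := by
    intro h
    rw [← lintegral_const_mul' _ _ ENNReal.ofReal_ne_top]
    simp_rw [mul_assoc]
  simp_rw [e1]
  rw [lintegral_lintegral_swap]
  · unfold homsq
    rw [← lintegral_const_mul _ (by fun_prop)]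
    apply lintegral_congr
    intro η
    rw [lintegral_mul_const _ (by unfold chr; fun_prop)]
    change gagliardo s η * _ = _
    rw [gagliardo_eq hs, ← mul_assoc]
    congr 1
    rw [abs_mul, Real.mul_rpow (abs_nonneg _) (abs_nonneg _), 
      abs_of_pos (by positivity : 0 < 2 * Real.pi), mul_comm, mul_assoc, ← ENNReal.ofReal_mul
          (by positivity)]
    congr 2
    rw [← mul_assoc, ← Real.rpow_add (by positivity)]
    simp
  · apply Measurable.aemeasurable
    have := measurable_chr_uncurry
    simp only [Function.uncurry_def]
    fun_prop

theorem homsq_le_of_lt_one {s : ℝ} (hs : 0 < s) (hs1 : s < 1) {f g : L2} {K : NNReal}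
    (h : ∀ t, ‖transL t g - g‖ₑ ≤ K * ‖transL t f - f‖ₑ) : homsq s g ≤ K ^ 2 * homsq s f := by
  set c := gagliardo s 1 * ENNReal.ofReal ((2 * Real.pi) ^ (-(2 * s))) with hc
  have hc0 : c ≠ 0 := by
    apply mul_ne_zero (gagliardo_one_ne_zero s)
    simp only [ne_eq, ENNReal.ofReal_eq_zero, not_le]
    positivity
  have hct : c ≠ ∞ := ENNReal.mul_ne_top (gagliardo_one_lt_top hs hs1).ne ENNReal.ofReal_ne_top
  have h1 : c * homsq s g ≤ c * (K ^ 2 * homsq s f) := by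
    rw [mul_left_comm, hc, ← lintegral_transL_sub s hs, ← lintegral_transL_sub s hs,
      ← lintegral_const_mul' _ _ (by finiteness)]
    refine lintegral_mono fun t => ?_
    simp only
    rw [mul_left_comm, ← mul_pow]
    gcongr
    exact h t
  exact (ENNReal.mul_le_mul_iff_right hc0 hct).mp h1

theorem tendsto_chr_quotient (η : ℝ) :
    Tendsto (fun n : ℕ => ((n + 1 : ℝ) : ℂ) * (chr (1 / (n + 1)) η - 1)) atTop
      (𝓝 (((2 * Real.pi * η : ℝ) : ℂ) * Complex.I)) := by
  have h1 : HasDerivAt (fun h : ℝ => chr h η) (((2 * Real.pi * η : ℝ) : ℂ) * Complex.I) 0 := by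
    have h2 : HasDerivAt (fun h : ℝ => ((2 * Real.pi * h * η : ℝ) : ℂ) * Complex.I)
        (((2 * Real.pi * η : ℝ) : ℂ) * Complex.I) 0 := by
      apply HasDerivAt.mul_const
      apply HasDerivAt.ofReal_comp
      have := ((hasDerivAt_id (0 : ℝ)).const_mul (2 * Real.pi)).mul_const η
      simpa using this
    have := h2.cexp
    simpa [chr] using this
  have h3 := h1.tendsto_slope_zero
  have h4 : Tendsto (fun n : ℕ => (1 / ((n : ℝ) + 1))) atTop (𝓝[≠] 0) := by
    rw [tendsto_nhdsWithin_iff]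
    refine ⟨tendsto_one_div_add_atTop_nhds_zero_nat, Eventually.of_forall fun n => ?_⟩
    have : (0 : ℝ) < 1 / ((n : ℝ) + 1) := by positivity
    exact this.ne'
  refine (h3.comp h4).congr fun n => ?_
  simp [chr]

/-- The case `s = 1`, where the integral `gagliardo` diverges. It follows by applying Fatou's lemma
to the difference quotients. -/
theorem homsq_one_le {f g : L2} {K : NNReal}
    (h : ∀ t, ‖transL t g - g‖ₑ ≤ K * ‖transL t f - f‖ₑ) : homsq 1 g ≤ K ^ 2 * homsq 1 f := by
  have hmg := measurable_coe_L2 (𝓕 g : L2)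
  have e : homsq 1 g = ∫⁻ η, liminf (fun n : ℕ =>
      ‖((n + 1 : ℝ) : ℂ) * (chr (1 / (n + 1)) η - 1)‖ₑ ^ 2 * ‖(𝓕 g : L2) η‖ₑ ^ 2) atTop := by
    unfold homsq
    apply lintegral_congr
    intro η
    have h1 : Tendsto (fun n : ℕ => ‖((n + 1 : ℝ) : ℂ) * (chr (1 / (n + 1)) η - 1)‖ₑ ^ 2
        * ‖(𝓕 g : L2) η‖ₑ ^ 2) atTop
        (𝓝 (‖((2 * Real.pi * η : ℝ) : ℂ) * Complex.I‖ₑ ^ 2 * ‖(𝓕 g : L2) η‖ₑ ^ 2)) :=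
      ENNReal.Tendsto.mul_const (((ENNReal.continuous_pow 2).tendsto _).comp
        ((tendsto_chr_quotient η).enorm)) (Or.inr (by finiteness))
    rw [h1.liminf_eq]
    congr 1
    rw [← ofReal_norm, ← ENNReal.ofReal_pow (norm_nonneg _), norm_mul, Complex.norm_I, mul_one,
      Complex.norm_real, Real.norm_eq_abs]
    norm_num
  rw [e]
  refine (lintegral_liminf_le fun n => by unfold chr; fun_prop).trans ?_
  apply liminf_le_of_le
  · isBoundedDefault
  intro b hb
  obtain ⟨n, hn⟩ := hb.exists
  refine hn.trans ?_
  have e2 : ∀ u : L2,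
      ∫⁻ η, ‖((n + 1 : ℝ) : ℂ) * (chr (1 / (n + 1)) η - 1)‖ₑ ^ 2 * ‖(𝓕 u : L2) η‖ₑ ^ 2
      = ‖((n + 1 : ℝ) : ℂ)‖ₑ ^ 2 * ‖transL (1 / (n + 1)) u - u‖ₑ ^ 2 := by
    intro u
    rw [enorm_transL_sub_sq, ← lintegral_const_mul' _ _ (by finiteness)]
    simp_rw [enorm_mul, mul_pow, mul_assoc]
  rw [e2]
  calc ‖((n + 1 : ℝ) : ℂ)‖ₑ ^ 2 * ‖transL (1 / (n + 1)) g - g‖ₑ ^ 2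
      ≤ ‖((n + 1 : ℝ) : ℂ)‖ₑ ^ 2 * (K * ‖transL (1 / (n + 1)) f - f‖ₑ) ^ 2 := by
        gcongr; exact h _
    _ = K ^ 2 * ∫⁻ η, ‖((n + 1 : ℝ) : ℂ) * (chr (1 / (n + 1)) η - 1)‖ₑ ^ 2 *
        ‖(𝓕 f : L2) η‖ₑ ^ 2 := by
        rw [e2]; ring
    _ ≤ K ^ 2 * homsq 1 f := by
        gcongr
        refine lintegral_mono fun η => ?_
        simp only
        gcongr
        rw [← ofReal_norm, ← ENNReal.ofReal_pow (norm_nonneg _)]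
        apply ENNReal.ofReal_le_ofReal
        have h5 := norm_chr_sub_one_le (1 / (n + 1)) η
        have h6 : |2 * Real.pi * (1 / ((n : ℝ) + 1)) * η| = |2 * Real.pi * η| / (n + 1) := by
          have : 2 * Real.pi * (1 / ((n : ℝ) + 1)) * η = 2 * Real.pi * η / (n + 1) := by ring
          rw [this, abs_div, abs_of_pos (by positivity : (0 : ℝ) < n + 1)]
        rw [h6, le_div_iff₀ (by positivity)] at h5
        rw [norm_mul, Complex.norm_real, Real.norm_eq_abs, 
          abs_of_pos (by positivity : (0 : ℝ) < n + 1), mul_one, Real.rpow_two]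
        gcongr
        rw [mul_comm]
        exact h5

/-- Nonlinear Lipschitz maps preserve `H^s` for `0 < s ≤ 1`. -/
theorem hsq_compLp_le {s : ℝ} (hs : 0 < s) (hs1 : s ≤ 1) {G : ℂ → ℂ} {K : NNReal}
    (hG : LipschitzWith K G) (hG0 : G 0 = 0) (f : L2) :
    hsq s (hG.compLp hG0 f) ≤ 2 * K ^ 2 * hsq s f := by
  have h : ∀ t, ‖transL t (hG.compLp hG0 f) - hG.compLp hG0 f‖ₑ ≤ K * ‖transL t f - f‖ₑ := by
    intro t
    have e : transL t (hG.compLp hG0 f) = hG.compLp hG0 (transL t f) := by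
      apply Lp.ext
      have h3 := (measurePreserving_add_right (volume : Measure ℝ)
        t).quasiMeasurePreserving.ae_eq_comp (hG.coeFn_compLp hG0 f)
      filter_upwards [coeFn_transL t (hG.compLp hG0 f), coeFn_transL t f,
        hG.coeFn_compLp hG0 (transL t f), h3] with x h1 h2 h3 h4
      simp only [Function.comp] at h3 h4
      rw [h1, h3, h2, h4]
    rw [e]
    have := hG.norm_compLp_sub_le hG0 (transL t f) f
    rw [← ofReal_norm, ← ofReal_norm, ← ENNReal.ofReal_coe_nnreal,
        ← ENNReal.ofReal_mul K.coe_nonneg]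
    exact ENNReal.ofReal_le_ofReal this
  have h2 : homsq s (hG.compLp hG0 f) ≤ K ^ 2 * homsq s f := by
    rcases hs1.eq_or_lt with rfl | hs1
    · exact homsq_one_le h
    · exact homsq_le_of_lt_one hs hs1 h
  have h3 : ‖hG.compLp hG0 f‖ₑ ≤ K * ‖f‖ₑ := by
    rw [← ofReal_norm, ← ofReal_norm, ← ENNReal.ofReal_coe_nnreal,
        ← ENNReal.ofReal_mul K.coe_nonneg]
    exact ENNReal.ofReal_le_ofReal (hG.norm_compLp_le hG0 f)
  calc hsq s (hG.compLp hG0 f) ≤ ‖hG.compLp hG0 f‖ₑ ^ 2 + homsq s (hG.compLp hG0 f) :=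
        hsq_le_add_homsq hs.le hs1 _
    _ ≤ (K * ‖f‖ₑ) ^ 2 + K ^ 2 * homsq s f := by gcongr
    _ ≤ K ^ 2 * hsq s f + K ^ 2 * hsq s f := by
        rw [mul_pow, ← hsq_zero]
        gcongr
        · exact hsq_mono hs.le f
        · exact homsq_le_hsq hs.le f
    _ = _ := by ring

/-! ### Sobolev embedding and products -/

theorem sq_lintegral_mul_le {α : Type*} [MeasurableSpace α] (μ : Measure α) {F H : α → ℝ≥0∞}
    (hF : AEMeasurable F μ) (hH : AEMeasurable H μ) :
    (∫⁻ x, F x * H x ∂μ) ^ 2 ≤ (∫⁻ x, F x ^ 2 ∂μ) * ∫⁻ x, H x ^ 2 ∂μ := by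
  have h := ENNReal.lintegral_mul_le_Lp_mul_Lq μ Real.HolderConjugate.two_two hF hH
  calc (∫⁻ x, F x * H x ∂μ) ^ 2 ≤ ((∫⁻ x, F x ^ (2 : ℝ) ∂μ) ^ (1 / 2 : ℝ) *
        (∫⁻ x, H x ^ (2 : ℝ) ∂μ) ^ (1 / 2 : ℝ)) ^ 2 := by gcongr; exact h
    _ = _ := by
      rw [mul_pow, ← ENNReal.rpow_natCast, ← ENNReal.rpow_natCast, ← ENNReal.rpow_mul,
        ← ENNReal.rpow_mul]
      norm_num

/-- Young's inequality `‖F * H‖₂ ≤ ‖F‖₁ ‖H‖₂`. -/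
theorem lintegral_sq_convolution_le {F H : ℝ → ℝ≥0∞} (hF : Measurable F) (hH : Measurable H) :
    ∫⁻ η, (∫⁻ ζ, F (η - ζ) * H ζ) ^ 2 ≤ (∫⁻ x, F x) ^ 2 * ∫⁻ x, H x ^ 2 := by
  have h1 : ∀ η, (∫⁻ ζ, F (η - ζ) * H ζ) ^ 2 ≤ (∫⁻ x, F x) * ∫⁻ ζ, F (η - ζ) * H ζ ^ 2 := by
    intro η
    have h2 := sq_lintegral_mul_le volume (F := fun ζ => F (η - ζ) ^ (1 / 2 : ℝ))
      (H := fun ζ => F (η - ζ) ^ (1 / 2 : ℝ) * H ζ) (by fun_prop) (by fun_prop)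
    have e : ∀ x : ℝ≥0∞, (x ^ (1 / 2 : ℝ)) ^ 2 = x := fun x => by
      rw [← ENNReal.rpow_natCast, ← ENNReal.rpow_mul]; norm_num
    simp only [← mul_assoc, ← sq, e, mul_pow] at h2
    rwa [lintegral_sub_left_eq_self F η] at h2
  calc ∫⁻ η, (∫⁻ ζ, F (η - ζ) * H ζ) ^ 2
      ≤ ∫⁻ η, (∫⁻ x, F x) * ∫⁻ ζ, F (η - ζ) * H ζ ^ 2 := lintegral_mono h1
    _ = (∫⁻ x, F x) * ∫⁻ η, ∫⁻ ζ, F (η - ζ) * H ζ ^ 2 := by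
        rw [lintegral_const_mul]
        exact Measurable.lintegral_prod_right' (f := fun p : ℝ × ℝ => F (p.1 - p.2) * H p.2 ^ 2)
            (by fun_prop)
    _ = (∫⁻ x, F x) * ∫⁻ ζ, ∫⁻ η, F (η - ζ) * H ζ ^ 2 := by
        rw [lintegral_lintegral_swap]
        simp only [Function.uncurry_def]
        fun_prop
    _ = (∫⁻ x, F x) * ∫⁻ ζ, (∫⁻ x, F x) * H ζ ^ 2 := by
        congr 1
        apply lintegral_congr
        intro ζ
        rw [lintegral_mul_const _ (by fun_prop), lintegral_sub_right_eq_self F ζ]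
    _ = _ := by
        rw [lintegral_const_mul _ (by fun_prop)]; ring

theorem lintegral_convolution_comm {F H : ℝ → ℝ≥0∞} (η : ℝ) :
    ∫⁻ ζ, F (η - ζ) * H ζ = ∫⁻ ζ, H (η - ζ) * F ζ := by
  rw [← lintegral_sub_left_eq_self (fun ζ => F (η - ζ) * H ζ) η]
  apply lintegral_congr
  intro ζ
  rw [sub_sub_cancel, mul_comm]

/-- The constant in the Sobolev embedding `H^σ ⊂ L^∞`. -/
noncomputable def embConst (σ : ℝ) : ℝ≥0∞ := ∫⁻ η, ENNReal.ofReal (wt (-(2 * σ)) η)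

theorem embConst_lt_top {σ : ℝ} (hσ : 1 / 2 < σ) : embConst σ < ∞ := by
  unfold embConst
  have h1 : Integrable (fun x : ℝ => (1 + ‖x‖ ^ 2) ^ (-(2 * σ) / 2)) :=
    integrable_rpow_neg_one_add_norm_sq (by simpa using by linarith)
  have h2 := h1.comp_mul_left' (R := 2 * Real.pi) (by positivity)
  refine Integrable.lintegral_lt_top (h2.congr ?_)
  filter_upwards with η
  simp only [wt, Real.norm_eq_abs, sq_abs]

/-- The Fourier transform of an element of `H^τ` is integrable against the weight of order `ν`
if `ν < τ - 1/2`. -/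
theorem sq_lintegral_wt_le (ν τ : ℝ) (f : L2) :
    (∫⁻ η, ENNReal.ofReal (wt ν η) * ‖(𝓕 f : L2) η‖ₑ) ^ 2 ≤ embConst (τ - ν) * hsq τ f := by
  have hmf := measurable_coe_L2 (𝓕 f : L2)
  have hw := measurable_wt
  have h := sq_lintegral_mul_le volume (F := fun η => ENNReal.ofReal (wt (ν - τ) η))
    (H := fun η => ENNReal.ofReal (wt τ η) * ‖(𝓕 f : L2) η‖ₑ)
    ((hw _).ennreal_ofReal.aemeasurable)
    (((hw _).ennreal_ofReal.mul hmf.enorm).aemeasurable)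
  have e1 : ∀ η, ENNReal.ofReal (wt (ν - τ) η) * (ENNReal.ofReal (wt τ η) * ‖(𝓕 f : L2) η‖ₑ) =
      ENNReal.ofReal (wt ν η) * ‖(𝓕 f : L2) η‖ₑ := by
    intro η
    rw [← mul_assoc, ← ENNReal.ofReal_mul (wt_pos _ _).le, ← wt_add]
    congr 3
    ring
  have e2 : ∀ η, ENNReal.ofReal (wt (ν - τ) η) ^ 2 = ENNReal.ofReal (wt (-(2 * (τ - ν))) η) := by
    intro η
    rw [← ENNReal.ofReal_pow (wt_pos _ _).le, sq, ← wt_add]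
    congr 2
    ring
  have e3 : ∀ η, (ENNReal.ofReal (wt τ η) * ‖(𝓕 f : L2) η‖ₑ) ^ 2 =
      ENNReal.ofReal (wt (2 * τ) η) * ‖(𝓕 f : L2) η‖ₑ ^ 2 := by
    intro η
    rw [mul_pow, ← ENNReal.ofReal_pow (wt_pos _ _).le, sq, ← wt_add]
    congr 3
    ring
  simp only [e1, e2, e3] at h
  exact h

theorem sq_lintegral_fourier_le (σ : ℝ) (f : L2) :
    (∫⁻ η, ‖(𝓕 f : L2) η‖ₑ) ^ 2 ≤ embConst σ * hsq σ f := by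
  have := sq_lintegral_wt_le 0 σ f
  simpa [wt_zero] using this

theorem ae_enorm_le_lintegral_fourier (f : L2) : ∀ᵐ x, ‖f x‖ₑ ≤ ∫⁻ η, ‖(𝓕 f : L2) η‖ₑ := by
  rcases eq_or_ne (∫⁻ η, ‖(𝓕 f : L2) η‖ₑ) ∞ with h | h
  · rw [h]; simp
  have hi : Integrable (𝓕 f : L2) := ⟨Lp.aestronglyMeasurable _, lt_top_iff_ne_top.mpr h⟩
  have h1 := coeFn_fourierInv_of_integrable hi
  rw [FourierTransform.fourierInv_fourier_eq] at h1
  filter_upwards [h1] with x hx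
  rw [hx, fourierInv_eq_integral_chr]
  refine (enorm_integral_le_lintegral_enorm _).trans_eq ?_
  apply lintegral_congr
  intro η
  rw [enorm_mul, ← ofReal_norm (chr x η), norm_chr]
  simp

/-- The Sobolev embedding. -/
theorem ae_enorm_sq_le (σ : ℝ) (f : L2) : ∀ᵐ x, ‖f x‖ₑ ^ 2 ≤ embConst σ * hsq σ f := by
  filter_upwards [ae_enorm_le_lintegral_fourier f] with x hx
  exact le_trans (by gcongr) (sq_lintegral_fourier_le σ f)

/-- The weight at `η = (η - ζ) + ζ` is bounded by the weight at the larger one of the two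
summands. -/
theorem wt_le_split {σ θ : ℝ} (hθ : 0 ≤ θ) (hσ : θ ≤ σ) (η ζ : ℝ) :
    wt θ η ≤ 2 ^ θ * (wt θ ζ + wt σ (η - ζ) * wt (θ - σ) ζ) := by
  have key : ∀ x y : ℝ, |x| ≤ |y| → wt θ (x + y) ≤ 2 ^ θ * wt θ y := by
    intro x y hxy
    unfold wt
    have h2 : (2 : ℝ) ^ θ = 4 ^ (θ / 2) := by
      rw [show (4 : ℝ) = 2 ^ (2 : ℝ) by norm_num, ← Real.rpow_mul (by norm_num)]
      congr 1; ring
    rw [h2, ← Real.mul_rpow (by norm_num) (by positivity)]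
    apply Real.rpow_le_rpow (by positivity) _ (by positivity)
    have h3 : (x + y) ^ 2 ≤ 4 * y ^ 2 := by
      have := sq_le_sq.mpr hxy
      nlinarith [sq_nonneg (x - y)]
    nlinarith [mul_le_mul_of_nonneg_left h3 (sq_nonneg (2 * Real.pi))]
  have hp : ∀ a b, 0 ≤ wt a b := fun a b => (wt_pos a b).le
  have h2θ : (0 : ℝ) ≤ 2 ^ θ := by positivity
  rcases le_total |η - ζ| |ζ| with h | h
  · have := key _ _ h
    rw [sub_add_cancel] at this
    refine this.trans ?_
    gcongr
    nlinarith [mul_nonneg (hp σ (η - ζ)) (hp (θ - σ) ζ)]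
  · have := key _ _ h
    rw [add_sub_cancel] at this
    refine this.trans ?_
    gcongr
    have h4 : wt (θ - σ) (η - ζ) ≤ wt (θ - σ) ζ := by
      unfold wt
      apply Real.rpow_le_rpow_of_nonpos (by positivity) _ (by linarith)
      have := sq_le_sq.mpr h
      rw [mul_pow (2 * Real.pi) ζ, mul_pow (2 * Real.pi) (η - ζ)]
      gcongr
    have h5 : wt θ (η - ζ) = wt σ (η - ζ) * wt (θ - σ) (η - ζ) := by
      rw [← wt_add]; congr 1; ring
    rw [h5]
    nlinarith [hp θ ζ, mul_le_mul_of_nonneg_left h4 (hp σ (η - ζ))]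

/-- The Fourier transform of a product is bounded by the convolution of the Fourier transforms. -/
theorem enorm_fourier_mul_le {a b c : L2} (hc : c =ᵐ[volume] fun x => a x * b x) :
    ∀ᵐ η, ‖(𝓕 c : L2) η‖ₑ ≤ ∫⁻ ζ, ‖(𝓕 a : L2) (η - ζ)‖ₑ * ‖(𝓕 b : L2) ζ‖ₑ := by
  have hi : Integrable c :=
      (MemLp.integrable_mul (p := 2) (q := 2) (Lp.memLp a) (Lp.memLp b)).congr hc.symm
  filter_upwards [coeFn_fourier_of_integrable hi] with η hη
  rw [hη, Real.fourier_congr_ae hc, fourier_eq_integral_chr, integral_chr_mul_mul]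
  refine (enorm_integral_le_lintegral_enorm _).trans_eq ?_
  simp_rw [enorm_mul]

/-- `H^σ · H^θ ⊂ H^θ` for `σ > 1/2` and `0 ≤ θ ≤ σ`. -/
theorem hsq_mul_le {σ θ : ℝ} (hθ : 0 ≤ θ) (hσ : θ ≤ σ) {a b c : L2}
    (hc : c =ᵐ[volume] fun x => a x * b x) :
    hsq θ c ≤ ENNReal.ofReal (4 * 4 ^ θ) * (embConst σ * hsq σ a * hsq θ b) := by
  have ha := measurable_coe_L2 (𝓕 a : L2)
  have hb := measurable_coe_L2 (𝓕 b : L2)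
  have hw := measurable_wt
  set A := fun η => ‖(𝓕 a : L2) η‖ₑ with hA
  set B := fun η => ‖(𝓕 b : L2) η‖ₑ with hB
  have hAm : Measurable A := ha.enorm
  have hBm : Measurable B := hb.enorm
  set W := fun ν η => ENNReal.ofReal (wt ν η) with hW
  have hWm : ∀ ν, Measurable (W ν) := fun ν => (hw ν).ennreal_ofReal
  have hWsq : ∀ ν η, W ν η ^ 2 = W (2 * ν) η := by
    intro ν η
    simp only [hW]
    rw [← ENNReal.ofReal_pow (wt_pos _ _).le, sq, ← wt_add]
    congr 2
    ring
  have h1 : ∀ᵐ η, W (2 * θ) η * ‖(𝓕 c : L2) η‖ₑ ^ 2 ≤ ENNReal.ofReal (2 * 4 ^ θ) *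
      ((∫⁻ ζ, A (η - ζ) * (W θ ζ * B ζ)) ^ 2 +
        (∫⁻ ζ, (W (θ - σ) (η - ζ) * B (η - ζ)) * (W σ ζ * A ζ)) ^ 2) := by
    filter_upwards [enorm_fourier_mul_le hc] with η hη
    have h2 : W θ η * ‖(𝓕 c : L2) η‖ₑ ≤ ENNReal.ofReal (2 ^ θ) *
        ((∫⁻ ζ, A (η - ζ) * (W θ ζ * B ζ)) +
        ∫⁻ ζ, (W (θ - σ) (η - ζ) * B (η - ζ)) * (W σ ζ * A ζ)) := by
      rw [lintegral_convolution_comm (F := fun x => W (θ - σ) x * B x),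
        ← lintegral_add_left (by fun_prop), ← lintegral_const_mul' _ _ ENNReal.ofReal_ne_top]
      calc W θ η * ‖(𝓕 c : L2) η‖ₑ ≤ W θ η * ∫⁻ ζ, A (η - ζ) * B ζ := by gcongr
        _ = ∫⁻ ζ, W θ η * (A (η - ζ) * B ζ) := by
            rw [lintegral_const_mul' _ _ ENNReal.ofReal_ne_top]
        _ ≤ _ := by
            refine lintegral_mono fun ζ => ?_
            have h3 : W θ η ≤ ENNReal.ofReal (2 ^ θ) * (W θ ζ + W σ (η - ζ) * W (θ - σ) ζ) := by
              simp only [hW]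
              rw [← ENNReal.ofReal_mul (wt_pos _ _).le, ← ENNReal.ofReal_add (wt_pos _ _).le
                (mul_nonneg (wt_pos _ _).le (wt_pos _ _).le), ← ENNReal.ofReal_mul (by positivity)]
              exact ENNReal.ofReal_le_ofReal (wt_le_split hθ hσ η ζ)
            calc W θ η * (A (η - ζ) * B ζ) ≤
                (ENNReal.ofReal (2 ^ θ) * (W θ ζ + W σ (η - ζ) * W (θ - σ) ζ))
                  * (A (η - ζ) * B ζ) := by gcongr
              _ = _ := by ring
    have h4 : ∀ x y : ℝ≥0∞, (x + y) ^ 2 ≤ 2 * (x ^ 2 + y ^ 2) := by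
      intro x y
      have := ENNReal.rpow_add_le_mul_rpow_add_rpow x y (p := 2) (by norm_num)
      norm_num at this
      exact this
    calc W (2 * θ) η * ‖(𝓕 c : L2) η‖ₑ ^ 2 = (W θ η * ‖(𝓕 c : L2) η‖ₑ) ^ 2 := by
          rw [mul_pow, hWsq]
      _ ≤ _ := pow_le_pow_left' h2 2
      _ ≤ ENNReal.ofReal (2 ^ θ) ^ 2 * (2 * ((∫⁻ ζ, A (η - ζ) * (W θ ζ * B ζ)) ^ 2 +
        (∫⁻ ζ, (W (θ - σ) (η - ζ) * B (η - ζ)) * (W σ ζ * A ζ)) ^ 2)) := by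
          rw [mul_pow]
          gcongr
          exact h4 _ _
      _ = _ := by
          rw [← mul_assoc]
          congr 1
          rw [← ENNReal.ofReal_pow (by positivity), mul_comm, ENNReal.ofReal_mul (by norm_num)]
          congr 2
          · norm_num
          · rw [show (4 : ℝ) = 2 ^ 2 by norm_num, ← Real.rpow_natCast, ← Real.rpow_natCast,
              ← Real.rpow_mul (by norm_num), ← Real.rpow_mul (by norm_num), mul_comm]
  calc hsq θ c = ∫⁻ η, W (2 * θ) η * ‖(𝓕 c : L2) η‖ₑ ^ 2 := rfl
    _ ≤ _ := lintegral_mono_ae h1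
    _ = ENNReal.ofReal (2 * 4 ^ θ) * ((∫⁻ η, (∫⁻ ζ, A (η - ζ) * (W θ ζ * B ζ)) ^ 2) +
        ∫⁻ η, (∫⁻ ζ, (W (θ - σ) (η - ζ) * B (η - ζ)) * (W σ ζ * A ζ)) ^ 2) := by
        rw [lintegral_const_mul' _ _ ENNReal.ofReal_ne_top, lintegral_add_left]
        refine Measurable.pow_const ?_ 2
        exact Measurable.lintegral_prod_right'
          (f := fun p : ℝ × ℝ => A (p.1 - p.2) * (W θ p.2 * B p.2)) (by fun_prop)
    _ ≤ ENNReal.ofReal (2 * 4 ^ θ) * ((∫⁻ x, A x) ^ 2 * (∫⁻ x, (W θ x * B x) ^ 2) +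
        (∫⁻ x, W (θ - σ) x * B x) ^ 2 * ∫⁻ x, (W σ x * A x) ^ 2) := by
        gcongr
        · exact lintegral_sq_convolution_le hAm ((hWm θ).mul hBm)
        · exact lintegral_sq_convolution_le ((hWm (θ - σ)).mul hBm) ((hWm σ).mul hAm)
    _ ≤ ENNReal.ofReal (2 * 4 ^ θ) * ((embConst σ * hsq σ a) * hsq θ b +
        (embConst (θ - (θ - σ)) * hsq θ b) * hsq σ a) := by
        have e1 : ∀ x, (W θ x * B x) ^ 2 = W (2 * θ) x * B x ^ 2 := fun x => by rw [mul_pow, hWsq]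
        have e2 : ∀ x, (W σ x * A x) ^ 2 = W (2 * σ) x * A x ^ 2 := fun x => by rw [mul_pow, hWsq]
        simp only [e1, e2]
        gcongr
        · exact sq_lintegral_fourier_le σ a
        · exact le_rfl
        · exact sq_lintegral_wt_le (θ - σ) θ b
        · exact le_rfl
    _ = _ := by
        rw [sub_sub_cancel]
        have : ENNReal.ofReal (4 * 4 ^ θ) = 2 * ENNReal.ofReal (2 * 4 ^ θ) := by
          rw [show (4 : ℝ) * 4 ^ θ = 2 * (2 * 4 ^ θ) by ring,
            ENNReal.ofReal_mul (by norm_num : (0 : ℝ) ≤ 2), ENNReal.ofReal_ofNat]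
        rw [this]
        ring

/-! ### Weak derivatives and the chain rule -/

/-- Dominated convergence in `L²`. -/
theorem tendsto_eLpNorm_zero_of_dominated {ι : Type*} {l : Filter ι} [l.IsCountablyGenerated]
    {F : ι → ℝ → ℂ} (b : L2) (hm : ∀ᶠ n in l, AEStronglyMeasurable (F n) volume)
    {C : ℝ} (hb : ∀ᶠ n in l, ∀ᵐ x, ‖F n x‖ ≤ C * ‖b x‖)
    (hlim : ∀ᵐ x, Tendsto (fun n => F n x) l (𝓝 0)) :
    Tendsto (fun n => eLpNorm (F n) 2 volume) l (𝓝 0) := by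
  have h1 : Tendsto (fun n => ∫⁻ x, ‖F n x‖ₑ ^ 2) l (𝓝 (∫⁻ _ : ℝ, (0 : ℝ≥0∞))) := by
    apply tendsto_lintegral_filter_of_dominated_convergence'
      (fun x => (ENNReal.ofReal C * ‖b x‖ₑ) ^ 2)
    · filter_upwards [hm] with n hn
      exact hn.enorm.pow_const 2
    · filter_upwards [hb] with n hn
      filter_upwards [hn] with x hx
      gcongr
      rw [← ofReal_norm, ← ofReal_norm, ← ENNReal.ofReal_mul' (norm_nonneg _)]
      exact ENNReal.ofReal_le_ofReal hx
    · simp_rw [mul_pow]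
      rw [lintegral_const_mul' _ _ (by finiteness), ← enorm_sq_eq_lintegral]
      finiteness
    · filter_upwards [hlim] with x hx
      have := ((ENNReal.continuous_pow 2).tendsto _).comp hx.enorm
      simpa [Function.comp_def] using this
  rw [lintegral_zero] at h1
  have h2 := ((ENNReal.continuous_rpow_const (y := 1 / 2)).tendsto _).comp h1
  rw [ENNReal.zero_rpow_of_pos (by norm_num)] at h2
  refine h2.congr fun n => ?_
  rw [eLpNorm_eq_lintegral_rpow_enorm_toReal (by norm_num) (by norm_num)]
  simp

/-- `d` is the weak derivative of `f`. -/
def IsDeriv (f d : L2) : Prop :=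
  (𝓕 d : L2) =ᵐ[volume] fun η => ((2 * Real.pi * η : ℝ) : ℂ) * Complex.I * (𝓕 f : L2) η

theorem enorm_two_pi_I (η : ℝ) :
    ‖((2 * Real.pi * η : ℝ) : ℂ) * Complex.I‖ₑ ^ 2 = ENNReal.ofReal ((2 * Real.pi * η) ^ 2) := by
  rw [← ofReal_norm, norm_mul, Complex.norm_I, mul_one, Complex.norm_real,
    ← ENNReal.ofReal_pow (norm_nonneg _), Real.norm_eq_abs, sq_abs]

theorem exists_isDeriv {f : L2} (hf : hsq 1 f < ∞) : ∃ d, IsDeriv f d := by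
  have hmf := measurable_coe_L2 (𝓕 f : L2)
  have hm : MemLp (fun η => ((2 * Real.pi * η : ℝ) : ℂ) * Complex.I * (𝓕 f : L2) η) 2 volume := by
    refine ⟨by fun_prop, ?_⟩
    rw [eLpNorm_lt_top_iff_lintegral_rpow_enorm_lt_top (by norm_num) (by norm_num)]
    refine lt_of_le_of_lt ?_ hf
    unfold hsq
    refine lintegral_mono fun η => ?_
    simp only [ENNReal.toReal_ofNat, ENNReal.rpow_two]
    rw [enorm_mul, mul_pow, enorm_two_pi_I, mul_one, wt_two]
    gcongr
    linarith
  refine ⟨𝓕⁻ hm.toLp, ?_⟩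
  unfold IsDeriv
  rw [FourierTransform.fourier_fourierInv_eq]
  exact hm.coeFn_toLp

/-- `‖f‖²` in `H^σ` is the sum of `‖f‖²` and `‖f'‖²` in `H^(σ-1)`. -/
theorem hsq_eq_add {f d : L2} (h : IsDeriv f d) (σ : ℝ) :
    hsq σ f = hsq (σ - 1) f + hsq (σ - 1) d := by
  have hmf := measurable_coe_L2 (𝓕 f : L2)
  have hw := measurable_wt
  have e : hsq (σ - 1) d = ∫⁻ η, ENNReal.ofReal (wt (2 * (σ - 1)) η) *
      (ENNReal.ofReal ((2 * Real.pi * η) ^ 2) * ‖(𝓕 f : L2) η‖ₑ ^ 2) := by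
    apply lintegral_congr_ae
    filter_upwards [h] with η hη
    rw [hη, enorm_mul, mul_pow, enorm_two_pi_I]
  rw [e]
  unfold hsq
  rw [← lintegral_add_left (by have := hw (2 * (σ - 1)); fun_prop)]
  apply lintegral_congr
  intro η
  rw [show 2 * σ = 2 * (σ - 1) + 2 by ring, wt_add, wt_two,
    ENNReal.ofReal_mul (wt_pos _ _).le, ENNReal.ofReal_add zero_le_one (by positivity)]
  simp
  ring

/-- The difference quotient with step `1 / (n + 1)`. -/
noncomputable def dquot (n : ℕ) (f : L2) : L2 := ((n + 1 : ℝ) : ℂ) • (transL (1 / (n + 1)) f - f)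

theorem coeFn_fourier_dquot (n : ℕ) (f : L2) : (𝓕 (dquot n f) : L2) =ᵐ[volume]
    fun η => ((n + 1 : ℝ) : ℂ) * (chr (1 / (n + 1)) η - 1) * (𝓕 f : L2) η := by
  have e : (𝓕 (dquot n f) : L2) =
      ((n + 1 : ℝ) : ℂ) • (mulOp (chr (1 / (n + 1))) (𝓕 f) - 𝓕 f) := by
    rw [← fourier_transL]
    exact ((Lp.fourierTransformₗᵢ ℝ ℂ).map_smul _ _).trans
      (congrArg _ ((Lp.fourierTransformₗᵢ ℝ ℂ).map_sub _ _))
  rw [e]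
  filter_upwards [Lp.coeFn_smul ((n + 1 : ℝ) : ℂ) (mulOp (chr (1 / (n + 1))) (𝓕 f) - 𝓕 f : L2),
    Lp.coeFn_sub (mulOp (chr (1 / (n + 1))) (𝓕 f)) (𝓕 f : L2),
    coeFn_mulOp (bddSymbol_chr (1 / (n + 1))) (𝓕 f)] with η h1 h2 h3
  rw [h1, Pi.smul_apply, h2, Pi.sub_apply, h3, smul_eq_mul]
  ring

theorem norm_chr_quotient_le (n : ℕ) (η : ℝ) :
    ‖((n + 1 : ℝ) : ℂ) * (chr (1 / (n + 1)) η - 1)‖ ≤ |2 * Real.pi * η| := by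
  have h5 := norm_chr_sub_one_le (1 / (n + 1)) η
  have h6 : |2 * Real.pi * (1 / ((n : ℝ) + 1)) * η| = |2 * Real.pi * η| / (n + 1) := by
    have : 2 * Real.pi * (1 / ((n : ℝ) + 1)) * η = 2 * Real.pi * η / (n + 1) := by ring
    rw [this, abs_div, abs_of_pos (by positivity : (0 : ℝ) < n + 1)]
  rw [h6, le_div_iff₀ (by positivity)] at h5
  rw [norm_mul, Complex.norm_real, Real.norm_eq_abs, abs_of_pos (by positivity : (0 : ℝ) < n + 1)]
  linarith

theorem IsDeriv.tendsto_dquot {f d : L2} (h : IsDeriv f d) :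
    Tendsto (fun n => dquot n f) atTop (𝓝 d) := by
  have h1 : Tendsto (fun n => (𝓕 (dquot n f) : L2)) atTop (𝓝 (𝓕 d)) := by
    rw [Lp.tendsto_Lp_iff_tendsto_eLpNorm']
    have hmf := measurable_coe_L2 (𝓕 f : L2)
    refine tendsto_eLpNorm_zero_of_dominated (𝓕 d : L2) (C := 2) ?_ ?_ ?_
    · exact Eventually.of_forall fun n => (Lp.aestronglyMeasurable _).sub
        (Lp.aestronglyMeasurable _)
    · refine Eventually.of_forall fun n => ?_
      filter_upwards [h, coeFn_fourier_dquot n f] with η h1 h2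
      rw [Pi.sub_apply]
      refine (norm_sub_le _ _).trans ?_
      have h3 : ‖(𝓕 (dquot n f) : L2) η‖ ≤ ‖(𝓕 d : L2) η‖ := by
        rw [h1, h2, norm_mul, norm_mul (_ * _)]
        gcongr
        refine (norm_chr_quotient_le n η).trans_eq ?_
        rw [norm_mul, Complex.norm_I, Complex.norm_real, Real.norm_eq_abs, mul_one]
      linarith
    · have h2 : ∀ᵐ η, ∀ n, (𝓕 (dquot n f) : L2) η =
          ((n + 1 : ℝ) : ℂ) * (chr (1 / (n + 1)) η - 1) * (𝓕 f : L2) η :=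
        ae_all_iff.mpr fun n => coeFn_fourier_dquot n f
      filter_upwards [h, h2] with η h1 h2
      have h3 := ((tendsto_chr_quotient η).mul_const ((𝓕 f : L2) η)).sub_const ((𝓕 d : L2) η)
      rw [h1, sub_self] at h3
      refine h3.congr fun n => ?_
      rw [Pi.sub_apply, h2, h1]
  have h2 := ((Lp.fourierTransformₗᵢ ℝ ℂ).symm.continuous.tendsto _).comp h1
  have h3 : ∀ u : L2, (Lp.fourierTransformₗᵢ ℝ ℂ).symm (𝓕 u : L2) = u :=
    (Lp.fourierTransformₗᵢ ℝ ℂ).symm_apply_apply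
  simpa [Function.comp_def, h3] using h2

/-- Limits of difference quotients in `L²` are weak derivatives; a subsequence of step sizes
suffices. -/
theorem isDeriv_of_tendsto {g e : L2} {φ : ℕ → ℕ} (hφ : Tendsto φ atTop atTop)
    (h : Tendsto (fun n => dquot (φ n) g) atTop (𝓝 e)) : IsDeriv g e := by
  have h1 : Tendsto (fun n => (𝓕 (dquot (φ n) g) : L2)) atTop (𝓝 (𝓕 e)) :=
    (continuous_fourier_L2.tendsto _).comp h
  obtain ⟨ns, hns, hae⟩ := (tendstoInMeasure_of_tendsto_Lp h1).exists_seq_tendsto_ae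
  have h2 : ∀ᵐ η, ∀ n, (𝓕 (dquot n g) : L2) η =
      ((n + 1 : ℝ) : ℂ) * (chr (1 / (n + 1)) η - 1) * (𝓕 g : L2) η :=
    ae_all_iff.mpr fun n => coeFn_fourier_dquot n g
  unfold IsDeriv
  filter_upwards [hae, h2] with η h3 h4
  have h5 := ((tendsto_chr_quotient η).mul_const ((𝓕 g : L2) η)).comp
    (hφ.comp hns.tendsto_atTop)
  refine tendsto_nhds_unique (h3.congr fun n => ?_) h5
  simp only [Function.comp]
  rw [h4]

theorem measurable_dslope {G : ℝ → ℝ} (hG : ContDiff ℝ 1 G) :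
    Measurable (fun p : ℝ × ℝ => dslope G p.1 p.2) := by
  have hGc : Continuous G := hG.continuous
  have hd : Continuous (deriv G) := hG.continuous_deriv le_rfl
  have : (fun p : ℝ × ℝ => dslope G p.1 p.2) =
      fun p => if p.2 = p.1 then deriv G p.1 else (p.2 - p.1)⁻¹ * (G p.2 - G p.1) := by
    funext p
    split_ifs with h
    · rw [h, dslope_same]
    · rw [dslope_of_ne _ h, slope_def_module, smul_eq_mul]
  rw [this]
  refine Measurable.ite (measurableSet_eq_fun measurable_snd measurable_fst) ?_ ?_
  · exact hd.measurable.comp measurable_fst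
  · have := hGc.measurable
    fun_prop

theorem exists_lipschitzOnWith_Icc {G : ℝ → ℝ} (hG : ContDiff ℝ 1 G) (M : ℝ) :
    ∃ K : NNReal, LipschitzOnWith K G (Set.Icc (-M) M) ∧ ∀ x ∈ Set.Icc (-M) M, |deriv G x| ≤ K := by
  have hd : Continuous (deriv G) := hG.continuous_deriv le_rfl
  obtain ⟨C, hC⟩ := (isCompact_Icc (a := -M) (b := M)).exists_bound_of_continuousOn hd.continuousOn
  have hC' : ∀ x ∈ Set.Icc (-M) M, ‖deriv G x‖ ≤ (⟨max C 0, le_max_right _ _⟩ : NNReal) :=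
    fun x hx => (hC x hx).trans (le_max_left _ _)
  refine ⟨⟨max C 0, le_max_right _ _⟩, ?_, hC'⟩
  exact (convex_Icc _ _).lipschitzOnWith_of_nnnorm_deriv_le
    (fun x _ => (hG.differentiable one_ne_zero).differentiableAt) hC'

/-- The chain rule for weak derivatives. A difference quotient of `G ∘ f` is the product of a
difference quotient of `f`, which converges in `L²`, and a divided difference of `G`, which is
bounded and converges almost everywhere along a subsequence. -/
theorem IsDeriv.comp {G : ℝ → ℝ} (hG : ContDiff ℝ 1 G) {f d gf e : L2} {M : ℝ}
    (hM : ∀ᵐ x, |(f x).re| ≤ M) (hre : ∀ᵐ x, (f x).im = 0)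
    (hgf : gf =ᵐ[volume] fun x => (G (f x).re : ℂ))
    (he : e =ᵐ[volume] fun x => ((deriv G (f x).re : ℝ) : ℂ) * d x) (hd : IsDeriv f d) :
    IsDeriv gf e := by
  have hq := hd.tendsto_dquot
  have htr : Tendsto (fun n : ℕ => transL (1 / (n + 1)) f) atTop (𝓝 f) := by
    have h1 : Tendsto (fun n : ℕ => (((1 / ((n : ℝ) + 1) : ℝ) : ℂ)) • dquot n f + f) atTop
        (𝓝 ((0 : ℂ) • d + f)) := by
      refine (Tendsto.smul ?_ hq).add_const f
      exact_mod_cast (Complex.continuous_ofReal.tendsto 0).comp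
        (tendsto_one_div_add_atTop_nhds_zero_nat (𝕜 := ℝ))
    rw [zero_smul, zero_add] at h1
    refine h1.congr fun n => ?_
    rw [dquot, smul_smul, ← Complex.ofReal_mul, one_div_mul_cancel (by positivity)]
    simp
  -- the translates converge almost everywhere along a subsequence
  obtain ⟨φ, hφ, hae⟩ := (tendstoInMeasure_of_tendsto_Lp htr).exists_seq_tendsto_ae
  apply isDeriv_of_tendsto hφ.tendsto_atTop
  obtain ⟨K, hK, hK'⟩ := exists_lipschitzOnWith_Icc hG M
  set S : ℕ → ℝ → ℝ := fun n x => dslope G (f x).re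
      ((transL (1 / ((φ n : ℝ) + 1)) f : L2) x).re with hS
  have hSm : ∀ n, Measurable (S n) := by
    intro n
    have h1 := measurable_coe_L2 f
    have h2 := measurable_coe_L2 (transL (1 / ((φ n : ℝ) + 1)) f)
    exact (measurable_dslope hG).comp
      ((Complex.measurable_re.comp h1).prodMk (Complex.measurable_re.comp h2))
  have hMt : ∀ᵐ x, ∀ n, |((transL (1 / ((φ n : ℝ) + 1)) f : L2) x).re| ≤ M := by
    refine ae_all_iff.mpr fun n => ?_
    have h3 := (measurePreserving_add_right (volume : Measure ℝ)
        (1 / ((φ n : ℝ) + 1))).quasiMeasurePreserving.ae hM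
    filter_upwards [coeFn_transL (1 / ((φ n : ℝ) + 1)) f, h3] with x h1 h2
    rw [h1]
    exact h2
  have hSb : ∀ᵐ x, ∀ n, |S n x| ≤ K := by
    filter_upwards [hMt, hM] with x h1 h2 n
    have hx : (f x).re ∈ Set.Icc (-M) M := abs_le.mp h2
    simp only [hS]
    by_cases h3 : ((transL (1 / ((φ n : ℝ) + 1)) f : L2) x).re = (f x).re
    · rw [h3, dslope_same]
      exact hK' _ hx
    · rw [dslope_of_ne _ h3, slope_def_field, abs_div, div_le_iff₀
        (abs_pos.mpr (sub_ne_zero.mpr h3))]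
      exact hK.dist_le_mul _ (abs_le.mp (h1 n)) _ hx
  have hSlim : ∀ᵐ x, Tendsto (fun n => S n x) atTop (𝓝 (deriv G (f x).re)) := by
    filter_upwards [hae] with x hx
    have h1 : ContinuousAt (dslope G (f x).re) (f x).re :=
      continuousAt_dslope_same.mpr (hG.differentiable one_ne_zero).differentiableAt
    have h2 := h1.tendsto.comp ((Complex.continuous_re.tendsto _).comp hx)
    rw [dslope_same] at h2
    exact h2
  have hdb : ∀ᵐ x, |deriv G (f x).re| ≤ K := by
    filter_upwards [hM] with x hx
    exact hK' _ (abs_le.mp hx)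
  have hquot : ∀ n, (dquot (φ n) gf : L2) =ᵐ[volume]
      fun x => (S n x : ℂ) * (dquot (φ n) f : L2) x := by
    intro n
    have hqp := (measurePreserving_add_right (volume : Measure ℝ)
        (1 / ((φ n : ℝ) + 1))).quasiMeasurePreserving
    have h3 := hqp.ae_eq_comp hgf
    have h4 := hqp.ae hre
    unfold dquot
    filter_upwards [Lp.coeFn_smul ((φ n + 1 : ℝ) : ℂ) (transL (1 / ((φ n : ℝ) + 1)) gf - gf),
      Lp.coeFn_sub (transL (1 / ((φ n : ℝ) + 1)) gf) gf,
      Lp.coeFn_smul ((φ n + 1 : ℝ) : ℂ) (transL (1 / ((φ n : ℝ) + 1)) f - f),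
      Lp.coeFn_sub (transL (1 / ((φ n : ℝ) + 1)) f) f,
      coeFn_transL (1 / ((φ n : ℝ) + 1)) gf, coeFn_transL (1 / ((φ n : ℝ) + 1)) f, h3, h4, hre, hgf]
      with x a1 a2 a3 a4 a5 a6 a7 a8 a9 a10
    simp only [Function.comp] at a7
    rw [a1, Pi.smul_apply, a2, Pi.sub_apply, a3, Pi.smul_apply, a4, Pi.sub_apply, a5, a7, a10]
    simp only [hS, smul_eq_mul]
    rw [a6]
    set y := f (x + 1 / ((φ n : ℝ) + 1)) with hy
    have e1 : y = (y.re : ℂ) := Complex.ext rfl (by simpa using a8)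
    have e2 : f x = ((f x).re : ℂ) := Complex.ext rfl (by simpa using a9)
    have e3 := sub_smul_dslope G (f x).re y.re
    rw [smul_eq_mul] at e3
    have e4 : ((G y.re : ℂ) - (G (f x).re : ℂ)) =
        (((y.re - (f x).re) * dslope G (f x).re y.re : ℝ) : ℂ) := by
      rw [e3]; push_cast; ring
    rw [e4]
    have e5 : y - f x = ((y.re - (f x).re : ℝ) : ℂ) := by
      rw [Complex.ofReal_sub, ← e1, ← e2]
    rw [e5]
    push_cast
    ring
  rw [Lp.tendsto_Lp_iff_tendsto_eLpNorm']
  have hA : Tendsto (fun n => K * eLpNorm (⇑(dquot (φ n) f) - ⇑d) 2 volume) atTop (𝓝 0) := by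
    have h1 := (Lp.tendsto_Lp_iff_tendsto_eLpNorm' _ _).mp (hq.comp hφ.tendsto_atTop)
    have := ENNReal.Tendsto.const_mul (a := (K : ℝ≥0∞)) h1 (Or.inr ENNReal.coe_ne_top)
    simpa using this
  have hB : Tendsto
      (fun n => eLpNorm (fun x => ((S n x - deriv G (f x).re : ℝ) : ℂ) * d x) 2 volume)
      atTop (𝓝 0) := by
    refine tendsto_eLpNorm_zero_of_dominated d (C := 2 * K) ?_ ?_ ?_
    · refine Eventually.of_forall fun n => ?_
      have h1 := measurable_coe_L2 f
      have h2 := measurable_coe_L2 d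
      have h3 := hSm n
      have h4 : Measurable (deriv G) := (hG.continuous_deriv le_rfl).measurable
      apply Measurable.aestronglyMeasurable
      fun_prop
    · refine Eventually.of_forall fun n => ?_
      filter_upwards [hSb, hdb] with x h1 h2
      rw [norm_mul, Complex.norm_real, Real.norm_eq_abs]
      gcongr
      refine (abs_sub _ _).trans ?_
      linarith [h1 n]
    · filter_upwards [hSlim] with x hx
      have h1 := (Complex.continuous_ofReal.tendsto _).comp (hx.sub_const (deriv G (f x).re))
      have h2 := h1.mul_const (d x)
      simpa [Function.comp_def] using h2
  -- `S f'ₙ - G' d = S (f'ₙ - d) + (S - G') d` for the difference quotients `f'ₙ` of `f`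
  refine tendsto_of_tendsto_of_tendsto_of_le_of_le tendsto_const_nhds
    (by have h := hA.add hB; rwa [add_zero] at h) (fun _ => zero_le) (fun n => ?_)
  have e1 : (⇑(dquot (φ n) gf) - ⇑e) =ᵐ[volume] (fun x => (S n x : ℂ) * (⇑(dquot (φ n) f) - ⇑d) x) +
      fun x => ((S n x - deriv G (f x).re : ℝ) : ℂ) * d x := by
    filter_upwards [hquot n, he] with x h1 h2
    simp only [Pi.sub_apply, Pi.add_apply, h1, h2]
    push_cast
    ring
  rw [eLpNorm_congr_ae e1]
  have h1 := measurable_coe_L2 f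
  have h2 := measurable_coe_L2 d
  have h2' := measurable_coe_L2 (dquot (φ n) f)
  have h3 := hSm n
  have h4 : Measurable (deriv G) := (hG.continuous_deriv le_rfl).measurable
  refine (eLpNorm_add_le (Measurable.aestronglyMeasurable ?_) (Measurable.aestronglyMeasurable ?_)
    (by norm_num)).trans ?_
  · simp only [Pi.sub_apply]; fun_prop
  · fun_prop
  gcongr
  refine (eLpNorm_le_nnreal_smul_eLpNorm_of_ae_le_mul (c := K)
      (g := ⇑(dquot (φ n) f) - ⇑d) ?_ 2).trans_eq ?_
  · filter_upwards [hSb] with x hx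
    rw [nnnorm_mul]
    gcongr
    rw [← NNReal.coe_le_coe, coe_nnnorm, Complex.norm_real]
    exact hx n
  · rfl

/-! ### Composition with smooth functions in Sobolev spaces -/

/-- The map `z ↦ G (Re z)`, with `Re z` truncated to `[-M, M]`. -/
noncomputable def clampComp (G : ℝ → ℝ) (M : ℝ) (z : ℂ) : ℂ :=
  ((G (max (-M) (min M z.re)) : ℝ) : ℂ)

theorem clampComp_of_le {G : ℝ → ℝ} {M : ℝ} {z : ℂ} (h : |z.re| ≤ M) :
    clampComp G M z = ((G z.re : ℝ) : ℂ) := by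
  unfold clampComp
  rw [min_eq_right (abs_le.mp h).2, max_eq_right (abs_le.mp h).1]

theorem clampComp_zero {G : ℝ → ℝ} (hG0 : G 0 = 0) {M : ℝ} (hM : 0 ≤ M) :
    clampComp G M 0 = 0 := by
  rw [clampComp_of_le (by simpa using hM)]
  simp [hG0]

theorem exists_lipschitzWith_clampComp {G : ℝ → ℝ} (hG : ContDiff ℝ 1 G) {M : ℝ} (hM : 0 ≤ M) :
    ∃ K : NNReal, LipschitzWith K (clampComp G M) := by
  obtain ⟨K, hK, -⟩ := exists_lipschitzOnWith_Icc hG M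
  refine ⟨K, LipschitzWith.of_dist_le_mul fun z w => ?_⟩
  have hmem : ∀ x : ℝ, max (-M) (min M x) ∈ Set.Icc (-M) M := fun x =>
    ⟨le_max_left _ _, max_le (by linarith) (min_le_left _ _)⟩
  have h1 := hK.dist_le_mul _ (hmem z.re) _ (hmem w.re)
  unfold clampComp
  rw [Complex.dist_eq, ← Complex.ofReal_sub, Complex.norm_real]
  refine h1.trans ?_
  gcongr
  rw [Complex.dist_eq, Real.dist_eq]
  refine (abs_max_sub_max_le_max (-M) (min M z.re) (-M) (min M w.re)).trans ?_
  rw [sub_self, abs_zero, max_eq_right (abs_nonneg _), min_comm M, min_comm M]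
  refine (abs_min_sub_min_le_max z.re M w.re M).trans ?_
  rw [sub_self, abs_zero, max_eq_left (abs_nonneg _), ← Complex.sub_re]
  exact Complex.abs_re_le_norm _

/-- Bounded sets of `H^s`, `s > 1/2`, are bounded in the supremum norm. There, a smooth
function may be replaced by a globally Lipschitz one. -/
theorem exists_sup_bound {s : ℝ} (hs : 1 / 2 < s) (R : NNReal) :
    ∃ M : ℝ, 0 ≤ M ∧ ∀ f : L2, hsq s f ≤ R → ∀ᵐ x, ‖f x‖ ≤ M := by
  refine ⟨Real.sqrt (embConst s * R).toReal, Real.sqrt_nonneg _, fun f hf => ?_⟩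
  filter_upwards [ae_enorm_sq_le s f] with x hx
  have h1 : ‖f x‖ₑ ^ 2 ≤ embConst s * R := hx.trans (by gcongr)
  have h2 := ENNReal.toReal_mono (ENNReal.mul_ne_top (embConst_lt_top hs).ne ENNReal.coe_ne_top) h1
  rw [ENNReal.toReal_pow, toReal_enorm] at h2
  exact Real.le_sqrt_of_sq_le h2

theorem hsq_add_le (σ : ℝ) (f g : L2) : hsq σ (f + g) ≤ 2 * (hsq σ f + hsq σ g) := by
  have hf := measurable_coe_L2 (𝓕 f : L2)
  have hg := measurable_coe_L2 (𝓕 g : L2)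
  have hw := measurable_wt (2 * σ)
  have e : (𝓕 (f + g) : L2) = 𝓕 f + 𝓕 g := (Lp.fourierTransformₗᵢ ℝ ℂ).map_add _ _
  unfold hsq
  rw [← lintegral_add_left (by fun_prop), ← lintegral_const_mul' _ _ (by finiteness), e]
  apply lintegral_mono_ae
  filter_upwards [Lp.coeFn_add (𝓕 f : L2) (𝓕 g : L2)] with η hη
  rw [hη, Pi.add_apply, ← mul_add, mul_left_comm]
  gcongr
  have h4 : ∀ x y : ℝ≥0∞, (x + y) ^ 2 ≤ 2 * (x ^ 2 + y ^ 2) := by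
    intro x y
    have := ENNReal.rpow_add_le_mul_rpow_add_rpow x y (p := 2) (by norm_num)
    norm_num at this
    exact this
  exact (pow_le_pow_left' (enorm_add_le _ _) 2).trans (h4 _ _)

theorem hsq_smul (σ : ℝ) (c : ℂ) (f : L2) : hsq σ (c • f) = ‖c‖ₑ ^ 2 * hsq σ f := by
  have e : (𝓕 (c • f) : L2) = c • 𝓕 f := (Lp.fourierTransformₗᵢ ℝ ℂ).map_smul _ _
  unfold hsq
  rw [← lintegral_const_mul' _ _ (by finiteness), e]
  apply lintegral_congr_ae
  filter_upwards [Lp.coeFn_smul c (𝓕 f : L2)] with η hη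
  rw [hη, Pi.smul_apply, smul_eq_mul, enorm_mul]
  ring

/-- Composition with a `C^(k+1)` function maps bounded sets of real-valued functions in `H^s` to
bounded sets, for `1/2 < s ≤ k + 1`. In the induction step, where
`k + 1 < s ≤ k + 2`, the derivative of `G(f)` is `(G'(f) - G'(0)) f' + G'(0) f'`, in which the
factor `G'(f) - G'(0)` is bounded in `H^(k+1)` by the induction hypothesis and `f'` is bounded in
`H^(s-1)`. -/
theorem exists_hsq_comp_le (k : ℕ) :
    ∀ G : ℝ → ℝ, ContDiff ℝ ((k + 1 : ℕ) : WithTop ℕ∞) G → G 0 = 0 →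
    ∀ s : ℝ, 1 / 2 < s → s ≤ (k + 1 : ℕ) → ∀ R : NNReal, ∃ C : NNReal, ∀ f gf : L2,
      (∀ᵐ x, (f x).im = 0) → hsq s f ≤ R → (gf =ᵐ[volume] fun x => (G (f x).re : ℂ)) →
        hsq s gf ≤ C := by
  induction k with
  | zero =>
    intro G hG hG0 s hs hs1 R
    have hG1 : ContDiff ℝ 1 G := by simpa using hG
    obtain ⟨M, hM0, hM⟩ := exists_sup_bound hs R
    obtain ⟨K, hK⟩ := exists_lipschitzWith_clampComp hG1 hM0
    have h0 := clampComp_zero hG0 hM0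
    refine ⟨2 * K ^ 2 * R, fun f gf _ hf hgf => ?_⟩
    have e : gf = hK.compLp h0 f := by
      apply Lp.ext
      filter_upwards [hgf, hK.coeFn_compLp h0 f, hM f hf] with x h1 h2 h3
      rw [h1, h2, Function.comp, clampComp_of_le ((Complex.abs_re_le_norm _).trans h3)]
    rw [e]
    refine (hsq_compLp_le (by linarith) (by simpa using hs1) hK h0 f).trans ?_
    push_cast
    gcongr
  | succ k ih =>
    intro G hG hG0 s hs hs1 R
    have hG1 : ContDiff ℝ 1 G := hG.of_le (by exact_mod_cast Nat.le_add_left _ _)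
    have hGk : ContDiff ℝ ((k + 1 : ℕ) : WithTop ℕ∞) G := hG.of_le (by exact_mod_cast Nat.le_succ _)
    have hdG : ContDiff ℝ ((k + 1 : ℕ) : WithTop ℕ∞) (deriv G) := by
      have : ContDiff ℝ (((k + 1 : ℕ) : WithTop ℕ∞) + 1) G := by exact_mod_cast hG
      exact (contDiff_succ_iff_deriv.mp this).2.2
    rcases le_or_gt s (k + 1 : ℕ) with hsk | hsk
    · exact ih G hGk hG0 s hs hsk R
    -- the case `k + 1 < s ≤ k + 2`
    set H : ℝ → ℝ := fun x => deriv G x - deriv G 0 with hH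
    have hHk : ContDiff ℝ ((k + 1 : ℕ) : WithTop ℕ∞) H := hdG.sub contDiff_const
    have hH1 : ContDiff ℝ 1 H := hHk.of_le (by exact_mod_cast Nat.le_add_left _ _)
    have hH0 : H 0 = 0 := by simp [hH]
    have hk1 : (1 : ℝ) / 2 < (k + 1 : ℕ) := by
      have : (0 : ℝ) ≤ k := Nat.cast_nonneg k
      push_cast; linarith
    have hk1' : (1 : ℝ) ≤ (k + 1 : ℕ) := by
      have : (0 : ℝ) ≤ k := Nat.cast_nonneg k
      push_cast; linarith
    obtain ⟨C₁, hC₁⟩ := ih G hGk hG0 (k + 1 : ℕ) hk1 le_rfl R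
    obtain ⟨C₂, hC₂⟩ := ih H hHk hH0 (k + 1 : ℕ) hk1 le_rfl R
    obtain ⟨M, hM0, hM⟩ := exists_sup_bound hs R
    obtain ⟨K, hK⟩ := exists_lipschitzWith_clampComp hH1 hM0
    have h0 := clampComp_zero hH0 hM0
    have hs2 : s - 1 ≤ (k + 1 : ℕ) := by push_cast at hs1 ⊢; linarith
    set B : ℝ≥0∞ := C₁ + 2 * (ENNReal.ofReal (4 * 4 ^ (s - 1)) * (embConst (k + 1 : ℕ) * C₂ * R)
      + ‖((deriv G 0 : ℝ) : ℂ)‖ₑ ^ 2 * R) with hB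
    have hBt : B ≠ ∞ := by
      have := (embConst_lt_top hk1).ne
      finiteness
    refine ⟨B.toNNReal, fun f gf hre hf hgf => ?_⟩
    rw [ENNReal.coe_toNNReal hBt]
    have hMf := hM f hf
    have hfk : hsq (k + 1 : ℕ) f ≤ R := (hsq_mono hsk.le f).trans hf
    obtain ⟨d, hd⟩ := exists_isDeriv (f := f)
      ((hsq_mono (hk1'.trans hsk.le) f).trans_lt (hf.trans_lt ENNReal.coe_lt_top))
    have hds : hsq (s - 1) d ≤ R := by
      rw [hsq_eq_add hd s] at hf
      exact le_add_self.trans hf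
    set a := hK.compLp h0 f with ha
    have hae : a =ᵐ[volume] fun x => (H (f x).re : ℂ) := by
      filter_upwards [hK.coeFn_compLp h0 f, hMf] with x h2 h3
      rw [h2, Function.comp, clampComp_of_le ((Complex.abs_re_le_norm _).trans h3)]
    obtain ⟨K', -, hK'⟩ := exists_lipschitzOnWith_Icc hG1 M
    have hmem : MemLp (fun x => ((deriv G (f x).re : ℝ) : ℂ) * d x) 2 volume := by
      refine (Lp.memLp d).of_le_mul (c := K') ?_ ?_
      · have h1 := measurable_coe_L2 f
        have h2 := measurable_coe_L2 d
        have h4 : Measurable (deriv G) := (hG1.continuous_deriv le_rfl).measurable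
        apply Measurable.aestronglyMeasurable
        fun_prop
      · filter_upwards [hMf] with x hx
        rw [norm_mul, Complex.norm_real]
        gcongr
        exact hK' _ (abs_le.mp ((Complex.abs_re_le_norm _).trans hx))
    set e := hmem.toLp with he
    have hderiv : IsDeriv gf e := by
      refine IsDeriv.comp hG1 (M := M) ?_ hre hgf hmem.coeFn_toLp hd
      filter_upwards [hMf] with x hx
      exact (Complex.abs_re_le_norm _).trans hx
    set c := e - ((deriv G 0 : ℝ) : ℂ) • d with hc
    have hce : c =ᵐ[volume] fun x => a x * d x := by
      filter_upwards [Lp.coeFn_sub e (((deriv G 0 : ℝ) : ℂ) • d),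
        Lp.coeFn_smul ((deriv G 0 : ℝ) : ℂ) d, hmem.coeFn_toLp, hae] with x h1 h2 h3 h4
      rw [h1, Pi.sub_apply, h2, h3, h4, hH]
      simp only [Pi.smul_apply, smul_eq_mul]
      push_cast
      ring
    have hcb : hsq (s - 1) c ≤ ENNReal.ofReal (4 * 4 ^ (s - 1)) *
        (embConst (k + 1 : ℕ) * C₂ * R) := by
      refine (hsq_mul_le (σ := (k + 1 : ℕ)) (by linarith) hs2 hce).trans ?_
      gcongr
      exact hC₂ f a hre hfk hae
    have heq : e = c + ((deriv G 0 : ℝ) : ℂ) • d := by rw [hc]; abel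
    rw [hsq_eq_add hderiv s, hB]
    gcongr
    · exact (hsq_mono hs2 gf).trans (hC₁ f gf hre hfk hgf)
    · rw [heq]
      refine (hsq_add_le _ _ _).trans ?_
      rw [hsq_smul]
      gcongr

/-! ### The parametrization of `H^s` on the Fourier side -/

theorem bddSymbol_wt_neg {σ : ℝ} (hσ : σ ≤ 0) : BddSymbol (fun η => (wt σ η : ℂ)) := by
  refine ⟨Complex.measurable_ofReal.comp (measurable_wt σ), 1, fun η => ?_⟩
  rw [Complex.norm_real, Real.norm_eq_abs, abs_of_pos (wt_pos _ _)]
  exact wt_le_one hσ η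

theorem hsq_eq_of_fourier_eq {s : ℝ} (hs : 0 ≤ s) {f a : L2}
    (h : (𝓕 f : L2) = mulOp (fun η => (wt (-s) η : ℂ)) a) : hsq s f = ‖a‖ₑ ^ 2 := by
  rw [enorm_sq_eq_lintegral]
  unfold hsq
  apply lintegral_congr_ae
  rw [h]
  filter_upwards [coeFn_mulOp (bddSymbol_wt_neg (show -s ≤ 0 by linarith)) a] with η hη
  rw [hη, enorm_mul, mul_pow, ← mul_assoc]
  have : ENNReal.ofReal (wt (2 * s) η) * ‖(wt (-s) η : ℂ)‖ₑ ^ 2 = 1 := by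
    rw [← ofReal_norm, Complex.norm_real, Real.norm_eq_abs, abs_of_pos (wt_pos _ _),
      ← ENNReal.ofReal_pow (wt_pos _ _).le, ← ENNReal.ofReal_mul (wt_pos _ _).le, sq, ← wt_add,
      ← wt_add]
    ring_nf
    simp [wt_zero]
  rw [this, one_mul]

theorem exists_fourier_eq_of_hsq_lt_top {s : ℝ} (hs : 0 ≤ s) {f : L2} (h : hsq s f < ∞) :
    ∃ a : L2, (𝓕 f : L2) = mulOp (fun η => (wt (-s) η : ℂ)) a := by
  have hmf := measurable_coe_L2 (𝓕 f : L2)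
  have hw := measurable_wt s
  have hm : MemLp (fun η => (wt s η : ℂ) * (𝓕 f : L2) η) 2 volume := by
    refine ⟨by fun_prop, ?_⟩
    rw [eLpNorm_lt_top_iff_lintegral_rpow_enorm_lt_top (by norm_num) (by norm_num)]
    refine lt_of_le_of_lt (le_of_eq ?_) h
    unfold hsq
    apply lintegral_congr
    intro η
    simp only [ENNReal.toReal_ofNat, ENNReal.rpow_two]
    rw [enorm_mul, mul_pow, ← ofReal_norm, Complex.norm_real, Real.norm_eq_abs,
      abs_of_pos (wt_pos _ _), ← ENNReal.ofReal_pow (wt_pos _ _).le, sq (wt s η), ← wt_add]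
    congr 3
    ring
  refine ⟨hm.toLp, ?_⟩
  apply Lp.ext
  filter_upwards [coeFn_mulOp (bddSymbol_wt_neg (show -s ≤ 0 by linarith)) hm.toLp,
    hm.coeFn_toLp] with η h1 h2
  rw [h1, h2, ← mul_assoc, ← Complex.ofReal_mul, wt_neg_mul]
  simp

/-! ### Strongly continuous families of operators and Duhamel integrals -/

section Duhamel

variable {E : Type*} [NormedAddCommGroup E] [NormedSpace ℂ E]

/-- A strongly continuous family of operators, bounded on bounded time intervals. -/
structure StrongCont (K : ℝ → E →L[ℂ] E) : Prop where
  continuous_apply : ∀ x, Continuous fun t => K t x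
  bound : ∀ T : ℝ, ∃ C : ℝ, 0 ≤ C ∧ ∀ t, |t| ≤ T → ∀ x, ‖K t x‖ ≤ C * ‖x‖

theorem StrongCont.continuous_uncurry {K : ℝ → E →L[ℂ] E} (hK : StrongCont K) :
    Continuous fun p : ℝ × E => K p.1 p.2 := by
  rw [continuous_iff_continuousAt]
  rintro ⟨t, x⟩
  obtain ⟨C, hC0, hC⟩ := hK.bound (|t| + 1)
  have h1 : Tendsto (fun p : ℝ × E => C * ‖p.2 - x‖ + ‖K p.1 x - K t x‖) (𝓝 (t, x)) (𝓝 0) := by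
    have : Continuous (fun p : ℝ × E => C * ‖p.2 - x‖ + ‖K p.1 x - K t x‖) := by
      have h := (hK.continuous_apply x).comp (continuous_fst (X := ℝ) (Y := E))
      exact ((continuous_snd.sub continuous_const).norm.const_mul C).add
        (h.sub continuous_const).norm
    have := this.tendsto (t, x)
    simpa using this
  rw [ContinuousAt, tendsto_iff_norm_sub_tendsto_zero]
  refine squeeze_zero' (Eventually.of_forall fun p => norm_nonneg _) ?_ h1
  have h2 : ∀ᶠ p : ℝ × E in 𝓝 (t, x), |p.1| ≤ |t| + 1 := by
    have : Continuous (fun p : ℝ × E => |p.1|) := by fun_prop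
    exact (this.tendsto (t, x)).eventually_le_const (by simp)
  filter_upwards [h2] with p hp
  have : K p.1 p.2 - K t x = K p.1 (p.2 - x) + (K p.1 x - K t x) := by
    rw [map_sub]; abel
  rw [this]
  exact (norm_add_le _ _).trans (add_le_add_left (hC _ hp _) _)

variable {h : ℝ → E} {B : ℝ}

theorem StrongCont.stronglyMeasurable_comp {K : ℝ → E →L[ℂ] E} (hK : StrongCont K)
    (hh : StronglyMeasurable h) (t : ℝ) : StronglyMeasurable fun τ => K (t - τ) (h τ) := by
  have h1 : StronglyMeasurable (fun τ : ℝ => t - τ) := by fun_prop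
  exact hK.continuous_uncurry.comp_stronglyMeasurable (h1.prodMk hh)

theorem StrongCont.intervalIntegrable {K : ℝ → E →L[ℂ] E} (hK : StrongCont K)
    (hh : StronglyMeasurable h) (hB : ∀ τ, ‖h τ‖ ≤ B) (t a b : ℝ) :
    IntervalIntegrable (fun τ => K (t - τ) (h τ)) volume a b := by
  obtain ⟨C, hC0, hC⟩ := hK.bound (|t| + (|a| + |b|))
  rw [intervalIntegrable_iff]
  refine Measure.integrableOn_of_bounded (M := C * B) (by simp)
    (hK.stronglyMeasurable_comp hh t).aestronglyMeasurable ?_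
  refine (ae_restrict_iff' measurableSet_uIoc).mpr (Eventually.of_forall fun τ hτ => ?_)
  have h1 : |τ| ≤ |a| + |b| := by
    rcases Set.mem_uIoc.mp hτ with h | h <;> rw [abs_le] <;>
      constructor <;> linarith [neg_abs_le a, neg_abs_le b, le_abs_self a, le_abs_self b,
        abs_nonneg a, abs_nonneg b]
  refine (hC _ ((abs_sub _ _).trans (by linarith)) _).trans ?_
  gcongr
  exact hB τ

variable [NormedSpace ℝ E]

/-- A family of operators with a strongly continuous strong derivative. -/
structure StrongC1 (K K' : ℝ → E →L[ℂ] E) : Prop where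
  left : StrongCont K
  deriv : StrongCont K'
  hasDerivAt : ∀ x t, HasDerivAt (fun t => K t x) (K' t x) t

/-- The product rule. -/
theorem StrongC1.hasDerivWithinAt_apply {K K' : ℝ → E →L[ℂ] E} (hK : StrongC1 K K') {x : ℝ → E}
    {x' : E} {S : Set ℝ} {t : ℝ} (hx : HasDerivWithinAt x x' S t) :
    HasDerivWithinAt (fun τ => K τ (x τ)) (K' t (x t) + K t x') S t := by
  rw [hasDerivWithinAt_iff_tendsto_slope] at hx ⊢
  have h1 := hasDerivWithinAt_iff_tendsto_slope.mp
      ((hK.hasDerivAt (x t) t).hasDerivWithinAt (s := S))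
  have h2 : Tendsto (fun τ => K τ (slope x t τ)) (𝓝[S \ {t}] t) (𝓝 (K t x')) := by
    have h3 : Tendsto (fun τ : ℝ => τ) (𝓝[S \ {t}] t) (𝓝 t) :=
        tendsto_nhdsWithin_of_tendsto_nhds tendsto_id
    exact (hK.left.continuous_uncurry.tendsto (t, x')).comp (h3.prodMk_nhds hx)
  refine (h1.add h2).congr fun τ => ?_
  simp only [slope_def_module]
  rw [map_real_smul (K τ) (K τ).continuous, ← smul_add, map_sub]
  congr 1
  abel

theorem StrongC1.norm_sub_le {K K' : ℝ → E →L[ℂ] E} (hK : StrongC1 K K') {T C : ℝ}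
    (hC : ∀ t, |t| ≤ T → ∀ x, ‖K' t x‖ ≤ C * ‖x‖) {t : ℝ} (ht : |t| ≤ T) (x : E) :
    ‖K t x - K 0 x‖ ≤ C * ‖x‖ * |t| := by
  have h0 : (0 : ℝ) ∈ Set.Icc (-T) T := abs_le.mp (by simpa using (abs_nonneg t).trans ht)
  have h := (convex_Icc (-T) T).norm_image_sub_le_of_norm_hasDerivWithin_le
    (f := fun t => K t x) (f' := fun t => K' t x) (C := C * ‖x‖)
    (fun y _ => (hK.hasDerivAt x y).hasDerivWithinAt) (fun y hy => hC y (abs_le.mpr hy) x)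
    h0 (abs_le.mp ht)
  simpa using h

/-- The Duhamel integral `∫₀ᵗ K(t - τ) h(τ) dτ`. -/
noncomputable def duhamel (K : ℝ → E →L[ℂ] E) (h : ℝ → E) (t : ℝ) : E :=
  ∫ τ in (0)..t, K (t - τ) (h τ)

theorem duhamel_sub {K : ℝ → E →L[ℂ] E} (hK : StrongCont K)
    (hh : StronglyMeasurable h) (hB : ∀ τ, ‖h τ‖ ≤ B) (t t' : ℝ) :
    duhamel K h t' = (∫ τ in (0)..t, K (t' - τ) (h τ)) + ∫ τ in t..t', K (t' - τ) (h τ) :=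
  (intervalIntegral.integral_add_adjacent_intervals (hK.intervalIntegrable hh hB _ _ _)
    (hK.intervalIntegrable hh hB _ _ _)).symm

theorem continuous_duhamel [CompleteSpace E] {K : ℝ → E →L[ℂ] E} (hK : StrongCont K)
    (hh : StronglyMeasurable h) (hB : ∀ τ, ‖h τ‖ ≤ B) : Continuous (duhamel K h) := by
  rw [continuous_iff_continuousAt]
  intro t
  have hB0 : 0 ≤ B := (norm_nonneg _).trans (hB 0)
  obtain ⟨C, hC0, hC⟩ := hK.bound (|t| + 1 + |t| + 1)
  have e : duhamel K h = fun t' =>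
      (∫ τ in (0)..t, K (t' - τ) (h τ)) + ∫ τ in t..t', K (t' - τ) (h τ) :=
    funext fun t' => duhamel_sub hK hh hB t t'
  have hnear : ∀ᶠ t' in 𝓝 t, |t' - t| ≤ 1 := by
    have : Continuous (fun t' : ℝ => |t' - t|) := by fun_prop
    exact (this.tendsto t).eventually_le_const (by simp)
  have key : ∀ t', |t' - t| ≤ 1 → ∀ τ, |τ| ≤ |t| + 1 → ‖K (t' - τ) (h τ)‖ ≤ C * B := by
    intro t' ht' τ hτ
    refine (hC _ ?_ _).trans (by gcongr; exact hB τ)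
    have : t' - τ = (t' - t) + t - τ := by ring
    rw [this]
    refine (abs_sub _ _).trans ?_
    have := abs_add_le (t' - t) t
    linarith [abs_nonneg t]
  rw [e]
  apply ContinuousAt.add
  · refine intervalIntegral.continuousAt_of_dominated_interval (bound := fun _ => C * B)
      (Eventually.of_forall fun t' => (hK.stronglyMeasurable_comp hh t').aestronglyMeasurable) ?_
      (by simp) ?_
    · filter_upwards [hnear] with t' ht'
      refine Eventually.of_forall fun τ hτ => key t' ht' τ ?_
      rcases Set.mem_uIoc.mp hτ with h | h <;> rw [abs_le] <;>
        constructor <;> linarith [neg_abs_le t, le_abs_self t, abs_nonneg t]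
    · refine Eventually.of_forall fun τ _ => ?_
      exact ((hK.continuous_apply (h τ)).comp (continuous_id.sub continuous_const)).continuousAt
  · rw [ContinuousAt, intervalIntegral.integral_same]
    rw [tendsto_zero_iff_norm_tendsto_zero]
    have h1 : Tendsto (fun t' : ℝ => C * B * |t' - t|) (𝓝 t) (𝓝 0) := by
      have : Continuous (fun t' : ℝ => C * B * |t' - t|) := by fun_prop
      simpa using this.tendsto t
    refine squeeze_zero' (Eventually.of_forall fun _ => norm_nonneg _) ?_ h1
    filter_upwards [hnear] with t' ht'
    refine intervalIntegral.norm_integral_le_of_norm_le_const fun τ hτ => key t' ht' τ ?_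
    have h2 : |τ - t| ≤ |t' - t| := by
      rcases Set.mem_uIoc.mp hτ with h | h
      · rw [abs_of_nonneg (by linarith), abs_of_nonneg (by linarith)]; linarith
      · rw [abs_of_nonpos (by linarith), abs_of_nonpos (by linarith)]; linarith
    have := abs_add_le (τ - t) t
    rw [sub_add_cancel] at this
    linarith

/-- Differentiation of a Duhamel integral. The term `K 0 (h τ)` is the only one where continuity of
the inhomogeneity is needed. -/
theorem hasDerivWithinAt_duhamel [CompleteSpace E] {K K' : ℝ → E →L[ℂ] E} (hK : StrongC1 K K')
    (hh : StronglyMeasurable h) (hB : ∀ τ, ‖h τ‖ ≤ B) {S : Set ℝ} (hS : S.OrdConnected) {t : ℝ}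
    (ht : t ∈ S) (hc : ContinuousWithinAt (fun τ => K 0 (h τ)) S t) :
    HasDerivWithinAt (duhamel K h) (duhamel K' h t + K 0 (h t)) S t := by
  have hB0 : 0 ≤ B := (norm_nonneg _).trans (hB 0)
  have e : duhamel K h = fun t' =>
      (∫ τ in (0)..t, K (t' - τ) (h τ)) + ∫ τ in t..t', K (t' - τ) (h τ) :=
    funext fun t' => duhamel_sub hK.left hh hB t t'
  rw [e]
  apply HasDerivWithinAt.add
  · apply HasDerivAt.hasDerivWithinAt
    obtain ⟨C, hC0, hC⟩ := hK.deriv.bound (|t| + 1 + |t|)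
    refine (intervalIntegral.hasDerivAt_integral_of_dominated_loc_of_deriv_le
      (F := fun t' τ => K (t' - τ) (h τ)) (F' := fun t' τ => K' (t' - τ) (h τ))
      (bound := fun _ => C * B) (s := Metric.ball t 1) (Metric.ball_mem_nhds t one_pos)
      (Eventually.of_forall fun t' => (hK.left.stronglyMeasurable_comp hh t').aestronglyMeasurable)
      (hK.left.intervalIntegrable hh hB _ _ _)
      (hK.deriv.stronglyMeasurable_comp hh t).aestronglyMeasurable ?_ (by simp) ?_).2
    · refine Eventually.of_forall fun τ hτ t' ht' => ?_
      refine (hC _ ?_ _).trans (by gcongr; exact hB τ)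
      have h1 : |τ| ≤ |t| := by
        rcases Set.mem_uIoc.mp hτ with h | h <;> rw [abs_le] <;>
          constructor <;> linarith [neg_abs_le t, le_abs_self t, abs_nonneg t]
      have h2 : |t' - t| ≤ 1 := by
        have := Metric.mem_ball.mp ht'
        rw [Real.dist_eq] at this
        exact this.le
      have : t' - τ = (t' - t) + t - τ := by ring
      rw [this]
      refine (abs_sub _ _).trans ?_
      have := abs_add_le (t' - t) t
      linarith [abs_nonneg t]
    · refine Eventually.of_forall fun τ _ t' _ => ?_
      exact (hK.hasDerivAt (h τ) (t' - τ)).comp_sub_const t' τ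
  · obtain ⟨C, hC0, hC⟩ := hK.deriv.bound 1
    rw [hasDerivWithinAt_iff_isLittleO, intervalIntegral.integral_same,
      Asymptotics.isLittleO_iff]
    intro ε hε
    obtain ⟨δ, hδ, hδ'⟩ := Metric.continuousWithinAt_iff.mp hc (ε / 2) (by positivity)
    set r := min δ (min 1 (ε / (2 * (C * B + 1)))) with hr
    have hr0 : 0 < r := by positivity
    have hmem : ∀ᶠ t' in 𝓝[S] t, t' ∈ S ∧ |t' - t| < r := by
      refine (eventually_mem_nhdsWithin).and ?_
      have := nhdsWithin_le_nhds (s := S) (Metric.ball_mem_nhds t hr0)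
      filter_upwards [this] with t' ht'
      have := Metric.mem_ball.mp ht'
      rwa [Real.dist_eq] at this
    filter_upwards [hmem] with t' ht'
    obtain ⟨htS, htr⟩ := ht'
    have h1 : (∫ τ in t..t', K (t' - τ) (h τ)) - 0 - (t' - t) • K 0 (h t) =
        ∫ τ in t..t', (K (t' - τ) (h τ) - K 0 (h t)) := by
      rw [intervalIntegral.integral_sub (hK.left.intervalIntegrable hh hB _ _ _) (by simp)]
      simp
    rw [h1, Real.norm_eq_abs]
    refine intervalIntegral.norm_integral_le_of_norm_le_const fun τ hτ => ?_
    have h2 : |τ - t| ≤ |t' - t| ∧ |t' - τ| ≤ |t' - t| := by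
      rcases Set.mem_uIoc.mp hτ with h | h
      · rw [abs_of_nonneg (by linarith), abs_of_nonneg (by linarith), abs_of_nonneg (by linarith)]
        constructor <;> linarith
      · rw [abs_of_nonpos (by linarith), abs_of_nonpos (by linarith), abs_of_nonpos (by linarith)]
        constructor <;> linarith
    have hτS : τ ∈ S := hS.uIcc_subset ht htS (Set.uIoc_subset_uIcc hτ)
    have h3 : ‖K 0 (h τ) - K 0 (h t)‖ < ε / 2 := by
      rw [← dist_eq_norm]
      apply hδ' hτS
      rw [Real.dist_eq]
      exact (h2.1.trans_lt htr).trans_le (min_le_left _ _)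
    have h4 : ‖K (t' - τ) (h τ) - K 0 (h τ)‖ ≤ ε / 2 := by
      refine (hK.norm_sub_le hC
          (h2.2.trans (htr.le.trans ((min_le_right _ _).trans (min_le_left _ _)))) _).trans ?_
      have h5 : |t' - τ| ≤ ε / (2 * (C * B + 1)) :=
        h2.2.trans (htr.le.trans ((min_le_right _ _).trans (min_le_right _ _)))
      calc C * ‖h τ‖ * |t' - τ| ≤ (C * B + 1) * (ε / (2 * (C * B + 1))) := by
            gcongr
            have : C * ‖h τ‖ ≤ C * B := by gcongr; exact hB τ
            linarith
        _ = ε / 2 := by field_simp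
    have h6 : K (t' - τ) (h τ) - K 0 (h t) =
        (K (t' - τ) (h τ) - K 0 (h τ)) + (K 0 (h τ) - K 0 (h t)) := by abel
    rw [h6]
    exact (norm_add_le _ _).trans (by linarith)

end Duhamel

/-! ### Real symbols depending on time -/

/-- Multiplication by a real symbol on `L²`. -/
noncomputable def mulR (m : ℝ → ℝ) : L2 →L[ℂ] L2 := mulOp (fun η => (m η : ℂ))

/-- Bounded measurable real symbols. -/
def BddR (m : ℝ → ℝ) : Prop := BddSymbol (fun η => (m η : ℂ))

theorem BddR.of_le {m : ℝ → ℝ} (hm : Measurable m) {C : ℝ} (hC : ∀ η, |m η| ≤ C) : BddR m :=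
  ⟨Complex.measurable_ofReal.comp hm, C, fun η => by
    rw [Complex.norm_real]; exact hC η⟩

theorem BddR.mul {m n : ℝ → ℝ} (hm : BddR m) (hn : BddR n) : BddR (fun η => m η * n η) := by
  have := BddSymbol.mul hm hn
  unfold BddR
  simpa only [Complex.ofReal_mul] using this

theorem BddR.neg {m : ℝ → ℝ} (hm : BddR m) : BddR (fun η => -m η) := by
  obtain ⟨h1, C, h2⟩ := hm
  refine ⟨?_, C, fun η => by simpa using h2 η⟩
  simp only [Complex.ofReal_neg]
  exact h1.neg

theorem bddR_wt {σ : ℝ} (hσ : σ ≤ 0) : BddR (wt σ) := bddSymbol_wt_neg hσ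

theorem coeFn_mulR {m : ℝ → ℝ} (hm : BddR m) (f : L2) :
    mulR m f =ᵐ[volume] fun η => (m η : ℂ) * f η := coeFn_mulOp hm f

theorem mulR_mulR {m n : ℝ → ℝ} (hm : BddR m) (hn : BddR n) (f : L2) :
    mulR m (mulR n f) = mulR (fun η => m η * n η) f := by
  unfold mulR
  rw [mulOp_mulOp hm hn]
  simp only [Complex.ofReal_mul]

theorem mulR_comm {m n : ℝ → ℝ} (hm : BddR m) (hn : BddR n) (f : L2) :
    mulR m (mulR n f) = mulR n (mulR m f) := mulOp_comm hm hn f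

theorem norm_mulR_le {m : ℝ → ℝ} (hm : Measurable m) {C : ℝ} (hC : ∀ η, |m η| ≤ C) (f : L2) :
    ‖mulR m f‖ ≤ C * ‖f‖ :=
  norm_mulOp_le (BddR.of_le hm hC) (fun η => by rw [Complex.norm_real]; exact hC η) f

theorem mulR_injective {m : ℝ → ℝ} (hm : BddR m) (h0 : ∀ η, m η ≠ 0) :
    Function.Injective (mulR m) := by
  intro f g hfg
  apply Lp.ext
  have h3 : (mulR m f : ℝ → ℂ) =ᵐ[volume] mulR m g := by rw [hfg]
  filter_upwards [coeFn_mulR hm f, coeFn_mulR hm g, h3] with η h1 h2 h3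
  rw [h1, h2] at h3
  exact mul_left_cancel₀ (by exact_mod_cast h0 η) h3

/-- A family of real symbols, continuous in time and bounded locally uniformly in time. -/
structure SymFam (m : ℝ → ℝ → ℝ) : Prop where
  meas : ∀ t, Measurable (m t)
  cont : ∀ η, Continuous fun t => m t η
  bound : ∀ T : ℝ, ∃ C : ℝ, 0 ≤ C ∧ ∀ t, |t| ≤ T → ∀ η, |m t η| ≤ C

theorem SymFam.bddR {m : ℝ → ℝ → ℝ} (hm : SymFam m) (t : ℝ) : BddR (m t) := by
  obtain ⟨C, -, hC⟩ := hm.bound |t|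
  exact BddR.of_le (hm.meas t) (hC t le_rfl)

theorem SymFam.const_mul {m : ℝ → ℝ → ℝ} (hm : SymFam m) {n : ℝ → ℝ} (hn : Measurable n) {D : ℝ}
    (hD : ∀ η, |n η| ≤ D) : SymFam (fun t η => n η * m t η) where
  meas := fun t => hn.mul (hm.meas t)
  cont := fun η => (hm.cont η).const_mul _
  bound := fun T => by
    obtain ⟨C, hC0, hC⟩ := hm.bound T
    have hD0 : 0 ≤ D := (abs_nonneg _).trans (hD 0)
    refine ⟨D * C, by positivity, fun t ht η => ?_⟩
    rw [abs_mul]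
    exact mul_le_mul (hD η) (hC t ht η) (abs_nonneg _) hD0

theorem SymFam.strongCont {m : ℝ → ℝ → ℝ} (hm : SymFam m) : StrongCont (fun t => mulR (m t)) where
  continuous_apply := fun x => by
    rw [continuous_iff_continuousAt]
    intro t
    rw [ContinuousAt, Lp.tendsto_Lp_iff_tendsto_eLpNorm']
    obtain ⟨C, hC0, hC⟩ := hm.bound (|t| + 1)
    have hnear : ∀ᶠ t' in 𝓝 t, |t'| ≤ |t| + 1 :=
      (continuous_abs.tendsto t).eventually_le_const (by simp)
    have h1 : ∀ t', (⇑(mulR (m t') x) - ⇑(mulR (m t) x)) =ᵐ[volume]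
        fun η => ((m t' η - m t η : ℝ) : ℂ) * x η := by
      intro t'
      filter_upwards [coeFn_mulR (hm.bddR t') x, coeFn_mulR (hm.bddR t) x] with η h1 h2
      rw [Pi.sub_apply, h1, h2]
      push_cast
      ring
    simp_rw [fun t' => eLpNorm_congr_ae (p := 2) (h1 t')]
    refine tendsto_eLpNorm_zero_of_dominated x (C := 2 * C) ?_ ?_ ?_
    · refine Eventually.of_forall fun t' => Measurable.aestronglyMeasurable ?_
      have h1 := measurable_coe_L2 x
      have h2 := hm.meas t
      have h3 := hm.meas t'
      fun_prop
    · filter_upwards [hnear] with t' ht'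
      refine Eventually.of_forall fun η => ?_
      rw [norm_mul, Complex.norm_real, Real.norm_eq_abs]
      gcongr
      refine (abs_sub _ _).trans ?_
      linarith [hC t' ht' η, hC t (by linarith) η]
    · refine Eventually.of_forall fun η => ?_
      have h2 : Continuous (fun t' => ((m t' η - m t η : ℝ) : ℂ) * x η) := by
        have := hm.cont η
        fun_prop
      simpa using h2.tendsto t
  bound := fun T => by
    obtain ⟨C, hC0, hC⟩ := hm.bound T
    exact ⟨C, hC0, fun t ht x => norm_mulR_le (hm.meas t) (hC t ht) x⟩

theorem SymFam.strongC1 {m m' : ℝ → ℝ → ℝ} (hm : SymFam m) (hm' : SymFam m')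
    (hd : ∀ t η, HasDerivAt (fun t => m t η) (m' t η) t) :
    StrongC1 (fun t => mulR (m t)) (fun t => mulR (m' t)) where
  left := hm.strongCont
  deriv := hm'.strongCont
  hasDerivAt := fun x t => by
    rw [hasDerivAt_iff_tendsto_slope, Lp.tendsto_Lp_iff_tendsto_eLpNorm']
    obtain ⟨C, hC0, hC⟩ := hm'.bound (|t| + 1)
    have hnear : ∀ᶠ t' in 𝓝[≠] t, |t'| ≤ |t| + 1 :=
      nhdsWithin_le_nhds ((continuous_abs.tendsto t).eventually_le_const (by simp))
    have h1 : ∀ t', (⇑(slope (fun t => mulR (m t) x) t t') - ⇑(mulR (m' t) x)) =ᵐ[volume]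
        fun η => ((slope (fun t => m t η) t t' - m' t η : ℝ) : ℂ) * x η := by
      intro t'
      rw [slope_def_module]
      filter_upwards [coeFn_mulR (hm.bddR t') x, coeFn_mulR (hm.bddR t) x, 
        coeFn_mulR (hm'.bddR t) x, Lp.coeFn_smul (t' - t)⁻¹ (mulR (m t') x - mulR (m t) x),
        Lp.coeFn_sub (mulR (m t') x) (mulR (m t) x)] with η h1 h2 h3 h4 h5
      rw [Pi.sub_apply, h4, Pi.smul_apply, h5, Pi.sub_apply, h1, h2, h3, slope_def_module,
        Complex.real_smul, smul_eq_mul]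
      push_cast
      ring
    simp_rw [fun t' => eLpNorm_congr_ae (p := 2) (h1 t')]
    refine tendsto_eLpNorm_zero_of_dominated x (C := 2 * C) ?_ ?_ ?_
    · refine Eventually.of_forall fun t' => Measurable.aestronglyMeasurable ?_
      have h1 := measurable_coe_L2 x
      have h2 := hm.meas t
      have h3 := hm.meas t'
      have h4 := hm'.meas t
      simp only [slope_def_module, smul_eq_mul]
      fun_prop
    · filter_upwards [hnear, self_mem_nhdsWithin] with t' ht' hne
      refine Eventually.of_forall fun η => ?_
      rw [norm_mul, Complex.norm_real, Real.norm_eq_abs]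
      gcongr
      refine (abs_sub _ _).trans ?_
      have h2 : |slope (fun t => m t η) t t'| ≤ C := by
        have h3 := (convex_Icc (-(|t| + 1)) (|t| + 1)).norm_image_sub_le_of_norm_hasDerivWithin_le
          (f := fun t => m t η) (f' := fun t => m' t η) (C := C)
          (fun y _ => (hd y η).hasDerivWithinAt) (fun y hy => hC y (abs_le.mpr hy) η)
          (abs_le.mp (show |t| ≤ |t| + 1 by linarith)) (abs_le.mp ht')
        rw [slope_def_field, abs_div, div_le_iff₀ (abs_pos.mpr (sub_ne_zero.mpr hne))]
        exact h3
      linarith [hC t (by linarith) η]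
    · refine Eventually.of_forall fun η => ?_
      have h2 := (hasDerivAt_iff_tendsto_slope.mp (hd t η)).sub_const (m' t η)
      rw [sub_self] at h2
      have h3 := ((Complex.continuous_ofReal.tendsto _).comp h2).mul_const (x η)
      simpa [Function.comp_def] using h3

/-! ### The symbols of the linear wave equation -/

/-- The hypotheses on the order `ρ` and the symbol `l` of the operator `L`. -/
structure Admissible (ρ : ℝ) (l : ℝ → ℝ) (c₁ c₂ : ℝ) : Prop where
  two_le : 2 ≤ ρ
  meas : Measurable l
  even : ∀ ξ, l (-ξ) = l ξ
  pos₁ : 0 < c₁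
  pos₂ : 0 < c₂
  lower : ∀ ξ, c₁ ^ 2 * (1 + ξ ^ 2) ^ (ρ / 2) ≤ l ξ
  upper : ∀ ξ, l ξ ≤ c₂ ^ 2 * (1 + ξ ^ 2) ^ (ρ / 2)

/-- The frequency `ω = |ξ| √l(ξ)` of the linear equation at `ξ = 2πη`. -/
noncomputable def omg (l : ℝ → ℝ) (η : ℝ) : ℝ := |2 * Real.pi * η| * √(l (2 * Real.pi * η))

/-- The symbol `cos(tω)`. -/
noncomputable def cosS (l : ℝ → ℝ) (t η : ℝ) : ℝ := Real.cos (t * omg l η)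

/-- The symbol `sin(tω)/ω`, with the value `t` at `ω = 0`. -/
noncomputable def sinS (l : ℝ → ℝ) (t η : ℝ) : ℝ :=
  if omg l η = 0 then t else Real.sin (t * omg l η) / omg l η

/-- The symbol `ξ²`. -/
noncomputable def xisq (η : ℝ) : ℝ := (2 * Real.pi * η) ^ 2

theorem hasDerivAt_sinS (l : ℝ → ℝ) (t η : ℝ) :
    HasDerivAt (fun t => sinS l t η) (cosS l t η) t := by
  unfold sinS cosS
  split_ifs with h
  · rw [h, mul_zero, Real.cos_zero]
    exact hasDerivAt_id t
  · have h1 := (((hasDerivAt_id t).mul_const (omg l η)).sin).div_const (omg l η)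
    simp only [id, one_mul] at h1
    rwa [mul_div_cancel_right₀ _ h] at h1

theorem omg_mul_sinS (l : ℝ → ℝ) (t η : ℝ) : omg l η * sinS l t η = Real.sin (t * omg l η) := by
  unfold sinS
  split_ifs with h
  · simp [h]
  · rw [mul_div_cancel₀ _ h]

theorem hasDerivAt_cosS (l : ℝ → ℝ) (t η : ℝ) :
    HasDerivAt (fun t => cosS l t η) (-(omg l η ^ 2 * sinS l t η)) t := by
  unfold cosS
  have h1 := ((hasDerivAt_id t).mul_const (omg l η)).cos
  simp only [id, one_mul] at h1
  convert h1 using 1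
  rw [← omg_mul_sinS]
  ring

theorem abs_omg_mul_sinS_le (l : ℝ → ℝ) (t η : ℝ) : |omg l η * sinS l t η| ≤ 1 := by
  rw [omg_mul_sinS]
  exact Real.abs_sin_le_one _

theorem omg_nonneg (l : ℝ → ℝ) (η : ℝ) : 0 ≤ omg l η := by unfold omg; positivity

theorem abs_sinS_le (l : ℝ → ℝ) (t η : ℝ) : |sinS l t η| ≤ |t| := by
  unfold sinS
  split_ifs with h
  · exact le_rfl
  · have h0 : 0 < omg l η := lt_of_le_of_ne (omg_nonneg l η) (Ne.symm h)
    rw [abs_div, abs_of_pos h0, div_le_iff₀ h0]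
    refine (Real.abs_sin_le_abs).trans_eq ?_
    rw [abs_mul, abs_of_pos h0]

theorem sinS_zero (l : ℝ → ℝ) (η : ℝ) : sinS l 0 η = 0 := by
  simpa using abs_sinS_le l 0 η

theorem cosS_zero (l : ℝ → ℝ) (η : ℝ) : cosS l 0 η = 1 := by simp [cosS]

theorem xisq_nonneg (η : ℝ) : 0 ≤ xisq η := sq_nonneg _

theorem measurable_xisq : Measurable xisq := by unfold xisq; fun_prop

namespace Admissible

variable {ρ : ℝ} {l : ℝ → ℝ} {c₁ c₂ : ℝ}

theorem measurable_omg (H : Admissible ρ l c₁ c₂) : Measurable (omg l) := by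
  have := H.meas
  unfold omg
  fun_prop

theorem measurable_cosS (H : Admissible ρ l c₁ c₂) (t : ℝ) : Measurable (cosS l t) := by
  have := H.measurable_omg
  unfold cosS
  fun_prop

theorem measurable_sinS (H : Admissible ρ l c₁ c₂) (t : ℝ) : Measurable (sinS l t) := by
  have := H.measurable_omg
  unfold sinS
  refine Measurable.ite (measurableSet_eq_fun this measurable_const) measurable_const ?_
  fun_prop

theorem omg_le (H : Admissible ρ l c₁ c₂) (η : ℝ) : omg l η ≤ c₂ * wt (1 + ρ / 2) η := by
  have h1 : |2 * Real.pi * η| ≤ wt 1 η := by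
    unfold wt
    rw [← Real.sqrt_eq_rpow, ← Real.sqrt_sq_eq_abs]
    exact Real.sqrt_le_sqrt (by linarith)
  have h2 : √(l (2 * Real.pi * η)) ≤ c₂ * wt (ρ / 2) η := by
    refine (Real.sqrt_le_sqrt (H.upper _)).trans_eq ?_
    rw [Real.sqrt_mul (sq_nonneg _), Real.sqrt_sq H.pos₂.le]
    congr 1
    unfold wt
    rw [Real.sqrt_eq_rpow, ← Real.rpow_mul (by positivity)]
    congr 1
    ring
  unfold omg
  rw [wt_add]
  calc |2 * Real.pi * η| * √(l (2 * Real.pi * η)) ≤ wt 1 η * (c₂ * wt (ρ / 2) η) :=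
        mul_le_mul h1 h2 (Real.sqrt_nonneg _) (wt_pos _ _).le
    _ = _ := by ring

theorem omg_mul_wt_le (H : Admissible ρ l c₁ c₂) (η : ℝ) : omg l η * wt (-(1 + ρ / 2)) η ≤ c₂ := by
  calc omg l η * wt (-(1 + ρ / 2)) η ≤ c₂ * wt (1 + ρ / 2) η * wt (-(1 + ρ / 2)) η := by
        gcongr
        · exact (wt_pos _ _).le
        · exact H.omg_le η
    _ = c₂ := by rw [mul_assoc, wt_mul_neg, mul_one]

theorem xisq_mul_wt_le (H : Admissible ρ l c₁ c₂) (η : ℝ) : xisq η * wt (-(1 + ρ / 2)) η ≤ 1 := by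
  have h1 : xisq η ≤ wt (1 + ρ / 2) η := by
    have h2 : xisq η ≤ wt 2 η := by rw [wt_two]; unfold xisq; linarith
    exact h2.trans (wt_mono (by linarith [H.two_le]) η)
  calc xisq η * wt (-(1 + ρ / 2)) η ≤ wt (1 + ρ / 2) η * wt (-(1 + ρ / 2)) η := by
        gcongr; exact (wt_pos _ _).le
    _ = 1 := wt_mul_neg _ _

/-- The smoothing property of the kernel `sin(tω)/ω`: it gains `1 + ρ/2` derivatives. -/
theorem exists_wt_mul_sinS_le (H : Admissible ρ l c₁ c₂) :
    ∃ C : ℝ, 0 ≤ C ∧ ∀ t η, wt (1 + ρ / 2) η * |sinS l t η| ≤ C * (1 + |t|) := by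
  have hp : (0 : ℝ) ≤ 1 + ρ / 2 := by linarith [H.two_le]
  refine ⟨max (2 / c₁) (2 ^ ((1 + ρ / 2) / 2)), by positivity, fun t η => ?_⟩
  rcases le_or_gt 1 |2 * Real.pi * η| with h | h
  · -- for `|ξ| ≥ 1`, `ω` is bounded below by a multiple of the weight of order `1 + ρ/2`
    have h1 : wt 1 η ≤ 2 * |2 * Real.pi * η| := by
      unfold wt
      rw [← Real.sqrt_eq_rpow]
      apply Real.sqrt_le_iff.mpr ⟨by positivity, ?_⟩
      have h2 : (1 : ℝ) ≤ |2 * Real.pi * η| ^ 2 := one_le_pow₀ h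
      rw [sq_abs] at h2
      have h3 : (2 * |2 * Real.pi * η|) ^ 2 = 4 * (2 * Real.pi * η) ^ 2 := by
        rw [mul_pow, sq_abs]; norm_num
      linarith
    have h2 : c₁ * wt (ρ / 2) η ≤ √(l (2 * Real.pi * η)) := by
      refine le_trans (le_of_eq ?_) (Real.sqrt_le_sqrt (H.lower _))
      rw [Real.sqrt_mul (sq_nonneg _), Real.sqrt_sq H.pos₁.le]
      congr 1
      unfold wt
      rw [Real.sqrt_eq_rpow, ← Real.rpow_mul (by positivity)]
      congr 1
      ring
    have h3 : c₁ * wt (1 + ρ / 2) η ≤ 2 * omg l η := by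
      unfold omg
      rw [wt_add]
      calc c₁ * (wt 1 η * wt (ρ / 2) η) = wt 1 η * (c₁ * wt (ρ / 2) η) := by ring
        _ ≤ 2 * |2 * Real.pi * η| * √(l (2 * Real.pi * η)) :=
          mul_le_mul h1 h2 (mul_nonneg H.pos₁.le (wt_pos _ _).le) (by positivity)
        _ = _ := by ring
    have h4 := abs_omg_mul_sinS_le l t η
    rw [abs_mul, abs_of_nonneg (omg_nonneg l η)] at h4
    have h5 : c₁ * (wt (1 + ρ / 2) η * |sinS l t η|) ≤ 2 := by
      calc c₁ * (wt (1 + ρ / 2) η * |sinS l t η|) = c₁ * wt (1 + ρ / 2) η * |sinS l t η| := by ring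
        _ ≤ 2 * omg l η * |sinS l t η| := by gcongr
        _ ≤ 2 := by linarith
    have h6 : wt (1 + ρ / 2) η * |sinS l t η| ≤ 2 / c₁ := by
      rw [le_div_iff₀ H.pos₁]; linarith
    calc wt (1 + ρ / 2) η * |sinS l t η| ≤ 2 / c₁ := h6
      _ ≤ max (2 / c₁) (2 ^ ((1 + ρ / 2) / 2)) := le_max_left _ _
      _ ≤ _ := le_mul_of_one_le_right (by positivity) (by linarith [abs_nonneg t])
  · have h1 : wt (1 + ρ / 2) η ≤ 2 ^ ((1 + ρ / 2) / 2) := by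
      unfold wt
      apply Real.rpow_le_rpow (by positivity) _ (by positivity)
      have := sq_lt_one_iff_abs_lt_one (2 * Real.pi * η) |>.mpr h
      linarith
    calc wt (1 + ρ / 2) η * |sinS l t η| ≤ max (2 / c₁) (2 ^ ((1 + ρ / 2) / 2)) * |t| :=
          mul_le_mul (h1.trans (le_max_right _ _)) (abs_sinS_le _ _ _) (abs_nonneg _)
              (by positivity)
      _ ≤ _ := by gcongr; linarith

theorem symFam_cosS (H : Admissible ρ l c₁ c₂) : SymFam (cosS l) where
  meas := H.measurable_cosS
  cont := fun η => by unfold cosS; fun_prop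
  bound := fun _ => ⟨1, zero_le_one, fun _ _ _ => Real.abs_cos_le_one _⟩

theorem continuous_sinS (l : ℝ → ℝ) (η : ℝ) : Continuous fun t => sinS l t η :=
  continuous_iff_continuousAt.mpr fun t => (hasDerivAt_sinS l t η).continuousAt

theorem symFam_sinS (H : Admissible ρ l c₁ c₂) : SymFam (sinS l) where
  meas := H.measurable_sinS
  cont := continuous_sinS l
  bound := fun T => ⟨|T|, abs_nonneg _, fun t ht η =>
    (abs_sinS_le l t η).trans (ht.trans (le_abs_self T))⟩

theorem symFam_wt_sinS (H : Admissible ρ l c₁ c₂) :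
    SymFam (fun t η => wt (1 + ρ / 2) η * sinS l t η) where
  meas := fun t => (measurable_wt _).mul (H.measurable_sinS t)
  cont := fun η => (continuous_sinS l η).const_mul _
  bound := fun T => by
    obtain ⟨C, hC0, hC⟩ := H.exists_wt_mul_sinS_le
    refine ⟨C * (1 + |T|), by positivity, fun t ht η => ?_⟩
    rw [abs_mul, abs_of_pos (wt_pos _ _)]
    exact (hC t η).trans (mul_le_mul_of_nonneg_left (by linarith [le_abs_self T]) hC0)

theorem symFam_omg_sinS (H : Admissible ρ l c₁ c₂) : SymFam (fun t η => omg l η * sinS l t η) where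
  meas := fun t => H.measurable_omg.mul (H.measurable_sinS t)
  cont := fun η => (continuous_sinS l η).const_mul _
  bound := fun _ => ⟨1, zero_le_one, fun t _ η => abs_omg_mul_sinS_le l t η⟩

end Admissible

theorem StrongCont.continuousOn_apply {E : Type*} [NormedAddCommGroup E] [NormedSpace ℂ E]
    {K : ℝ → E →L[ℂ] E} (hK : StrongCont K) {φ : ℝ → ℝ} (hφ : Continuous φ) {x : ℝ → E} {S : Set ℝ}
    (hx : ContinuousOn x S) : ContinuousOn (fun τ => K (φ τ) (x τ)) S :=
  hK.continuous_uncurry.comp_continuousOn (hφ.continuousOn.prodMk hx)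

/-- Reversal of time. -/
theorem StrongC1.comp_const_sub {E : Type*} [NormedAddCommGroup E] [NormedSpace ℂ E]
    [NormedSpace ℝ E] {P P' : ℝ → E →L[ℂ] E} (hP : StrongC1 P P') (t : ℝ) :
    StrongC1 (fun τ => P (t - τ)) (fun τ => -P' (t - τ)) := by
  have aux : ∀ {Q : ℝ → E →L[ℂ] E}, StrongCont Q → StrongCont (fun τ => Q (t - τ)) := by
    intro Q hQ
    refine ⟨fun x => (hQ.continuous_apply x).comp (by fun_prop), fun T => ?_⟩
    obtain ⟨C, hC0, hC⟩ := hQ.bound (|t| + T)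
    exact ⟨C, hC0, fun τ hτ x => hC _ ((abs_sub _ _).trans (by linarith)) x⟩
  refine ⟨aux hP.left, ⟨fun x => ((aux hP.deriv).continuous_apply x).neg, fun T => ?_⟩,
    fun x τ => ?_⟩
  · obtain ⟨C, hC0, hC⟩ := (aux hP.deriv).bound T
    exact ⟨C, hC0, fun τ hτ x => by simpa using hC τ hτ x⟩
  · exact (hP.hasDerivAt x (t - τ)).comp_const_sub t τ

/-- A family of real symbols with a time derivative, both continuous in time and bounded locally
uniformly in time. -/
structure SymC1 (m m' : ℝ → ℝ → ℝ) : Prop where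
  left : SymFam m
  deriv : SymFam m'
  hasDerivAt : ∀ t η, HasDerivAt (fun t => m t η) (m' t η) t

theorem SymC1.const_mul {m m' : ℝ → ℝ → ℝ} (hm : SymC1 m m') {n : ℝ → ℝ} (hn : Measurable n)
    {D : ℝ} (hD : ∀ η, |n η| ≤ D) : SymC1 (fun t η => n η * m t η) (fun t η => n η * m' t η) where
  left := hm.left.const_mul hn hD
  deriv := hm.deriv.const_mul hn hD
  hasDerivAt := fun t η => (hm.hasDerivAt t η).const_mul _

theorem SymC1.strongC1 {m m' : ℝ → ℝ → ℝ} (hm : SymC1 m m') :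
    StrongC1 (fun t => mulR (m t)) (fun t => mulR (m' t)) :=
  hm.left.strongC1 hm.deriv hm.hasDerivAt

/-- A multiplier is moved into the kernel. -/
theorem mulR_duhamel {m : ℝ → ℝ → ℝ} (hm : SymFam m) {n : ℝ → ℝ} (hn : BddR n) {h : ℝ → L2}
    {B : ℝ} (hh : StronglyMeasurable h) (hB : ∀ τ, ‖h τ‖ ≤ B) (t : ℝ) :
    mulR n (duhamel (fun t => mulR (m t)) h t) =
      duhamel (fun t => mulR (fun η => n η * m t η)) h t := by
  unfold duhamel
  rw [← ContinuousLinearMap.intervalIntegral_comp_comm _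
    (hm.strongCont.intervalIntegrable hh hB t 0 t)]
  simp_rw [mulR_mulR hn (hm.bddR _)]

/-- A multiplier is moved into the inhomogeneity. -/
theorem mulR_duhamel' {m : ℝ → ℝ → ℝ} (hm : SymFam m) {n : ℝ → ℝ} (hn : BddR n) {h : ℝ → L2}
    {B : ℝ} (hh : StronglyMeasurable h) (hB : ∀ τ, ‖h τ‖ ≤ B) (t : ℝ) :
    mulR n (duhamel (fun t => mulR (m t)) h t) =
      duhamel (fun t => mulR (m t)) (fun τ => mulR n (h τ)) t := by
  unfold duhamel
  rw [← ContinuousLinearMap.intervalIntegral_comp_comm _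
    (hm.strongCont.intervalIntegrable hh hB t 0 t)]
  simp_rw [mulR_comm hn (hm.bddR _)]

/-! ### The mild formulation of the wave equation -/

/-- The weight of order `-(1 + ρ/2)`. -/
noncomputable def wS (ρ : ℝ) : ℝ → ℝ := wt (-(1 + ρ / 2))

/-- The bounded symbol `ξ² (1+ξ²)^(-(1 + ρ/2)/2)`. -/
noncomputable def qS (ρ η : ℝ) : ℝ := xisq η * wS ρ η

/-- The bounded symbol `ω (1+ξ²)^(-(1 + ρ/2)/2)`. -/
noncomputable def rS (ρ : ℝ) (l : ℝ → ℝ) (η : ℝ) : ℝ := omg l η * wS ρ η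

/-- The symbol `(1+ξ²)^((1 + ρ/2)/2) sin(tω)/ω`, which carries the initial velocity to
the solution. -/
noncomputable def velS (ρ : ℝ) (l : ℝ → ℝ) (t η : ℝ) : ℝ := wt (1 + ρ / 2) η * sinS l t η

/-- The symbol `-ξ² sin(tω)/ω`, which carries the nonlinearity to the solution. -/
noncomputable def kerA (ρ : ℝ) (l : ℝ → ℝ) (t η : ℝ) : ℝ := -qS ρ η * velS ρ l t η

/-- The symbol `-ξ² (1+ξ²)^(-(1 + ρ/2)/2) cos(tω)`, which carries the nonlinearity to the
velocity. -/
noncomputable def kerB (ρ : ℝ) (l : ℝ → ℝ) (t η : ℝ) : ℝ := -qS ρ η * cosS l t η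

/-- The symbol `-ω² (1+ξ²)^(-(1 + ρ/2)/2) sin(tω)/ω`. -/
noncomputable def accS (ρ : ℝ) (l : ℝ → ℝ) (t η : ℝ) : ℝ := -rS ρ l η * (omg l η * sinS l t η)

theorem wS_mul_velS (ρ : ℝ) (l : ℝ → ℝ) (t η : ℝ) : wS ρ η * velS ρ l t η = sinS l t η := by
  unfold wS velS
  rw [← mul_assoc, wt_neg_mul, one_mul]

theorem wS_mul_kerA (ρ : ℝ) (l : ℝ → ℝ) (t η : ℝ) :
    wS ρ η * kerA ρ l t η = -qS ρ η * sinS l t η := by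
  rw [← wS_mul_velS ρ]
  unfold kerA
  ring

theorem wS_mul_accS (ρ : ℝ) (l : ℝ → ℝ) (t η : ℝ) :
    wS ρ η * accS ρ l t η = -(rS ρ l η * rS ρ l η) * sinS l t η := by
  unfold accS rS
  ring

/-- The Fourier side of the solution of the linear equation with inhomogeneity `h_xx`, initial
value `A₀` and initial velocity `B₀`, where `A₀` and `h` are normalized by the weight of order `s`
and `B₀` by the weight of order `s - 1 - ρ/2`. -/
noncomputable def duhA (ρ : ℝ) (l : ℝ → ℝ) (A₀ B₀ : L2) (h : ℝ → L2) (t : ℝ) : L2 :=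
  mulR (cosS l t) A₀ + mulR (velS ρ l t) B₀ + duhamel (fun t => mulR (kerA ρ l t)) h t

/-- The time derivative of `duhA`, normalized by the weight of order `s - 1 - ρ/2`. -/
noncomputable def duhB (ρ : ℝ) (l : ℝ → ℝ) (A₀ B₀ : L2) (h : ℝ → L2) (t : ℝ) : L2 :=
  mulR (accS ρ l t) A₀ + mulR (cosS l t) B₀ + duhamel (fun t => mulR (kerB ρ l t)) h t

namespace Admissible

variable {ρ : ℝ} {l : ℝ → ℝ} {c₁ c₂ : ℝ}

theorem bddR_wS (H : Admissible ρ l c₁ c₂) : BddR (wS ρ) := bddR_wt (by linarith [H.two_le])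

theorem measurable_wS : Measurable (wS ρ) := measurable_wt _

theorem abs_wS_le (H : Admissible ρ l c₁ c₂) (η : ℝ) : |wS ρ η| ≤ 1 := by
  unfold wS
  rw [abs_of_pos (wt_pos _ _)]
  exact wt_le_one (by linarith [H.two_le]) η

theorem measurable_qS : Measurable (qS ρ) := measurable_xisq.mul (measurable_wt _)

theorem abs_neg_qS_le (H : Admissible ρ l c₁ c₂) (η : ℝ) : |-qS ρ η| ≤ 1 := by
  unfold qS wS
  rw [abs_neg, abs_of_nonneg (mul_nonneg (xisq_nonneg _) (wt_pos _ _).le)]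
  exact H.xisq_mul_wt_le η

theorem measurable_rS (H : Admissible ρ l c₁ c₂) : Measurable (rS ρ l) :=
  H.measurable_omg.mul (measurable_wt _)

theorem abs_rS_le (H : Admissible ρ l c₁ c₂) (η : ℝ) : |rS ρ l η| ≤ c₂ := by
  unfold rS wS
  rw [abs_of_nonneg (mul_nonneg (omg_nonneg _ _) (wt_pos _ _).le)]
  exact H.omg_mul_wt_le η

theorem bddR_neg_qS (H : Admissible ρ l c₁ c₂) : BddR (fun η => -qS ρ η) :=
  BddR.of_le measurable_qS.neg H.abs_neg_qS_le

theorem bddR_rS (H : Admissible ρ l c₁ c₂) : BddR (rS ρ l) :=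
  BddR.of_le H.measurable_rS H.abs_rS_le

theorem symFam_velS (H : Admissible ρ l c₁ c₂) : SymFam (velS ρ l) := H.symFam_wt_sinS

theorem symFam_kerA (H : Admissible ρ l c₁ c₂) : SymFam (kerA ρ l) :=
  H.symFam_velS.const_mul measurable_qS.neg H.abs_neg_qS_le

theorem symFam_kerB (H : Admissible ρ l c₁ c₂) : SymFam (kerB ρ l) :=
  H.symFam_cosS.const_mul measurable_qS.neg H.abs_neg_qS_le

theorem symFam_accS (H : Admissible ρ l c₁ c₂) : SymFam (accS ρ l) :=
  H.symFam_omg_sinS.const_mul H.measurable_rS.neg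
    (fun η => (abs_neg _).trans_le (H.abs_rS_le η))

theorem symC1_sinS (H : Admissible ρ l c₁ c₂) : SymC1 (sinS l) (cosS l) :=
  ⟨H.symFam_sinS, H.symFam_cosS, hasDerivAt_sinS l⟩

theorem symC1_wS_cosS (H : Admissible ρ l c₁ c₂) :
    SymC1 (fun t η => wS ρ η * cosS l t η) (accS ρ l) where
  left := H.symFam_cosS.const_mul measurable_wS H.abs_wS_le
  deriv := H.symFam_accS
  hasDerivAt := fun t η => by
    refine ((hasDerivAt_cosS l t η).const_mul (wS ρ η)).congr_deriv ?_
    unfold accS rS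
    ring

theorem symC1_wS_kerA (H : Admissible ρ l c₁ c₂) :
    SymC1 (fun t η => wS ρ η * kerA ρ l t η) (kerB ρ l) := by
  simp_rw [wS_mul_kerA]
  exact H.symC1_sinS.const_mul measurable_qS.neg H.abs_neg_qS_le

theorem symC1_wS_accS (H : Admissible ρ l c₁ c₂) :
    SymC1 (fun t η => wS ρ η * accS ρ l t η)
      (fun t η => -(rS ρ l η * rS ρ l η) * cosS l t η) := by
  simp_rw [wS_mul_accS]
  refine H.symC1_sinS.const_mul (D := c₂ * c₂) (H.measurable_rS.mul H.measurable_rS).neg fun η => ?_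
  rw [abs_neg, abs_mul]
  exact mul_le_mul (H.abs_rS_le η) (H.abs_rS_le η) (abs_nonneg _) H.pos₂.le

theorem symC1_wS_kerB (H : Admissible ρ l c₁ c₂) :
    SymC1 (fun t η => wS ρ η * kerB ρ l t η) (fun t η => -qS ρ η * accS ρ l t η) := by
  have e : (fun t η => wS ρ η * kerB ρ l t η) = fun t η => -qS ρ η * (wS ρ η * cosS l t η) := by
    funext t η
    unfold kerB
    ring
  rw [e]
  exact H.symC1_wS_cosS.const_mul (n := fun η => -qS ρ η) measurable_qS.neg H.abs_neg_qS_le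

/-- `-ω² (1+ξ²)^(-(1+ρ/2))` is a bounded symbol. -/
theorem bddR_neg_rS_sq (H : Admissible ρ l c₁ c₂) : BddR (fun η => -(rS ρ l η * rS ρ l η)) :=
  (H.bddR_rS.mul H.bddR_rS).neg

theorem bddR_neg_qS_wS (H : Admissible ρ l c₁ c₂) : BddR (fun η => -qS ρ η * wS ρ η) :=
  H.bddR_neg_qS.mul H.bddR_wS

variable {A₀ B₀ : L2} {h : ℝ → L2} {B : ℝ}

theorem continuous_duhA (H : Admissible ρ l c₁ c₂) (hh : StronglyMeasurable h)
    (hB : ∀ τ, ‖h τ‖ ≤ B) : Continuous (duhA ρ l A₀ B₀ h) :=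
  ((H.symFam_cosS.strongCont.continuous_apply A₀).add
    (H.symFam_velS.strongCont.continuous_apply B₀)).add
    (continuous_duhamel H.symFam_kerA.strongCont hh hB)

theorem continuous_duhB (H : Admissible ρ l c₁ c₂) (hh : StronglyMeasurable h)
    (hB : ∀ τ, ‖h τ‖ ≤ B) : Continuous (duhB ρ l A₀ B₀ h) :=
  ((H.symFam_accS.strongCont.continuous_apply A₀).add
    (H.symFam_cosS.strongCont.continuous_apply B₀)).add
    (continuous_duhamel H.symFam_kerB.strongCont hh hB)

theorem mulR_duhA (H : Admissible ρ l c₁ c₂) (hh : StronglyMeasurable h)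
    (hB : ∀ τ, ‖h τ‖ ≤ B) {n : ℝ → ℝ} (hn : BddR n) (t : ℝ) :
    mulR n (duhA ρ l A₀ B₀ h t) = duhA ρ l (mulR n A₀) (mulR n B₀) (fun τ => mulR n (h τ)) t := by
  unfold duhA
  rw [map_add, map_add, mulR_comm hn (H.symFam_cosS.bddR t), mulR_comm hn (H.symFam_velS.bddR t),
    mulR_duhamel' H.symFam_kerA hn hh hB]

theorem mulR_duhB (H : Admissible ρ l c₁ c₂) (hh : StronglyMeasurable h)
    (hB : ∀ τ, ‖h τ‖ ≤ B) {n : ℝ → ℝ} (hn : BddR n) (t : ℝ) :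
    mulR n (duhB ρ l A₀ B₀ h t) = duhB ρ l (mulR n A₀) (mulR n B₀) (fun τ => mulR n (h τ)) t := by
  unfold duhB
  rw [map_add, map_add, mulR_comm hn (H.symFam_accS.bddR t), mulR_comm hn (H.symFam_cosS.bddR t),
    mulR_duhamel' H.symFam_kerB hn hh hB]

theorem mulR_zero_fun (f : L2) : mulR (fun _ => (0 : ℝ)) f = 0 := by
  apply Lp.ext
  filter_upwards [coeFn_mulR
      (BddR.of_le (m := fun _ => (0 : ℝ)) measurable_const (C := 0) (by simp)) f,
    Lp.coeFn_zero ℂ 2 (volume : Measure ℝ)] with η h1 h2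
  rw [h1, h2]
  simp

/-- In the norm of order `s - 1 - ρ/2` the variation of constants formula has the derivative
`duhB`, also for discontinuous `h`, since the kernel `sin(tω)/ω` vanishes at `t = 0`. -/
theorem hasDerivAt_duhA (H : Admissible ρ l c₁ c₂) (hh : StronglyMeasurable h)
    (hB : ∀ τ, ‖h τ‖ ≤ B) (t : ℝ) :
    HasDerivAt (fun t => mulR (wS ρ) (duhA ρ l A₀ B₀ h t)) (duhB ρ l A₀ B₀ h t) t := by
  have e : (fun t => mulR (wS ρ) (duhA ρ l A₀ B₀ h t)) = fun t =>
      mulR (fun η => wS ρ η * cosS l t η) A₀ + mulR (sinS l t) B₀ +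
        duhamel (fun t => mulR (fun η => wS ρ η * kerA ρ l t η)) h t := by
    funext t
    unfold duhA
    rw [map_add, map_add, mulR_mulR H.bddR_wS (H.symFam_cosS.bddR t),
      mulR_mulR H.bddR_wS (H.symFam_velS.bddR t), mulR_duhamel H.symFam_kerA H.bddR_wS hh hB]
    simp_rw [wS_mul_velS]
  rw [e]
  have hz : ∀ τ, mulR (fun η => wS ρ η * kerA ρ l 0 η) (h τ) = 0 := fun τ => by
    simp_rw [wS_mul_kerA, sinS_zero, mul_zero]
    exact mulR_zero_fun _
  have h3 := hasDerivWithinAt_duhamel H.symC1_wS_kerA.strongC1 hh hB (S := Set.univ)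
    Set.ordConnected_univ (Set.mem_univ t) (by simp_rw [hz]; exact continuousWithinAt_const)
  rw [hz, add_zero, hasDerivWithinAt_univ] at h3
  exact ((H.symC1_wS_cosS.strongC1.hasDerivAt A₀ t).add
    (H.symC1_sinS.strongC1.hasDerivAt B₀ t)).add h3

/-- The second time derivative, `-ω² û - ξ² ĥ`, where `h` has to be continuous. -/
theorem hasDerivWithinAt_duhB (H : Admissible ρ l c₁ c₂) (hh : StronglyMeasurable h)
    (hB : ∀ τ, ‖h τ‖ ≤ B) {S : Set ℝ} (hS : S.OrdConnected) {t : ℝ} (ht : t ∈ S)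
    (hc : ContinuousWithinAt h S t) :
    HasDerivWithinAt (fun t => mulR (wS ρ) (duhB ρ l A₀ B₀ h t))
      (mulR (fun η => -(rS ρ l η * rS ρ l η)) (duhA ρ l A₀ B₀ h t) +
        mulR (fun η => -qS ρ η * wS ρ η) (h t)) S t := by
  have e : (fun t => mulR (wS ρ) (duhB ρ l A₀ B₀ h t)) = fun t =>
      mulR (fun η => wS ρ η * accS ρ l t η) A₀ + mulR (fun η => wS ρ η * cosS l t η) B₀ +
        duhamel (fun t => mulR (fun η => wS ρ η * kerB ρ l t η)) h t := by
    funext t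
    unfold duhB
    rw [map_add, map_add, mulR_mulR H.bddR_wS (H.symFam_accS.bddR t),
      mulR_mulR H.bddR_wS (H.symFam_cosS.bddR t), mulR_duhamel H.symFam_kerB H.bddR_wS hh hB]
  rw [e]
  have h3 := hasDerivWithinAt_duhamel H.symC1_wS_kerB.strongC1 hh hB hS ht
    ((mulR _).continuous.continuousAt.comp_continuousWithinAt hc)
  refine ((((H.symC1_wS_accS.strongC1.hasDerivAt A₀ t).add
    (H.symC1_wS_cosS.strongC1.hasDerivAt B₀ t)).hasDerivWithinAt).add h3).congr_deriv ?_
  unfold duhA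
  rw [map_add, map_add, mulR_mulR H.bddR_neg_rS_sq (H.symFam_cosS.bddR t),
    mulR_mulR H.bddR_neg_rS_sq (H.symFam_velS.bddR t),
    mulR_duhamel H.symFam_kerA H.bddR_neg_rS_sq hh hB, ← add_assoc]
  have e1 : ∀ t η, -(rS ρ l η * rS ρ l η) * velS ρ l t η = accS ρ l t η := fun t η => by
    have := wS_mul_velS ρ l t η
    unfold accS
    rw [← this]
    unfold rS
    ring
  have e2 : ∀ t η, -(rS ρ l η * rS ρ l η) * kerA ρ l t η = -qS ρ η * accS ρ l t η := fun t η => by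
    rw [← e1]
    unfold kerA
    ring
  have e3 : ∀ η, wS ρ η * kerB ρ l 0 η = -qS ρ η * wS ρ η := fun η => by
    unfold kerB
    rw [cosS_zero]
    ring
  simp_rw [e1, e2, e3]

/-- Solutions of the evolution equation are given by the variation of constants formula. The
equation is required only after a further multiplication by a weight of negative order, which is
the sense in which weak solutions satisfy it. -/
theorem eq_duhA (H : Admissible ρ l c₁ c₂) (hh : StronglyMeasurable h)
    (hB : ∀ τ, ‖h τ‖ ≤ B) {X Y : ℝ → L2} {t : ℝ} (ht : 0 ≤ t)
    (hX : ContinuousOn X (Set.Icc 0 t)) (hY : ContinuousOn Y (Set.Icc 0 t))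
    (hX' : ∀ τ ∈ Set.Ioo 0 t, HasDerivAt (fun τ => mulR (wS ρ) (X τ)) (Y τ) τ)
    (hY' : ∀ τ ∈ Set.Ioo 0 t, HasDerivAt (fun τ => mulR (wS ρ) (Y τ))
      (mulR (fun η => -(rS ρ l η * rS ρ l η)) (X τ) +
        mulR (fun η => -qS ρ η * wS ρ η) (h τ)) τ) :
    X t = duhA ρ l (X 0) (Y 0) h t := by
  have hw := H.bddR_wS
  -- up to weights, the value at time `t` of the free wave with the data `X τ`, `Y τ` at time `τ`
  set y : ℝ → L2 := fun τ => mulR (fun η => wS ρ η * cosS l (t - τ) η) (mulR (wS ρ) (X τ)) +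
    mulR (sinS l (t - τ)) (mulR (wS ρ) (Y τ)) with hy
  set K : ℝ → L2 →L[ℂ] L2 := fun t => mulR (kerA ρ l t) with hK
  have hKc : StrongCont K := H.symFam_kerA.strongCont
  have hww := hw.mul hw
  have hcont : ContinuousOn y (Set.Icc 0 t) := by
    have hc : Continuous fun τ : ℝ => t - τ := by fun_prop
    exact (H.symC1_wS_cosS.strongC1.left.continuousOn_apply hc
      ((mulR (wS ρ)).continuous.comp_continuousOn hX)).add
      (H.symC1_sinS.strongC1.left.continuousOn_apply hc
      ((mulR (wS ρ)).continuous.comp_continuousOn hY))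
  have hderiv : ∀ τ ∈ Set.Ioo 0 t, HasDerivAt y
      (mulR (fun η => wS ρ η * wS ρ η) (K (t - τ) (h τ))) τ := by
    intro τ hτ
    have h1 := (H.symC1_wS_cosS.strongC1.comp_const_sub t).hasDerivWithinAt_apply
      (hX' τ hτ).hasDerivWithinAt (S := Set.univ)
    have h2 := (H.symC1_sinS.strongC1.comp_const_sub t).hasDerivWithinAt_apply
      (hY' τ hτ).hasDerivWithinAt (S := Set.univ)
    rw [hasDerivWithinAt_univ] at h1 h2
    refine (h1.add h2).congr_deriv ?_
    have b1 := H.symFam_accS.bddR (t - τ)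
    have b2 := H.symFam_sinS.bddR (t - τ)
    have b3 := H.symFam_cosS.bddR (t - τ)
    have b4 := H.symFam_kerA.bddR (t - τ)
    rw [hK, map_add, mulR_mulR b2 H.bddR_neg_rS_sq, mulR_mulR b2 H.bddR_neg_qS_wS,
      mulR_mulR hww b4, neg_apply, neg_apply,
      mulR_mulR b1 hw, mulR_mulR b3 hw]
    have e1 : ∀ η, accS ρ l (t - τ) η * wS ρ η =
        sinS l (t - τ) η * -(rS ρ l η * rS ρ l η) := fun η => by
      rw [mul_comm, wS_mul_accS]; ring
    have e2 : ∀ η, sinS l (t - τ) η * (-qS ρ η * wS ρ η) =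
        wS ρ η * wS ρ η * kerA ρ l (t - τ) η := fun η => by
      rw [mul_assoc (wS ρ η), wS_mul_kerA]; ring
    have e3 : ∀ η, cosS l (t - τ) η * wS ρ η = wS ρ η * cosS l (t - τ) η := fun η => mul_comm _ _
    simp_rw [e1, e2, e3]
    abel
  have hint : IntervalIntegrable (fun τ => mulR (fun η => wS ρ η * wS ρ η) (K (t - τ) (h τ)))
      volume 0 t :=
    ⟨(mulR _).integrable_comp (hKc.intervalIntegrable hh hB t 0 t).1,
      (mulR _).integrable_comp (hKc.intervalIntegrable hh hB t 0 t).2⟩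
  have hFTC := intervalIntegral.integral_eq_sub_of_hasDerivAt_of_le ht hcont hderiv hint
  rw [ContinuousLinearMap.intervalIntegral_comp_comm _ (hKc.intervalIntegrable hh hB t 0 t)] at hFTC
  have hyt : y t = mulR (fun η => wS ρ η * wS ρ η) (X t) := by
    simp only [hy, sub_self, cosS_zero, mul_one]
    have : sinS l 0 = fun _ => 0 := funext (sinS_zero l)
    rw [this, mulR_zero_fun, add_zero, mulR_mulR hw hw]
  have hy0 : y 0 = mulR (fun η => wS ρ η * wS ρ η)
      (mulR (cosS l t) (X 0) + mulR (velS ρ l t) (Y 0)) := by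
    have b1 := H.symFam_velS.bddR t
    have b2 := H.symFam_sinS.bddR t
    have b3 := H.symFam_cosS.bddR t
    simp only [hy, sub_zero]
    rw [map_add, mulR_mulR hww b3, mulR_mulR hww b1, mulR_mulR b2 hw, mulR_mulR (hw.mul b3) hw]
    have e1 : ∀ η, wS ρ η * wS ρ η * velS ρ l t η = sinS l t η * wS ρ η := fun η => by
      rw [mul_assoc, wS_mul_velS, mul_comm]
    have e2 : ∀ η, wS ρ η * wS ρ η * cosS l t η = wS ρ η * cosS l t η * wS ρ η := fun η => by ring
    simp_rw [e1, e2]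
  have hinj := mulR_injective hww (fun η => mul_ne_zero (wt_ne_zero _ _) (wt_ne_zero _ _))
  apply hinj
  unfold duhA
  rw [map_add, ← hy0, ← hyt]
  change y t = y 0 + mulR (fun η => wS ρ η * wS ρ η) (∫ τ in (0)..t, K (t - τ) (h τ))
  rw [hFTC]
  abel

end Admissible

/-! ### The Sobolev scale on the Fourier side -/

/-- The inclusion of `H^σ` in `H^(σ-q)` in terms of the parametrizations. -/
theorem sob_eq_sob_mulR (σ : ℝ) {q : ℝ} (hq : 0 ≤ q) (a : L2) :
    sob σ a = sob (σ - q) (mulR (wt (-q)) a) := by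
  refine eq_sob_of_represents ((represents_fourier_sob σ a).congr ?_)
  filter_upwards [coeFn_mulR (bddR_wt (show -q ≤ 0 by linarith)) a] with η hη
  rw [hη, ← mul_assoc, ← Complex.ofReal_mul, ← wt_add]
  congr 3
  ring

/-- Elements of `H^s`, `s ≥ 0`, are functions. -/
theorem sob_eq_coe {s : ℝ} (hs : 0 ≤ s) {a f : L2} (h : (𝓕 f : L2) = mulR (wt (-s)) a) :
    sob s a = (f : 𝓢'(ℝ, ℂ)) := by
  refine (eq_sob_of_represents ((represents_fourier_coe f).congr ?_)).symm
  rw [h]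
  exact coeFn_mulR (bddR_wt (show -s ≤ 0 by linarith)) a

/-- The pairing of `sob σ a` with a fixed Schwartz function is continuous and linear in `a`. -/
noncomputable def sobPair (σ : ℝ) (χ : 𝓢(ℝ, ℂ)) : L2 →L[ℂ] ℂ :=
  (PointwiseConvergenceCLM.evalCLM (RingHom.id ℂ) ℂ χ : 𝓢'(ℝ, ℂ) →L[ℂ] ℂ) ∘L sob σ

theorem sobPair_apply (σ : ℝ) (χ : 𝓢(ℝ, ℂ)) (a : L2) : sobPair σ χ a = sob σ a χ := rfl

theorem tendsto_sobolevENorm_sob_iff {ι : Type*} {F : Filter ι} (σ : ℝ) {X : ι → L2} :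
    Tendsto (fun i => sobolevENorm σ (sob σ (X i))) F (𝓝 0) ↔ Tendsto X F (𝓝 0) := by
  rw [tendsto_zero_iff_enorm_tendsto_zero]
  simp_rw [sobolevENorm_sob]
  constructor
  · intro h
    have h2 := ENNReal.Tendsto.const_mul (a := freqConst⁻¹) h
      (Or.inr (ENNReal.inv_ne_top.mpr freqConst_ne_zero))
    simp_rw [← mul_assoc, ENNReal.inv_mul_cancel freqConst_ne_zero freqConst_ne_top] at h2
    simpa using h2
  · intro h
    simpa using ENNReal.Tendsto.const_mul (a := freqConst) h (Or.inr freqConst_ne_top)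

theorem continuousOnH_iff {σ : ℝ} {I : Set ℝ} {u : ℝ → 𝓢'(ℝ, ℂ)} {A : ℝ → L2}
    (hu : ∀ t ∈ I, u t = sob σ (A t)) : ContinuousOnH σ I u ↔ ContinuousOn A I := by
  unfold ContinuousOnH ContinuousOn
  refine forall₂_congr fun t ht => ?_
  have h1 : MemH σ (u t) := by rw [hu t ht]; exact memH_sob _ _
  have h2 : (fun τ => sobolevENorm σ (u τ - u t)) =ᶠ[𝓝[I] t]
      fun τ => sobolevENorm σ (sob σ (A τ - A t)) := by
    filter_upwards [self_mem_nhdsWithin] with τ hτ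
    rw [hu τ hτ, hu t ht, map_sub]
  rw [and_iff_right h1, tendsto_congr' h2, tendsto_sobolevENorm_sob_iff, ContinuousWithinAt,
    tendsto_sub_nhds_zero_iff]

theorem hasTimeDerivOnH_iff {σ : ℝ} {I : Set ℝ} {u v : ℝ → 𝓢'(ℝ, ℂ)} {A B : ℝ → L2}
    (hu : ∀ t ∈ I, u t = sob σ (A t)) (hv : ∀ t ∈ I, v t = sob σ (B t)) :
    HasTimeDerivOnH σ I u v ↔ ∀ t ∈ I, HasDerivWithinAt A (B t) I t := by
  unfold HasTimeDerivOnH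
  refine forall₂_congr fun t ht => ?_
  have h2 : (fun τ : ℝ => sobolevENorm σ (((((τ - t)⁻¹ : ℝ) : ℂ)) • (u τ - u t) - v t))
      =ᶠ[𝓝[I \ {t}] t] fun τ => sobolevENorm σ (sob σ (slope A t τ - B t)) := by
    filter_upwards [self_mem_nhdsWithin] with τ hτ
    rw [hu τ hτ.1, hu t ht, hv t ht, ← map_sub, ← map_smul, ← map_sub, slope_def_module]
    rfl
  rw [tendsto_congr' h2, tendsto_sobolevENorm_sob_iff, hasDerivWithinAt_iff_tendsto_slope,
    tendsto_sub_nhds_zero_iff]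

theorem represents_fourier_derivCLM {f : 𝓢'(ℝ, ℂ)} {v : ℝ → ℂ} (hf : Represents (𝓕 f) v) :
    Represents (𝓕 (TemperedDistribution.derivCLM ℂ f))
      (fun η => (2 * Real.pi * Complex.I) * (η * v η)) := by
  have e : TemperedDistribution.derivCLM ℂ f = LineDeriv.lineDerivOp (1 : ℝ) f := by
    ext χ
    rw [TemperedDistribution.derivCLM_apply_apply, TemperedDistribution.lineDerivOp_apply_apply]
    congr 2
  have hg : (fun η : ℝ => ((η : ℝ) : ℂ)).HasTemperateGrowth := by fun_prop
  have e2 : TemperedDistribution.smulLeftCLM ℂ (fun x : ℝ => ((inner ℝ x (1 : ℝ) : ℝ) : ℂ)) (𝓕 f) =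
      TemperedDistribution.smulLeftCLM ℂ (fun η : ℝ => ((η : ℝ) : ℂ)) (𝓕 f) := by
    simp
  rw [e, TemperedDistribution.fourier_lineDerivOp_eq, e2]
  intro χ
  have h := represents_smulLeft hf hg χ
  have e3 : (fun x : ℝ => χ x * (2 * Real.pi * Complex.I * (x * v x))) =
      fun x : ℝ => (2 * Real.pi * Complex.I) * (χ x * (x * v x)) := by
    funext x; ring
  rw [e3]
  refine ⟨h.1.const_mul _, ?_⟩
  rw [integral_const_mul, ← h.2]
  rfl

theorem represents_fourier_dxx {f : 𝓢'(ℝ, ℂ)} {v : ℝ → ℂ} (hf : Represents (𝓕 f) v) :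
    Represents (𝓕 (dxx f)) (fun η => ((-xisq η : ℝ) : ℂ) * v η) := by
  unfold dxx
  refine (represents_fourier_derivCLM (represents_fourier_derivCLM hf)).congr ?_
  refine Eventually.of_forall fun η => ?_
  simp only [xisq]
  push_cast
  ring_nf
  rw [Complex.I_sq]
  ring

theorem dxx_eq_zero_of_const {f : 𝓢'(ℝ, ℂ)} {c : ℂ} (hf : Represents f (fun _ => c)) :
    dxx f = 0 := by
  have key : TemperedDistribution.derivCLM ℂ f = 0 := by
    ext χ
    rw [TemperedDistribution.derivCLM_apply_apply, hf.apply_eq, integral_mul_const]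
    have h0 : ∫ x, deriv χ x = 0 :=
      integral_eq_zero_of_hasDerivAt_of_integrable (fun x => χ.hasDerivAt x)
        (SchwartzMap.derivCLM ℂ ℂ χ).integrable χ.integrable
    have : ∫ x, (-SchwartzMap.derivCLM ℂ ℂ χ) x = 0 := by
      have e : ∀ x, (-SchwartzMap.derivCLM ℂ ℂ χ) x = -deriv χ x := fun x => rfl
      simp_rw [e]
      rw [integral_neg, h0, neg_zero]
    rw [this, zero_mul]
    rfl
  unfold dxx
  rw [key, map_zero]

theorem dxx_add (f g : 𝓢'(ℝ, ℂ)) : dxx (f + g) = dxx f + dxx g := by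
  unfold dxx; rw [map_add, map_add]

theorem Represents.add {f g : 𝓢'(ℝ, ℂ)} {v w : ℝ → ℂ} (hf : Represents f v)
    (hg : Represents g w) : Represents (f + g) (fun x => v x + w x) := by
  intro χ
  have h1 := hf χ
  have h2 := hg χ
  simp_rw [mul_add]
  exact ⟨h1.1.add h2.1, by rw [integral_add h1.1 h2.1, ← h1.2, ← h2.2]; rfl⟩

theorem exists_represents_const (c : ℂ) : ∃ f : 𝓢'(ℝ, ℂ), Represents f (fun _ => c) := by
  have hc : (fun _ : ℝ => c).HasTemperateGrowth := by fun_prop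
  refine ⟨hc.toTemperedDistribution (μ := volume), fun χ => ⟨χ.integrable.mul_const c, ?_⟩⟩
  simp

namespace Admissible

variable {ρ : ℝ} {l : ℝ → ℝ} {c₁ c₂ : ℝ}

/-- The second derivative on the Sobolev scale. -/
theorem dxx_sob (H : Admissible ρ l c₁ c₂) (σ : ℝ) (a : L2) :
    dxx (sob σ a) = sob (σ - 2 * (1 + ρ / 2)) (mulR (fun η => -qS ρ η * wS ρ η) a) := by
  refine eq_sob_of_represents ((represents_fourier_dxx (represents_fourier_sob σ a)).congr ?_)
  filter_upwards [coeFn_mulR H.bddR_neg_qS_wS a] with η hη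
  rw [hη, ← mul_assoc, ← mul_assoc, ← Complex.ofReal_mul, ← Complex.ofReal_mul]
  congr 2
  have e : wt (-(σ - 2 * (1 + ρ / 2))) η = wt (-σ) η * (wt (1 + ρ / 2) η * wt (1 + ρ / 2) η) := by
    rw [← wt_add, ← wt_add]; congr 1; ring
  have e2 := wt_neg_mul (1 + ρ / 2) η
  unfold qS wS
  rw [e]
  linear_combination (-(xisq η * wt (-σ) η) * (wt (-(1 + ρ / 2)) η * wt (1 + ρ / 2) η + 1)) * -e2

theorem represents_fourier_of_isMultiplierImage {f h : 𝓢'(ℝ, ℂ)} {v : ℝ → ℂ}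
    (hv : Represents (𝓕 f) v) (hh : IsMultiplierImage l f h) :
    Represents (𝓕 h) (fun η => (l (2 * Real.pi * η) : ℂ) * v η) := by
  obtain ⟨w, hw, hw'⟩ := hh
  refine Represents.congr hw' ?_
  filter_upwards [Represents.ae_eq hw hv] with η hη
  rw [hη]

theorem l_nonneg (H : Admissible ρ l c₁ c₂) (ξ : ℝ) : 0 ≤ l ξ :=
  le_trans (by positivity) (H.lower ξ)

theorem omg_sq (H : Admissible ρ l c₁ c₂) (η : ℝ) :
    omg l η * omg l η = xisq η * l (2 * Real.pi * η) := by
  unfold omg xisq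
  rw [mul_mul_mul_comm, abs_mul_abs_self, Real.mul_self_sqrt (H.l_nonneg _), sq]

/-- The operator `L ∂ₓ²` on the Sobolev scale. -/
theorem dxx_eq_of_isMultiplierImage (H : Admissible ρ l c₁ c₂) {σ : ℝ} {a : L2} {h : 𝓢'(ℝ, ℂ)}
    (hh : IsMultiplierImage l (sob σ a) h) :
    dxx h = sob (σ - 2 * (1 + ρ / 2)) (mulR (fun η => -(rS ρ l η * rS ρ l η)) a) := by
  refine eq_sob_of_represents ((represents_fourier_dxx
    (represents_fourier_of_isMultiplierImage (represents_fourier_sob σ a) hh)).congr ?_)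
  filter_upwards [coeFn_mulR H.bddR_neg_rS_sq a] with η hη
  rw [hη, ← mul_assoc, ← mul_assoc, ← mul_assoc, ← Complex.ofReal_mul, ← Complex.ofReal_mul,
    ← Complex.ofReal_mul]
  congr 2
  have e : wt (-(σ - 2 * (1 + ρ / 2))) η = wt (-σ) η * (wt (1 + ρ / 2) η * wt (1 + ρ / 2) η) := by
    rw [← wt_add, ← wt_add]; congr 1; ring
  have e2 := wt_neg_mul (1 + ρ / 2) η
  have e3 := H.omg_sq η
  unfold rS wS
  rw [e]
  linear_combination (omg l η * omg l η * wt (-σ) η *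
      (wt (-(1 + ρ / 2)) η * wt (1 + ρ / 2) η + 1)) * e2 +
    wt (-σ) η * e3

theorem exists_isMultiplierImage (H : Admissible ρ l c₁ c₂) (σ : ℝ) (a : L2) :
    ∃ h, IsMultiplierImage l (sob σ a) h := by
  have hm := H.meas
  have hb : BddR (fun η => l (2 * Real.pi * η) * wt (-ρ) η) := by
    refine BddR.of_le (C := c₂ ^ 2) ((hm.comp (by fun_prop)).mul (measurable_wt _)) fun η => ?_
    rw [abs_of_nonneg (mul_nonneg (H.l_nonneg _) (wt_pos _ _).le)]
    calc l (2 * Real.pi * η) * wt (-ρ) η ≤ c₂ ^ 2 * wt ρ η * wt (-ρ) η := by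
          gcongr
          · exact (wt_pos _ _).le
          · exact H.upper _
      _ = c₂ ^ 2 := by rw [mul_assoc, wt_mul_neg, mul_one]
  refine ⟨sob (σ - ρ) (mulR (fun η => l (2 * Real.pi * η) * wt (-ρ) η) a), _,
    hasFourierTransform_sob σ a, ?_⟩
  unfold HasFourierTransform
  have : ∀ η : ℝ, (2 * Real.pi)⁻¹ * (2 * Real.pi * η) = η := fun η => by field_simp
  simp only [this]
  refine (represents_fourier_sob _ _).congr ?_
  filter_upwards [coeFn_mulR hb a] with η hη
  rw [hη, ← mul_assoc, ← mul_assoc, ← Complex.ofReal_mul, ← Complex.ofReal_mul]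
  congr 2
  have e : wt (-(σ - ρ)) η = wt (-σ) η * wt ρ η := by rw [← wt_add]; congr 1; ring
  rw [e]
  linear_combination (wt (-σ) η * l (2 * Real.pi * η)) * wt_mul_neg ρ η

end Admissible

/-- A weak time derivative, tested against Schwartz functions, which is continuous in `L²`, is a
strong one. -/
theorem hasDerivAt_of_weak {σ : ℝ} {X D : ℝ → L2} {J : Set ℝ} (hJ : IsOpen J)
    (hJ' : J.OrdConnected) (hD : ContinuousOn D J)
    (hw : ∀ χ : 𝓢(ℝ, ℂ), ∀ τ ∈ J, HasDerivAt (fun τ => sob σ (X τ) χ) (sob σ (D τ) χ) τ) {t : ℝ}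
    (ht : t ∈ J) : HasDerivAt X (D t) t := by
  have hsub : ∀ τ ∈ J, Set.uIcc t τ ⊆ J := fun τ hτ => hJ'.uIcc_subset ht hτ
  have hint : ∀ τ ∈ J, IntervalIntegrable D volume t τ := fun τ hτ =>
    (hD.mono (hsub τ hτ)).intervalIntegrable
  have key : ∀ τ ∈ J, X τ = X t + ∫ r in t..τ, D r := by
    intro τ hτ
    apply sob_injective σ
    ext χ
    have h1 := intervalIntegral.integral_eq_sub_of_hasDerivAt
      (f := fun τ => sob σ (X τ) χ) (f' := fun τ => sob σ (D τ) χ)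
      (fun r hr => hw χ r (hsub τ hτ hr))
      (((sobPair σ χ).continuous.comp_continuousOn (hD.mono (hsub τ hτ))).intervalIntegrable)
    have h2 := ContinuousLinearMap.intervalIntegral_comp_comm (sobPair σ χ) (hint τ hτ)
    simp only [sobPair_apply] at h2
    rw [h2] at h1
    rw [map_add]
    change _ = sob σ (X t) χ + sob σ (∫ r in t..τ, D r) χ
    rw [h1]
    ring
  have h3 : HasDerivAt (fun τ => X t + ∫ r in t..τ, D r) (D t) t :=
    (intervalIntegral.integral_hasDerivAt_right (hint t ht)
      (hD.stronglyMeasurableAtFilter hJ t ht) (hD.continuousAt (hJ.mem_nhds ht))).const_add _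
  refine h3.congr_of_eventuallyEq ?_
  filter_upwards [hJ.mem_nhds ht] with τ hτ using key τ hτ

/-! ### Hermitian symmetry: the Fourier side of real-valued functions -/

/-- The involution `X ↦ (η ↦ conj (X (-η)))` on `L²`. Its fixed points are the Fourier transforms
of real-valued functions. -/
noncomputable def hermL : L2 →L[ℝ] L2 := conjL.comp (reflL 0).toContinuousLinearMap

/-- `X(-η) = conj X(η)`. -/
def IsHerm (X : L2) : Prop := hermL X = X

theorem coeFn_hermL (X : L2) : hermL X =ᵐ[volume] fun η => (starRingEnd ℂ) (X (-η)) := by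
  filter_upwards [coeFn_conjL (reflL 0 X), coeFn_reflL 0 X] with η h1 h2
  simp only [zero_sub] at h2
  rw [← h2, ← h1]
  rfl

theorem hermL_fourier (f : L2) : hermL (𝓕 f) = 𝓕 (conjL f) := (fourier_conjL f).symm

theorem isHerm_fourier_iff (f : L2) : IsHerm (𝓕 f) ↔ ∀ᵐ x, (f x).im = 0 := by
  unfold IsHerm
  rw [hermL_fourier]
  have hinj : Function.Injective (fun f : L2 => (𝓕 f : L2)) :=
    (Lp.fourierTransformₗᵢ ℝ ℂ).injective
  constructor
  · intro h
    have h2 := coeFn_conjL f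
    rw [hinj h] at h2
    filter_upwards [h2] with x hx
    exact Complex.conj_eq_iff_im.mp hx.symm
  · intro h
    congr 1
    apply Lp.ext
    filter_upwards [h, coeFn_conjL f] with x h1 h2
    rw [h2]
    exact Complex.conj_eq_iff_im.mpr h1

theorem hermL_mulR {m : ℝ → ℝ} (hm : BddR m) (he : ∀ η, m (-η) = m η) (X : L2) :
    hermL (mulR m X) = mulR m (hermL X) := by
  apply Lp.ext
  have h3 := (Measure.measurePreserving_neg (volume : Measure ℝ)).quasiMeasurePreserving.ae_eq_comp
    (coeFn_mulR hm X)
  filter_upwards [coeFn_hermL (mulR m X), coeFn_mulR hm (hermL X), coeFn_hermL X, h3]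
    with η h1 h2 h3 h4
  simp only [Function.comp] at h4
  rw [h1, h2, h3, h4, he, map_mul, Complex.conj_ofReal]

theorem IsHerm.mulR {m : ℝ → ℝ} (hm : BddR m) (he : ∀ η, m (-η) = m η) {X : L2} (hX : IsHerm X) :
    IsHerm (mulR m X) := by
  unfold IsHerm
  rw [hermL_mulR hm he, hX]

theorem IsHerm.of_mulR {m : ℝ → ℝ} (hm : BddR m) (he : ∀ η, m (-η) = m η) (h0 : ∀ η, m η ≠ 0)
    {X : L2} (hX : IsHerm (NonlocalWave.mulR m X)) : IsHerm X := by
  apply mulR_injective hm h0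
  rw [← hermL_mulR hm he, hX]

theorem isHerm_zero : IsHerm 0 := map_zero _

theorem IsHerm.add {X Y : L2} (hX : IsHerm X) (hY : IsHerm Y) : IsHerm (X + Y) := by
  unfold IsHerm
  rw [map_add, hX, hY]

theorem isClosed_isHerm : IsClosed {X : L2 | IsHerm X} :=
  isClosed_eq hermL.continuous continuous_id

theorem isHerm_duhamel {m : ℝ → ℝ → ℝ} (hm : SymFam m) (he : ∀ t η, m t (-η) = m t η) {h : ℝ → L2}
    {B : ℝ} (hh : StronglyMeasurable h) (hB : ∀ τ, ‖h τ‖ ≤ B) (hH : ∀ τ, IsHerm (h τ)) (t : ℝ) :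
    IsHerm (duhamel (fun t => mulR (m t)) h t) := by
  unfold IsHerm duhamel
  rw [← ContinuousLinearMap.intervalIntegral_comp_comm _
    (hm.strongCont.intervalIntegrable hh hB t 0 t)]
  exact intervalIntegral.integral_congr fun τ _ => (hH τ).mulR (hm.bddR _) (he _)

theorem omg_neg {l : ℝ → ℝ} (hl : ∀ ξ, l (-ξ) = l ξ) (η : ℝ) : omg l (-η) = omg l η := by
  unfold omg
  rw [mul_neg, hl, abs_neg]

theorem Admissible.isHerm_duhA {ρ c₁ c₂ : ℝ} {l : ℝ → ℝ} (H : Admissible ρ l c₁ c₂) {A₀ B₀ : L2}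
    {h : ℝ → L2} {B : ℝ} (hh : StronglyMeasurable h) (hB : ∀ τ, ‖h τ‖ ≤ B) (hA₀ : IsHerm A₀)
    (hB₀ : IsHerm B₀) (hH : ∀ τ, IsHerm (h τ)) (t : ℝ) : IsHerm (duhA ρ l A₀ B₀ h t) := by
  have e1 : ∀ t η, cosS l t (-η) = cosS l t η := fun t η => by unfold cosS; rw [omg_neg H.even]
  have e2 : ∀ t η, velS ρ l t (-η) = velS ρ l t η := fun t η => by
    unfold velS sinS; rw [omg_neg H.even, wt_neg_eq]
  have e3 : ∀ t η, kerA ρ l t (-η) = kerA ρ l t η := fun t η => by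
    unfold kerA qS wS xisq; rw [e2, wt_neg_eq, mul_neg, neg_sq]
  exact ((hA₀.mulR (H.symFam_cosS.bddR t) (e1 t)).add (hB₀.mulR (H.symFam_velS.bddR t) (e2 t))).add
    (isHerm_duhamel H.symFam_kerA e3 hh hB hH t)

theorem bddR_wt_neg {s : ℝ} (hs : 1 / 2 < s) : BddR (wt (-s)) := bddR_wt (by linarith)

theorem mulR_wt_neg_injective {s : ℝ} (hs : 1 / 2 < s) : Function.Injective (mulR (wt (-s))) :=
  mulR_injective (bddR_wt_neg hs) (wt_ne_zero _)

/-! ### The nonlinearity -/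

/-- On the Fourier side, `h` is the nonlinear term `g(u) - g(0)` for the function `u` given by `a`.
Both are elements of `H^s`, normalized by the weight of order `s`. Here `f` and `k` are the
functions `u` and `g(u) - g(0)`. -/
def IsNonlin (g : ℝ → ℝ) (s : ℝ) (a h : L2) : Prop :=
  ∃ f k : L2, (∀ᵐ x, (f x).im = 0) ∧ (𝓕 f : L2) = mulR (wt (-s)) a ∧
    (𝓕 k : L2) = mulR (wt (-s)) h ∧ k =ᵐ[volume] fun x => ((g (f x).re - g 0 : ℝ) : ℂ)

section

variable {g : ℝ → ℝ} {s : ℝ} {a h : L2}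

theorem IsNonlin.isHerm_right (hs : 1 / 2 < s) (hN : IsNonlin g s a h) : IsHerm h := by
  obtain ⟨f, k, -, -, hk, hgf⟩ := hN
  refine IsHerm.of_mulR (bddR_wt_neg hs) (wt_neg_eq _) (wt_ne_zero _) ?_
  rw [← hk, isHerm_fourier_iff]
  filter_upwards [hgf] with x hx
  rw [hx, Complex.ofReal_im]

/-- The distribution `g(u)` differs from the element of `H^s` given by `h` by the constant
`g(0)`. -/
theorem IsNonlin.exists_isComposition (hs : 1 / 2 < s) (hN : IsNonlin g s a h) :
    ∃ gu, IsComposition g (sob s a) gu ∧ dxx gu = dxx (sob s h) := by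
  obtain ⟨f, k, hf, hfa, hkh, hgf⟩ := hN
  have hs0 : 0 ≤ s := by linarith
  obtain ⟨c, hc⟩ := exists_represents_const ((g 0 : ℝ) : ℂ)
  refine ⟨sob s h + c, ⟨fun x => (f x).re, ?_, ?_⟩, ?_⟩
  · rw [sob_eq_coe hs0 hfa]
    refine (represents_coe f).congr ?_
    filter_upwards [hf] with x hx
    exact Complex.ext (by simp) (by simp [hx])
  · rw [sob_eq_coe hs0 hkh]
    refine ((represents_coe k).add hc).congr ?_
    filter_upwards [hgf] with x hx
    rw [hx]
    push_cast
    ring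
  · rw [dxx_add, dxx_eq_zero_of_const hc, add_zero]

/-- The derivatives do not see the constant `g(0)`. -/
theorem IsNonlin.dxx_eq (hs : 1 / 2 < s) (hN : IsNonlin g s a h) {gu : 𝓢'(ℝ, ℂ)}
    (hgu : IsComposition g (sob s a) gu) : dxx gu = dxx (sob s h) := by
  obtain ⟨gu', ⟨v', hv', hgv'⟩, he⟩ := hN.exists_isComposition hs
  obtain ⟨v, hv, hgv⟩ := hgu
  rw [← he]
  congr 1
  refine hgv.unique (hgv'.congr ?_)
  filter_upwards [hv.ae_eq hv'] with x hx
  rw [Complex.ofReal_inj.mp hx]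

/-- The definition of a composition includes that the inner function is real-valued. -/
theorem isHerm_of_isComposition (hs : 1 / 2 < s) {gu : 𝓢'(ℝ, ℂ)}
    (hgu : IsComposition g (sob s a) gu) : IsHerm a := by
  obtain ⟨v, hv, -⟩ := hgu
  have hf : (𝓕 (𝓕⁻ (mulR (wt (-s)) a) : L2) : L2) = mulR (wt (-s)) a :=
    FourierTransform.fourier_fourierInv_eq _
  rw [sob_eq_coe (by linarith) hf] at hv
  refine IsHerm.of_mulR (bddR_wt_neg hs) (wt_neg_eq _) (wt_ne_zero _) ?_
  rw [← hf, isHerm_fourier_iff]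
  filter_upwards [hv.ae_eq (represents_coe _)] with x hx
  rw [← hx, Complex.ofReal_im]

/-- On bounded sets of `H^s` the nonlinearity is bounded in `H^s`, and it is given by a map `N`
which is Lipschitz continuous in `L²`. A Lipschitz bound in `H^s` would require more smoothness of
`g`. -/
theorem exists_nonlinearity (hs : 1 / 2 < s)
    (hg : ContDiff ℝ ((⌊s⌋₊ + 1 : ℕ) : WithTop ℕ∞) g) (R : NNReal) :
    ∃ (N : L2 → L2) (K C : NNReal), LipschitzWith K N ∧
      (∀ a, IsHerm a → ‖a‖ ≤ R → ∃ h, IsNonlin g s a h) ∧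
      ∀ a h, IsNonlin g s a h → ‖a‖ ≤ R →
        ‖h‖ ≤ C ∧ mulR (wt (-s)) h = N (mulR (wt (-s)) a) := by
  have hs0 : 0 ≤ s := by linarith
  set G : ℝ → ℝ := fun x => g x - g 0 with hGdef
  have hG : ContDiff ℝ ((⌊s⌋₊ + 1 : ℕ) : WithTop ℕ∞) G := hg.sub contDiff_const
  have hG0 : G 0 = 0 := sub_self _
  have hG1 : ContDiff ℝ 1 G := hG.of_le (by exact_mod_cast Nat.le_add_left 1 _)
  obtain ⟨M, hM0, hM⟩ := exists_sup_bound hs (R ^ 2)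
  obtain ⟨K, hK⟩ := exists_lipschitzWith_clampComp hG1 hM0
  obtain ⟨C, hC⟩ := exists_hsq_comp_le ⌊s⌋₊ G hG hG0 s hs (by
    push_cast; exact (Nat.lt_floor_add_one s).le) (R ^ 2)
  have hc0 := clampComp_zero hG0 hM0
  have hsq_le : ∀ {a f : L2}, (𝓕 f : L2) = mulR (wt (-s)) a → ‖a‖ ≤ R →
      hsq s f ≤ ((R ^ 2 : NNReal) : ℝ≥0∞) := by
    intro a f hf ha
    rw [hsq_eq_of_fourier_eq hs0 hf, ENNReal.coe_pow]
    have : ‖a‖ₑ ≤ (R : ℝ≥0∞) := by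
      rw [← ofReal_norm]
      exact ENNReal.ofReal_le_of_le_toReal (by simpa using ha)
    gcongr
  have hclamp : ∀ {a f : L2}, (𝓕 f : L2) = mulR (wt (-s)) a → ‖a‖ ≤ R →
      hK.compLp hc0 f =ᵐ[volume] fun x => ((G (f x).re : ℝ) : ℂ) := by
    intro a f hf ha
    filter_upwards [hM f (hsq_le hf ha), hK.coeFn_compLp hc0 f] with x h1 h2
    rw [h2]
    exact clampComp_of_le ((Complex.abs_re_le_norm _).trans h1)
  have hiso : ∀ f k : L2, ‖(𝓕 f - 𝓕 k : L2)‖ = ‖f - k‖ := fun f k => by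
    have := (Lp.fourierTransformₗᵢ ℝ ℂ).norm_map (f - k)
    rw [map_sub] at this
    exact this
  refine ⟨fun X => 𝓕 (hK.compLp hc0 (𝓕⁻ X : L2)), K, C + 1, ?_, ?_, ?_⟩
  · refine LipschitzWith.of_dist_le_mul fun X Y => ?_
    rw [dist_eq_norm, dist_eq_norm, hiso]
    refine (hK.norm_compLp_sub_le hc0 _ _).trans_eq ?_
    rw [← hiso, FourierTransform.fourier_fourierInv_eq, FourierTransform.fourier_fourierInv_eq]
  · intro a ha haR
    have hf : (𝓕 (𝓕⁻ (mulR (wt (-s)) a) : L2) : L2) = mulR (wt (-s)) a :=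
      FourierTransform.fourier_fourierInv_eq _
    set f : L2 := 𝓕⁻ (mulR (wt (-s)) a) with hfdef
    have hreal : ∀ᵐ x, (f x).im = 0 := by
      rw [← isHerm_fourier_iff, hf]
      exact ha.mulR (bddR_wt_neg hs) (wt_neg_eq _)
    have h1 := hC f (hK.compLp hc0 f) hreal (hsq_le hf haR) (hclamp hf haR)
    obtain ⟨h, hh⟩ := exists_fourier_eq_of_hsq_lt_top hs0 (h1.trans_lt ENNReal.coe_lt_top)
    exact ⟨h, f, _, hreal, hf, hh, hclamp hf haR⟩
  · rintro a h ⟨f, k, hreal, hf, hk, hgf⟩ haR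
    have e1 : k = hK.compLp hc0 f := Lp.ext (hgf.trans (hclamp hf haR).symm)
    have e2 : f = 𝓕⁻ (mulR (wt (-s)) a) := by
      rw [← hf, FourierTransform.fourierInv_fourier_eq]
    refine ⟨?_, by rw [← hk, e1, e2]⟩
    have h1 := hC f k hreal (hsq_le hf haR) hgf
    rw [hsq_eq_of_fourier_eq hs0 hk, ← ofReal_norm, ← ENNReal.ofReal_pow (norm_nonneg _)] at h1
    have h2 : ‖h‖ ^ 2 ≤ C := by
      have := ENNReal.toReal_mono ENNReal.coe_ne_top h1
      rwa [ENNReal.toReal_ofReal (by positivity), ENNReal.coe_toReal] at this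
    push_cast
    nlinarith [sq_nonneg (‖h‖ - 1), norm_nonneg h]

end

/-! ### Measurability and limits -/

/-- Continuity in a weaker norm implies strong measurability: a bounded multiplication operator with
nonvanishing symbol is an injective continuous map between Polish spaces, hence a measurable
embedding. -/
theorem stronglyMeasurable_of_mulR {m : ℝ → ℝ} (hm : BddR m) (h0 : ∀ η, m η ≠ 0) {h : ℝ → L2}
    {S : Set ℝ} (hS : MeasurableSet S) (hc : ContinuousOn (fun τ => mulR m (h τ)) S)
    (hz : ∀ τ, τ ∉ S → h τ = 0) : StronglyMeasurable h := by
  classical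
  borelize L2
  have : Fact ((2 : ℝ≥0∞) ≠ ∞) := ⟨by norm_num⟩
  have he : MeasurableEmbedding (mulR m) :=
    (mulR m).continuous.measurableEmbedding (mulR_injective hm h0)
  refine Measurable.stronglyMeasurable ?_
  rw [← he.measurable_comp_iff]
  have e : mulR m ∘ h = S.piecewise (fun τ => mulR m (h τ)) (fun _ => 0) := by
    funext τ
    by_cases hτ : τ ∈ S
    · rw [Set.piecewise_eq_of_mem _ _ _ hτ]; rfl
    · rw [Set.piecewise_eq_of_notMem _ _ _ hτ, Function.comp, hz τ hτ, map_zero]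
  rw [e]
  exact hc.measurable_piecewise continuousOn_const hS

/-- Balls of `H^s` are closed in `L²`. -/
theorem exists_of_tendsto_mulR_wt {s : ℝ} (hs : 1 / 2 < s) {R : NNReal} {X : L2} {a : ℕ → L2}
    (ha : ∀ n, IsHerm (a n)) (hR : ∀ n, ‖a n‖ ≤ R)
    (hlim : Tendsto (fun n => mulR (wt (-s)) (a n)) atTop (𝓝 X)) :
    ∃ b, IsHerm b ∧ ‖b‖ ≤ R ∧ mulR (wt (-s)) b = X := by
  have hb := bddR_wt_neg hs
  have hm := tendstoInMeasure_of_tendsto_Lp hlim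
  obtain ⟨ns, -, hns⟩ := hm.exists_seq_tendsto_ae
  have hall : ∀ᵐ η, ∀ n, mulR (wt (-s)) (a n) η = (wt (-s) η : ℂ) * a n η :=
    ae_all_iff.mpr fun n => coeFn_mulR hb (a n)
  have hae : ∀ᵐ η, Tendsto (fun k => a (ns k) η) atTop (𝓝 ((wt s η : ℂ) * X η)) := by
    filter_upwards [hns, hall] with η h1 h2
    have h3 := h1.const_mul (wt s η : ℂ)
    simp_rw [h2, ← mul_assoc, ← Complex.ofReal_mul, wt_mul_neg, Complex.ofReal_one, one_mul] at h3
    exact h3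
  have hle : eLpNorm (fun η => (wt s η : ℂ) * X η) 2 volume ≤ R := by
    refine (Lp.eLpNorm_lim_le_liminf_eLpNorm
        (fun k => Lp.aestronglyMeasurable (a (ns k))) _ hae).trans ?_
    refine liminf_le_of_le (by isBoundedDefault) fun b hb => ?_
    obtain ⟨k, hk⟩ := hb.exists
    refine hk.trans ?_
    rw [← Lp.enorm_def, ← ofReal_norm]
    exact ENNReal.ofReal_le_of_le_toReal (by simpa using hR (ns k))
  have hmeas := measurable_coe_L2 X
  have hw := measurable_wt s
  have hML : MemLp (fun η => (wt s η : ℂ) * X η) 2 volume :=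
    ⟨by fun_prop, hle.trans_lt ENNReal.coe_lt_top⟩
  have heq : mulR (wt (-s)) hML.toLp = X := by
    apply Lp.ext
    filter_upwards [coeFn_mulR hb hML.toLp, hML.coeFn_toLp] with η h1 h2
    rw [h1, h2, ← mul_assoc, ← Complex.ofReal_mul, wt_neg_mul, Complex.ofReal_one, one_mul]
  refine ⟨hML.toLp, ?_, ?_, heq⟩
  · refine IsHerm.of_mulR hb (wt_neg_eq _) (wt_ne_zero _) ?_
    rw [heq]
    exact isClosed_isHerm.mem_of_tendsto hlim
      (Eventually.of_forall fun n => (ha n).mulR hb (wt_neg_eq _))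
  · rw [Lp.norm_toLp]
    exact ENNReal.toReal_le_coe_of_le_coe hle

/-! ### Solutions and the variation of constants formula -/

theorem timeInterval_coe (T : ℝ) : timeInterval (T : EReal) = Set.Ico 0 T := by
  ext t
  simp [timeInterval]

theorem norm_mulR_wt_neg_le {s : ℝ} (hs : 1 / 2 < s) (x : L2) : ‖mulR (wt (-s)) x‖ ≤ ‖x‖ := by
  refine (norm_mulR_le (measurable_wt _) (C := 1) (fun η => ?_) x).trans_eq (one_mul _)
  rw [abs_of_pos (wt_pos _ _)]
  exact wt_le_one (by linarith) η

theorem hasDerivWithinAt_mulR {X : ℝ → L2} {X' : L2} {S : Set ℝ} {t : ℝ} (m : ℝ → ℝ)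
    (hX : HasDerivWithinAt X X' S t) : HasDerivWithinAt (fun τ => mulR m (X τ)) (mulR m X') S t :=
  ((mulR m).restrictScalars ℝ).hasFDerivAt.comp_hasDerivWithinAt t hX

namespace Admissible

variable {ρ s : ℝ} {l g : ℝ → ℝ} {c₁ c₂ : ℝ} {A₀ B₀ : L2} {h : ℝ → L2} {B : ℝ}

theorem duhA_zero : duhA ρ l A₀ B₀ h 0 = A₀ := by
  have e1 : cosS l 0 = fun _ => (1 : ℝ) := funext (cosS_zero l)
  have e2 : velS ρ l 0 = fun _ => (0 : ℝ) := funext fun η => by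
    unfold velS; rw [sinS_zero, mul_zero]
  have e3 : mulR (fun _ => (1 : ℝ)) A₀ = A₀ := by
    unfold mulR
    simp only [Complex.ofReal_one]
    exact mulOp_one A₀
  unfold duhA duhamel
  rw [e1, e2, e3, mulR_zero_fun, intervalIntegral.integral_same, add_zero, add_zero]

theorem duhB_zero : duhB ρ l A₀ B₀ h 0 = B₀ := by
  have e1 : cosS l 0 = fun _ => (1 : ℝ) := funext (cosS_zero l)
  have e2 : accS ρ l 0 = fun _ => (0 : ℝ) := funext fun η => by
    unfold accS; rw [sinS_zero, mul_zero, mul_zero]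
  have e3 : mulR (fun _ => (1 : ℝ)) B₀ = B₀ := by
    unfold mulR
    simp only [Complex.ofReal_one]
    exact mulOp_one B₀
  unfold duhB duhamel
  rw [e1, e2, e3, mulR_zero_fun, intervalIntegral.integral_same, add_zero, zero_add]

/-- An element of `H^s` as an element of `H^(s-1-ρ/2)`. -/
theorem sob_eq_wS (H : Admissible ρ l c₁ c₂) (a : L2) :
    sob s a = sob (s - 1 - ρ / 2) (mulR (wS ρ) a) := by
  rw [sob_eq_sob_mulR s (show 0 ≤ 1 + ρ / 2 by linarith [H.two_le]), sub_sub]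
  rfl

/-- The velocity as an element of the space `H^(-2-ρ)`, in which the equation holds. -/
theorem sob_eq_wS_wt (H : Admissible ρ l c₁ c₂) (hs : 1 / 2 < s) (b : L2) :
    sob (s - 1 - ρ / 2) b = sob (-(2 * (1 + ρ / 2))) (mulR (wS ρ) (mulR (wt (-s)) b)) := by
  rw [sob_eq_sob_mulR (s - 1 - ρ / 2) (show 0 ≤ s by linarith),
    sob_eq_sob_mulR (s - 1 - ρ / 2 - s) (show 0 ≤ 1 + ρ / 2 by linarith [H.two_le])]
  have : s - 1 - ρ / 2 - s - (1 + ρ / 2) = -(2 * (1 + ρ / 2)) := by ring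
  rw [this]
  rfl

/-- The right hand side of the equation on the Fourier side, as an element of `H^(-2-ρ)`. -/
theorem dxx_add_dxx_eq (H : Admissible ρ l c₁ c₂) (hs : 1 / 2 < s) {a k : L2}
    {Lu gu : 𝓢'(ℝ, ℂ)} (hL : IsMultiplierImage l (sob s a) Lu) (hgu : dxx gu = dxx (sob s k)) :
    dxx Lu + dxx gu = sob (-(2 * (1 + ρ / 2)))
      (mulR (fun η => -(rS ρ l η * rS ρ l η)) (mulR (wt (-s)) a) +
        mulR (fun η => -qS ρ η * wS ρ η) (mulR (wt (-s)) k)) := by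
  have e : s - 2 * (1 + ρ / 2) - s = -(2 * (1 + ρ / 2)) := by ring
  rw [H.dxx_eq_of_isMultiplierImage hL, hgu, H.dxx_sob, ← map_add,
    sob_eq_sob_mulR (s - 2 * (1 + ρ / 2)) (show 0 ≤ s by linarith), e, map_add,
    mulR_comm (bddR_wt_neg hs) H.bddR_neg_rS_sq, mulR_comm (bddR_wt_neg hs) H.bddR_neg_qS_wS]

/-- The variation of constants formula yields solutions. -/
theorem isSolutionOn_of_mild (H : Admissible ρ l c₁ c₂) (hs : 1 / 2 < s)
    (hh : StronglyMeasurable h) (hB : ∀ τ, ‖h τ‖ ≤ B) {T : ℝ}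
    (hc : ContinuousOn (fun τ => mulR (wt (-s)) (h τ)) (Set.Ico 0 T))
    (hN : ∀ t ∈ Set.Ico 0 T, IsNonlin g s (duhA ρ l A₀ B₀ h t) (h t)) :
    IsSolutionOn ρ s l g (sob s A₀) (sob (s - 1 - ρ / 2) B₀) (Set.Ico 0 T)
      (fun t => sob s (duhA ρ l A₀ B₀ h t))
          (fun t => sob (s - 1 - ρ / 2) (duhB ρ l A₀ B₀ h t)) where
  continuousOn := (continuousOnH_iff fun _ _ => rfl).mpr (H.continuous_duhA hh hB).continuousOn
  continuousOn_deriv :=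
    (continuousOnH_iff fun _ _ => rfl).mpr (H.continuous_duhB hh hB).continuousOn
  hasTimeDeriv := (hasTimeDerivOnH_iff (fun _ _ => H.sob_eq_wS _) fun _ _ => rfl).mpr
    fun t _ => (H.hasDerivAt_duhA hh hB t).hasDerivWithinAt
  initial := by rw [duhA_zero]
  initial_deriv := by rw [duhB_zero]
  equation := fun t ht => by
    obtain ⟨Lu, hLu⟩ := H.exists_isMultiplierImage s (duhA ρ l A₀ B₀ h t)
    obtain ⟨gu, hgu, hgu'⟩ := (hN t ht).exists_isComposition hs
    refine ⟨Lu, gu, hLu, hgu, fun χ => ?_⟩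
    have hb := bddR_wt_neg hs
    have hh' : StronglyMeasurable (fun τ => mulR (wt (-s)) (h τ)) :=
      (mulR (wt (-s))).continuous.comp_stronglyMeasurable hh
    have hB' : ∀ τ, ‖mulR (wt (-s)) (h τ)‖ ≤ B := fun τ => (norm_mulR_wt_neg_le hs _).trans (hB τ)
    have h1 := H.hasDerivWithinAt_duhB (A₀ := mulR (wt (-s)) A₀) (B₀ := mulR (wt (-s)) B₀) hh' hB'
      Set.ordConnected_Ico ht (hc t ht)
    rw [H.dxx_add_dxx_eq hs hLu hgu', H.mulR_duhA hh hB hb]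
    simp_rw [H.sob_eq_wS_wt hs, H.mulR_duhB hh hB hb]
    exact ((sobPair _ χ).restrictScalars ℝ).hasFDerivAt.comp_hasDerivWithinAt t h1

/-- Solutions which are bounded in `H^s` satisfy the variation of constants formula. -/
theorem exists_mild_of_isSolutionOn (H : Admissible ρ l c₁ c₂) (hs : 1 / 2 < s)
    (hg : ContDiff ℝ ((⌊s⌋₊ + 1 : ℕ) : WithTop ℕ∞) g) {φ ψ : 𝓢'(ℝ, ℂ)} {T : ℝ} (hT : 0 < T)
    {u ut : ℝ → 𝓢'(ℝ, ℂ)} (hu : IsSolutionOn ρ s l g φ ψ (Set.Ico 0 T) u ut) {R : NNReal}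
    (hR : ∀ t ∈ Set.Ico 0 T, sobolevENorm s (u t) ≤ freqConst * R) :
    ∃ (A₀ B₀ : L2) (h : ℝ → L2) (B : ℝ), IsHerm A₀ ∧ IsHerm B₀ ∧ φ = sob s A₀ ∧
      ψ = sob (s - 1 - ρ / 2) B₀ ∧ StronglyMeasurable h ∧ (∀ τ, ‖h τ‖ ≤ B) ∧
      (∀ τ, τ ∉ Set.Ico 0 T → h τ = 0) ∧ ∀ t ∈ Set.Ico 0 T, u t = sob s (duhA ρ l A₀ B₀ h t) ∧
        IsNonlin g s (duhA ρ l A₀ B₀ h t) (h t) := by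
  classical
  set S := Set.Ico 0 T with hS
  have h0S : (0 : ℝ) ∈ S := ⟨le_rfl, hT⟩
  have hb := bddR_wt_neg hs
  have hA : ∀ t ∈ S, ∃ a, u t = sob s a := fun t ht => (hu.continuousOn t ht).1.exists_eq_sob
  choose! A hA using hA
  have hBex : ∀ t ∈ S, ∃ b, ut t = sob (s - 1 - ρ / 2) b := fun t ht =>
    (hu.continuousOn_deriv t ht).1.exists_eq_sob
  choose! B hB using hBex
  have hAc : ContinuousOn A S := (continuousOnH_iff hA).mp hu.continuousOn
  have hBc : ContinuousOn B S := (continuousOnH_iff hB).mp hu.continuousOn_deriv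
  have hder : ∀ t ∈ S, HasDerivWithinAt (fun τ => mulR (wS ρ) (A τ)) (B t) S t :=
    (hasTimeDerivOnH_iff (fun t ht => (hA t ht).trans (H.sob_eq_wS _)) hB).mp hu.hasTimeDeriv
  have hHerm : ∀ t ∈ S, IsHerm (A t) := by
    intro t ht
    obtain ⟨-, gu, -, hgu, -⟩ := hu.equation t ht
    rw [hA t ht] at hgu
    exact isHerm_of_isComposition hs hgu
  have hRA : ∀ t ∈ S, ‖A t‖ ≤ R := by
    intro t ht
    have h1 := hR t ht
    rw [hA t ht, sobolevENorm_sob,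
        ENNReal.mul_le_mul_iff_right freqConst_ne_zero freqConst_ne_top] at h1
    have h2 := ENNReal.toReal_mono ENNReal.coe_ne_top h1
    simpa using h2
  obtain ⟨N, K, C, hN, hex, hNC⟩ := exists_nonlinearity hs hg R
  have hexh : ∀ t ∈ S, ∃ h, IsNonlin g s (A t) h := fun t ht => hex _ (hHerm t ht) (hRA t ht)
  choose! k hk using hexh
  set h : ℝ → L2 := fun τ => if τ ∈ S then k τ else 0 with hh
  have hhS : ∀ t ∈ S, h t = k t := fun t ht => if_pos ht
  have hh0 : ∀ t, t ∉ S → h t = 0 := fun t ht => if_neg ht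
  have hnl : ∀ t ∈ S, IsNonlin g s (A t) (h t) := fun t ht => by rw [hhS t ht]; exact hk t ht
  have hbound : ∀ τ, ‖h τ‖ ≤ C := fun τ => by
    by_cases hτ : τ ∈ S
    · exact (hNC _ _ (hnl τ hτ) (hRA τ hτ)).1
    · rw [hh0 τ hτ, norm_zero]; exact C.2
  have hhc : ContinuousOn (fun τ => mulR (wt (-s)) (h τ)) S := by
    refine ContinuousOn.congr (f := fun τ => N (mulR (wt (-s)) (A τ))) ?_
      fun τ hτ => (hNC _ _ (hnl τ hτ) (hRA τ hτ)).2
    exact hN.continuous.comp_continuousOn ((mulR (wt (-s))).continuous.comp_continuousOn hAc)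
  have hmeas : StronglyMeasurable h :=
    stronglyMeasurable_of_mulR hb (wt_ne_zero _) measurableSet_Ico hhc hh0
  have hmild : ∀ t ∈ S, A t = duhA ρ l (A 0) (B 0) h t := by
    intro t ht
    have hsub : Set.Icc 0 t ⊆ S := fun τ hτ => ⟨hτ.1, hτ.2.trans_lt ht.2⟩
    have hnhds : ∀ τ ∈ Set.Ioo 0 t, S ∈ 𝓝 τ := fun τ hτ =>
      Ico_mem_nhds hτ.1 (hτ.2.trans ht.2)
    have hIoo : Set.Ioo 0 t ⊆ S := Set.Ioo_subset_Icc_self.trans hsub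
    apply mulR_wt_neg_injective hs
    rw [H.mulR_duhA hmeas hbound hb]
    have hcA := (mulR (wt (-s))).continuous.comp_continuousOn hAc
    have hcB := (mulR (wt (-s))).continuous.comp_continuousOn hBc
    refine H.eq_duhA (X := fun τ => mulR (wt (-s)) (A τ)) (Y := fun τ => mulR (wt (-s)) (B τ))
      ((mulR (wt (-s))).continuous.comp_stronglyMeasurable hmeas)
      (fun τ => (norm_mulR_wt_neg_le hs _).trans (hbound τ)) ht.1 (hcA.mono hsub) (hcB.mono hsub)
      ?_ ?_
    · intro τ hτ
      have h1 := (hasDerivWithinAt_mulR (wt (-s)) (hder τ (hIoo hτ))).hasDerivAt (hnhds τ hτ)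
      simp_rw [mulR_comm hb H.bddR_wS] at h1
      exact h1
    · intro τ hτ
      refine hasDerivAt_of_weak (σ := -(2 * (1 + ρ / 2)))
        (D := fun τ => mulR (fun η => -(rS ρ l η * rS ρ l η)) (mulR (wt (-s)) (A τ)) +
          mulR (fun η => -qS ρ η * wS ρ η) (mulR (wt (-s)) (h τ)))
        isOpen_Ioo Set.ordConnected_Ioo ?_ ?_ hτ
      · exact ((mulR _).continuous.comp_continuousOn (hcA.mono hIoo)).add
          ((mulR _).continuous.comp_continuousOn (hhc.mono hIoo))
      · intro χ r hr
        obtain ⟨Lu, gu, hLu, hgu, heq⟩ := hu.equation r (hIoo hr)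
        rw [hA r (hIoo hr)] at hLu hgu
        have h1 := (heq χ).hasDerivAt (hnhds r hr)
        rw [H.dxx_add_dxx_eq hs hLu ((hnl r (hIoo hr)).dxx_eq hs hgu)] at h1
        refine h1.congr_of_eventuallyEq ?_
        filter_upwards [hnhds r hr] with x hx
        rw [hB x hx, H.sob_eq_wS_wt hs]
  -- `ut 0` is real as the limit of difference quotients of `u`
  have hB0 : IsHerm (B 0) := by
    have h1 := hder 0 h0S
    have h2 : HasDerivWithinAt (fun τ => hermL (mulR (wS ρ) (A τ))) (hermL (B 0)) S 0 :=
      hermL.hasFDerivAt.comp_hasDerivWithinAt 0 h1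
    have h3 : ∀ τ ∈ S, hermL (mulR (wS ρ) (A τ)) = mulR (wS ρ) (A τ) := fun τ hτ =>
      (hHerm τ hτ).mulR H.bddR_wS (wt_neg_eq _)
    have h4 := h1.congr h3 (h3 0 h0S)
    exact (uniqueDiffOn_Ico 0 T 0 h0S).eq_deriv _ h2 h4
  refine ⟨A 0, B 0, h, C, hHerm 0 h0S, hB0, ?_, ?_, hmeas, hbound, hh0, fun t ht => ?_⟩
  · rw [← hu.initial, hA 0 h0S]
  · rw [← hu.initial_deriv, hB 0 h0S]
  · rw [← hmild t ht]
    exact ⟨hA t ht, hnl t ht⟩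

end Admissible

/-- If the limit superior of the norms is finite at the end of the interval, then the solution is
bounded in `H^s`. -/
theorem exists_bound_of_limsup_ne_top {s σ T : ℝ} {u ut : ℝ → 𝓢'(ℝ, ℂ)}
    (hu : ContinuousOnH s (Set.Ico 0 T) u)
    (hlim : limsup (fun t : ℝ => sobolevENorm s (u t) + sobolevENorm σ (ut t)) (𝓝[<] T) ≠ ∞) :
    ∃ R : NNReal, ∀ t ∈ Set.Ico 0 T, sobolevENorm s (u t) ≤ freqConst * R := by
  have hA : ∀ t ∈ Set.Ico 0 T, ∃ a, u t = sob s a := fun t ht => (hu t ht).1.exists_eq_sob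
  choose! A hA using hA
  have hAc := (continuousOnH_iff hA).mp hu
  obtain ⟨C, hC1, hC2⟩ := exists_between (lt_top_iff_ne_top.mpr hlim)
  have hev := eventually_lt_of_limsup_lt hC1
  obtain ⟨T₁, hT₁, hT₁'⟩ := (mem_nhdsLT_iff_exists_Ioo_subset).mp hev
  have hT₁T : T₁ < T := hT₁
  obtain ⟨D, hD⟩ := isCompact_Icc.exists_bound_of_continuousOn
    (hAc.mono (fun τ (hτ : τ ∈ Set.Icc 0 T₁) => ⟨hτ.1, hτ.2.trans_lt hT₁T⟩))
  refine ⟨max D.toNNReal (freqConst⁻¹ * C).toNNReal, fun t ht => ?_⟩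
  rcases le_or_gt t T₁ with h | h
  · rw [hA t ht, sobolevENorm_sob]
    gcongr
    rw [← ofReal_norm]
    refine (ENNReal.ofReal_le_ofReal (hD t ⟨ht.1, h⟩)).trans ?_
    exact ENNReal.coe_le_coe.mpr (le_max_left _ _)
  · have h1 : sobolevENorm s (u t) + sobolevENorm σ (ut t) < C := hT₁' ⟨h, ht.2⟩
    have h2 : freqConst⁻¹ * C ≠ ∞ :=
      ENNReal.mul_ne_top (ENNReal.inv_ne_top.mpr freqConst_ne_zero) hC2.ne
    calc sobolevENorm s (u t) ≤ C := le_self_add.trans h1.le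
      _ = freqConst * (freqConst⁻¹ * C) := by
        rw [← mul_assoc, ENNReal.mul_inv_cancel freqConst_ne_zero freqConst_ne_top, one_mul]
      _ ≤ _ := by
        gcongr
        rw [← ENNReal.coe_toNNReal h2]
        exact ENNReal.coe_le_coe.mpr (le_max_right _ _)

/-! ### Extension of bounded solutions -/

section

variable {E : Type*} [NormedAddCommGroup E] [NormedSpace ℂ E] [NormedSpace ℝ E]
  {K : ℝ → E →L[ℂ] E} {h k : ℝ → E} {B D : ℝ}

theorem duhamel_eq_zero {t : ℝ} (ht : 0 ≤ t) (hz : ∀ τ, τ < t → h τ = 0) :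
    duhamel K h t = 0 := by
  unfold duhamel
  rw [intervalIntegral.integral_congr_Ioo_of_le (g := fun _ => (0 : E)) ht
    (fun τ hτ => by rw [hz τ hτ.2, map_zero])]
  simp

theorem duhamel_add_fun (hK : StrongCont K) (hh : StronglyMeasurable h) (hB : ∀ τ, ‖h τ‖ ≤ B)
    (hk : StronglyMeasurable k) (hD : ∀ τ, ‖k τ‖ ≤ D) (t : ℝ) :
    duhamel K (fun τ => h τ + k τ) t = duhamel K h t + duhamel K k t := by
  unfold duhamel
  simp_rw [map_add]
  exact intervalIntegral.integral_add (hK.intervalIntegrable hh hB t 0 t)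
    (hK.intervalIntegrable hk hD t 0 t)

theorem duhamel_sub_fun (hK : StrongCont K) (hh : StronglyMeasurable h) (hB : ∀ τ, ‖h τ‖ ≤ B)
    (hk : StronglyMeasurable k) (hD : ∀ τ, ‖k τ‖ ≤ D) (t : ℝ) :
    duhamel K (fun τ => h τ - k τ) t = duhamel K h t - duhamel K k t := by
  unfold duhamel
  simp_rw [map_sub]
  exact intervalIntegral.integral_sub (hK.intervalIntegrable hh hB t 0 t)
    (hK.intervalIntegrable hk hD t 0 t)

/-- The Duhamel integral of an inhomogeneity which vanishes before the time `T` is small shortly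
after `T`. -/
theorem norm_duhamel_le (hK : StrongCont K) (hh : StronglyMeasurable h) (hB : ∀ τ, ‖h τ‖ ≤ B)
    {C T δ t : ℝ} (hC0 : 0 ≤ C) (hT : 0 ≤ T) (hC : ∀ t, |t| ≤ δ → ∀ x, ‖K t x‖ ≤ C * ‖x‖)
    (hz : ∀ τ, τ < T → h τ = 0) (ht : t ∈ Set.Icc T (T + δ)) :
    ‖duhamel K h t‖ ≤ C * B * δ := by
  have hB0 : 0 ≤ B := (norm_nonneg _).trans (hB 0)
  rw [duhamel_sub hK hh hB T t, intervalIntegral.integral_congr_Ioo_of_le (g := fun _ => (0 : E)) hT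
    (fun τ hτ => by rw [hz τ hτ.2, map_zero]), intervalIntegral.integral_zero, zero_add]
  have h1 : ‖∫ τ in T..t, K (t - τ) (h τ)‖ ≤ C * B * |t - T| := by
    refine intervalIntegral.norm_integral_le_of_norm_le_const fun τ hτ => ?_
    rw [Set.uIoc_of_le ht.1] at hτ
    refine (hC _ ?_ _).trans (by gcongr; exact hB τ)
    rw [abs_of_nonneg (by linarith [hτ.2])]
    linarith [hτ.1, ht.2]
  refine h1.trans ?_
  rw [abs_of_nonneg (by linarith [ht.1])]
  gcongr
  linarith [ht.2]

end

namespace Admissible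

variable {ρ s : ℝ} {l g : ℝ → ℝ} {c₁ c₂ : ℝ} {A₀ B₀ : L2} {h k : ℝ → L2} {B D : ℝ}

theorem duhA_add_fun (H : Admissible ρ l c₁ c₂) (hh : StronglyMeasurable h) (hB : ∀ τ, ‖h τ‖ ≤ B)
    (hk : StronglyMeasurable k) (hD : ∀ τ, ‖k τ‖ ≤ D) (t : ℝ) :
    duhA ρ l A₀ B₀ (fun τ => h τ + k τ) t =
      duhA ρ l A₀ B₀ h t + duhamel (fun t => mulR (kerA ρ l t)) k t := by
  unfold duhA
  rw [duhamel_add_fun H.symFam_kerA.strongCont hh hB hk hD, ← add_assoc]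

/-- A solution of the variation of constants formula on `[0, T)` with bounded nonlinear term `h`
extends beyond `T`. The formula with `h` extended by zero after `T` is the free wave `W`, and the
extension is `W` plus the Duhamel integral of the nonlinear term on `[T, T + δ]`, a fixed point of a
contraction in `C([T, T + δ], L²)`. The bound in `H^s` is preserved by the iteration and by its
limit. -/
theorem exists_extension (H : Admissible ρ l c₁ c₂) (hs : 1 / 2 < s)
    (hg : ContDiff ℝ ((⌊s⌋₊ + 1 : ℕ) : WithTop ℕ∞) g) {T : ℝ} (hT : 0 < T) (hA₀ : IsHerm A₀)
    (hB₀ : IsHerm B₀) (hh : StronglyMeasurable h) (hB : ∀ τ, ‖h τ‖ ≤ B)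
    (hz : ∀ τ, τ ∉ Set.Ico 0 T → h τ = 0)
    (hnl : ∀ t ∈ Set.Ico 0 T, IsNonlin g s (duhA ρ l A₀ B₀ h t) (h t)) :
    ∃ T', T < T' ∧ ∃ (h' : ℝ → L2) (B' : ℝ), StronglyMeasurable h' ∧ (∀ τ, ‖h' τ‖ ≤ B') ∧
      (∀ t ∈ Set.Ico 0 T, duhA ρ l A₀ B₀ h' t = duhA ρ l A₀ B₀ h t) ∧
      (∀ t ∈ Set.Ico 0 T', IsNonlin g s (duhA ρ l A₀ B₀ h' t) (h' t)) ∧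
      ContinuousOn (fun τ => mulR (wt (-s)) (h' τ)) (Set.Ico 0 T') := by
  classical
  have hb := bddR_wt_neg hs
  set W : ℝ → L2 := duhA ρ l A₀ B₀ h with hW
  set L : ℝ → L2 →L[ℂ] L2 := fun t => mulR (kerA ρ l t) with hL
  have hLc : StrongCont L := H.symFam_kerA.strongCont
  have hWc : Continuous W := H.continuous_duhA hh hB
  have hHh : ∀ τ, IsHerm (h τ) := fun τ => by
    by_cases hτ : τ ∈ Set.Ico 0 T
    · exact (hnl τ hτ).isHerm_right hs
    · rw [hz τ hτ]; exact isHerm_zero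
  obtain ⟨D, hD⟩ := (isCompact_Icc (a := 0) (b := T + 1)).exists_bound_of_continuousOn
    hWc.continuousOn
  set R : NNReal := D.toNNReal + 1 with hR
  have hDR : D + 1 ≤ R := by
    rw [hR]; push_cast; linarith [Real.le_coe_toNNReal D]
  obtain ⟨N, K, C, hN, hex, hNC⟩ := exists_nonlinearity hs hg R
  obtain ⟨CL, hCL0, hCL⟩ := hLc.bound 1
  -- the bound with `C` keeps the iterates in the ball of radius `R ≥ D + 1` of `H^s`, the bound
  -- with `K` yields the contraction in `L²`
  obtain ⟨δ, hδ0, hδ1, hδC, hδK⟩ :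
      ∃ δ : ℝ, 0 < δ ∧ δ ≤ 1 ∧ CL * C * δ ≤ 1 ∧ CL * K * δ ≤ 1 / 2 := by
    have hK0 := K.2
    have hC0 := C.2
    have hpos : 0 < 2 * (CL * C + CL * K + 1) := by positivity
    refine ⟨(2 * (CL * C + CL * K + 1))⁻¹, by positivity, inv_le_one_of_one_le₀ ?_, ?_, ?_⟩
    · have : 0 ≤ CL * C + CL * K := by positivity
      linarith
    · rw [mul_inv_le_iff₀ hpos]
      have : 0 ≤ CL * K := by positivity
      have : 0 ≤ CL * C := by positivity
      linarith
    · rw [mul_inv_le_iff₀ hpos]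
      have : 0 ≤ CL * C := by positivity
      linarith
  have hCLδ : ∀ t, |t| ≤ δ → ∀ x, ‖L t x‖ ≤ CL * ‖x‖ := fun t ht => hCL t (ht.trans hδ1)
  have hTδ : T ≤ T + δ := by linarith
  set J : Set ℝ := Set.Icc T (T + δ) with hJ
  -- the nonlinear term, extended by zero outside `[T, T + δ]`
  set F : C(J, L2) → ℝ → L2 := fun X => J.indicator fun τ => N (X (Set.projIcc T (T + δ) hTδ τ))
    with hF
  have hFmeas : ∀ X, StronglyMeasurable (F X) := fun X =>
    (hN.continuous.comp (X.continuous.comp continuous_projIcc)).stronglyMeasurable.indicator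
      measurableSet_Icc
  have hFJ : ∀ (X : C(J, L2)) (τ : ℝ) (hτ : τ ∈ J), F X τ = N (X ⟨τ, hτ⟩) := fun X τ hτ => by
    rw [hF]
    simp only [Set.indicator_of_mem hτ]
    rw [Set.projIcc_of_mem hTδ hτ]
  have hF0 : ∀ (X : C(J, L2)) (τ : ℝ), τ ∉ J → F X τ = 0 := fun X τ hτ =>
    Set.indicator_of_notMem hτ _
  have hFbd : ∀ X τ, ‖F X τ‖ ≤ ‖N 0‖ + K * ‖X‖ := fun X τ => by
    by_cases hτ : τ ∈ J
    · rw [hFJ X τ hτ]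
      have h1 := hN.norm_sub_le (X ⟨τ, hτ⟩) 0
      rw [sub_zero] at h1
      have h2 := norm_le_norm_add_norm_sub' (N (X ⟨τ, hτ⟩)) (N 0)
      have h3 : (K : ℝ) * ‖X ⟨τ, hτ⟩‖ ≤ K * ‖X‖ := by gcongr; exact X.norm_coe_le_norm _
      linarith
    · rw [hF0 X τ hτ, norm_zero]; positivity
  have hFsub : ∀ X Y τ, ‖F X τ - F Y τ‖ ≤ K * dist X Y := fun X Y τ => by
    by_cases hτ : τ ∈ J
    · rw [hFJ X τ hτ, hFJ Y τ hτ, ← dist_eq_norm]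
      refine (hN.dist_le_mul _ _).trans ?_
      gcongr
      exact ContinuousMap.dist_apply_le_dist _
    · rw [hF0 X τ hτ, hF0 Y τ hτ, sub_zero, norm_zero]; positivity
  have hltJ : ∀ τ, τ < T → τ ∉ J := fun τ hτ h => absurd h.1 (not_le.mpr hτ)
  set Φ : C(J, L2) → C(J, L2) := fun X =>
    ⟨fun t => mulR (wt (-s)) (W t) + duhamel L (F X) t,
      (((mulR (wt (-s))).continuous.comp hWc).add
        (continuous_duhamel hLc (hFmeas X) (hFbd X))).comp continuous_subtype_val⟩ with hΦ
  have hcontr : ContractingWith (1 / 2) Φ := by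
    refine ⟨by norm_num, LipschitzWith.of_dist_le_mul fun X Y => ?_⟩
    refine (ContinuousMap.dist_le (by positivity)).mpr fun t => ?_
    change dist (mulR (wt (-s)) (W t) + duhamel L (F X) t)
      (mulR (wt (-s)) (W t) + duhamel L (F Y) t) ≤ _
    rw [dist_add_left, dist_eq_norm,
      ← duhamel_sub_fun hLc (hFmeas X) (hFbd X) (hFmeas Y) (hFbd Y)]
    refine (norm_duhamel_le hLc ((hFmeas X).sub (hFmeas Y)) (hFsub X Y) hCL0 hT.le hCLδ
      (fun τ hτ => ?_) t.2).trans ?_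
    · simp only [Pi.sub_apply]
      rw [hF0 X τ (hltJ τ hτ), hF0 Y τ (hltJ τ hτ), sub_zero]
    · push_cast
      calc CL * (K * dist X Y) * δ = CL * K * δ * dist X Y := by ring
        _ ≤ 1 / 2 * dist X Y := by gcongr
  -- the invariant set: elements of a ball of `H^s` at every time
  set Inv : C(J, L2) → Prop := fun X =>
    ∀ t : J, ∃ a, IsHerm a ∧ ‖a‖ ≤ R ∧ mulR (wt (-s)) a = X t with hInv
  -- for `X` in the invariant set, the nonlinear term `F X` comes from a bounded function in `H^s`
  have hlift : ∀ X, Inv X → ∃ k : ℝ → L2, StronglyMeasurable k ∧ (∀ τ, ‖k τ‖ ≤ C) ∧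
      (∀ τ, IsHerm (k τ)) ∧ (∀ τ, τ ∉ J → k τ = 0) ∧ (∀ τ, F X τ = mulR (wt (-s)) (k τ)) ∧
      ∀ (τ : ℝ) (hτ : τ ∈ J) (a : L2), mulR (wt (-s)) a = X ⟨τ, hτ⟩ →
        IsNonlin g s a (k τ) ∧ ‖a‖ ≤ R := by
    intro X hX
    have h1 : ∀ τ, ∃ y, (τ ∉ J → y = 0) ∧ ∀ (hτ : τ ∈ J) (a : L2),
        mulR (wt (-s)) a = X ⟨τ, hτ⟩ → IsNonlin g s a y ∧ ‖a‖ ≤ R := by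
      intro τ
      by_cases hτ : τ ∈ J
      · obtain ⟨a, ha1, ha2, ha3⟩ := hX ⟨τ, hτ⟩
        obtain ⟨y, hy⟩ := hex a ha1 ha2
        refine ⟨y, fun h => absurd hτ h, fun _ a' ha' => ?_⟩
        have : a' = a := mulR_wt_neg_injective hs (ha'.trans ha3.symm)
        rw [this]
        exact ⟨hy, ha2⟩
      · exact ⟨0, fun _ => rfl, fun h => absurd h hτ⟩
    choose k hk0 hk using h1
    have hFk : ∀ τ, F X τ = mulR (wt (-s)) (k τ) := fun τ => by
      by_cases hτ : τ ∈ J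
      · obtain ⟨a, -, -, ha⟩ := hX ⟨τ, hτ⟩
        obtain ⟨h1, h2⟩ := hk τ hτ a ha
        rw [hFJ X τ hτ, (hNC a _ h1 h2).2, ha]
      · rw [hF0 X τ hτ, hk0 τ hτ, map_zero]
    refine ⟨k, ?_, fun τ => ?_, fun τ => ?_, hk0, hFk, hk⟩
    · refine stronglyMeasurable_of_mulR hb (wt_ne_zero _) measurableSet_Icc ?_ hk0
      have h2 : Continuous fun τ => N (X (Set.projIcc T (T + δ) hTδ τ)) :=
        hN.continuous.comp (X.continuous.comp continuous_projIcc)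
      refine h2.continuousOn.congr fun τ hτ => ?_
      change mulR (wt (-s)) (k τ) = N (X (Set.projIcc T (T + δ) hTδ τ))
      rw [← hFk, hFJ X τ hτ, Set.projIcc_of_mem hTδ hτ]
    · by_cases hτ : τ ∈ J
      · obtain ⟨a, -, -, ha⟩ := hX ⟨τ, hτ⟩
        obtain ⟨h1, h2⟩ := hk τ hτ a ha
        exact (hNC a _ h1 h2).1
      · rw [hk0 τ hτ, norm_zero]; exact C.2
    · by_cases hτ : τ ∈ J
      · obtain ⟨a, -, -, ha⟩ := hX ⟨τ, hτ⟩
        exact (hk τ hτ a ha).1.isHerm_right hs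
      · rw [hk0 τ hτ]; exact isHerm_zero
  have hstep : ∀ (X : C(J, L2)) (k : ℝ → L2), StronglyMeasurable k → (∀ τ, ‖k τ‖ ≤ C) →
      (∀ τ, F X τ = mulR (wt (-s)) (k τ)) → ∀ t : J,
      mulR (wt (-s)) (duhA ρ l A₀ B₀ (fun τ => h τ + k τ) t) = Φ X t := by
    intro X k hkm hkC hFk t
    rw [H.duhA_add_fun hh hB hkm hkC, map_add, mulR_duhamel' H.symFam_kerA hb hkm hkC]
    simp_rw [← hFk]
    rfl
  have hinv : ∀ X, Inv X → Inv (Φ X) := by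
    intro X hX t
    obtain ⟨k, hkm, hkC, hkH, hk0, hFk, -⟩ := hlift X hX
    refine ⟨_, ?_, ?_, hstep X k hkm hkC hFk t⟩
    · refine H.isHerm_duhA (B := B + C) (hh.add hkm) (fun τ => ?_) hA₀ hB₀
        (fun τ => (hHh τ).add (hkH τ)) t
      exact (norm_add_le _ _).trans (add_le_add (hB τ) (hkC τ))
    · rw [H.duhA_add_fun hh hB hkm hkC]
      refine (norm_add_le _ _).trans ?_
      have h1 := hD t ⟨hT.le.trans t.2.1, t.2.2.trans (by linarith)⟩
      have h2 := norm_duhamel_le hLc hkm hkC hCL0 hT.le hCLδ (fun τ hτ => hk0 τ (hltJ τ hτ)) t.2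
      linarith
  have hinv0 : Inv 0 := fun t => ⟨0, isHerm_zero, by simp, by rw [map_zero]; rfl⟩
  set X := ContractingWith.fixedPoint Φ hcontr with hX
  have hfix : Φ X = X := hcontr.fixedPoint_isFixedPt
  have hXinv : Inv X := by
    have hiter : ∀ n, Inv (Φ^[n] 0) := fun n => by
      induction n with
      | zero => exact hinv0
      | succ n ih => rw [Function.iterate_succ_apply']; exact hinv _ ih
    intro t
    choose a ha1 ha2 ha3 using fun n => hiter n t
    refine exists_of_tendsto_mulR_wt hs ha1 ha2 ?_
    simp_rw [ha3]
    exact ((continuous_eval_const t).tendsto _).comp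
      (hcontr.tendsto_iterate_fixedPoint 0)
  obtain ⟨k, hkm, hkC, hkH, hk0, hFk, hk⟩ := hlift X hXinv
  have hbefore : ∀ t ∈ Set.Ico 0 T, duhA ρ l A₀ B₀ (fun τ => h τ + k τ) t = W t := fun t ht => by
    rw [H.duhA_add_fun hh hB hkm hkC,
      duhamel_eq_zero ht.1 (fun τ hτ => hk0 τ (hltJ τ (hτ.trans ht.2))), add_zero]
  have hafter : ∀ (t : ℝ) (ht : t ∈ J),
      mulR (wt (-s)) (duhA ρ l A₀ B₀ (fun τ => h τ + k τ) t) = X ⟨t, ht⟩ := fun t ht => by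
    rw [hstep X k hkm hkC hFk ⟨t, ht⟩, hfix]
  have hfull : ∀ t ∈ Set.Ico 0 (T + δ),
      IsNonlin g s (duhA ρ l A₀ B₀ (fun τ => h τ + k τ) t) (h t + k t) ∧
        ‖duhA ρ l A₀ B₀ (fun τ => h τ + k τ) t‖ ≤ R := by
    intro t ht
    rcases lt_or_ge t T with h1 | h1
    · rw [hbefore t ⟨ht.1, h1⟩, hk0 t (hltJ t h1), add_zero]
      refine ⟨hnl t ⟨ht.1, h1⟩, ?_⟩
      have := hD t ⟨ht.1, by linarith⟩
      linarith
    · have htJ : t ∈ J := ⟨h1, ht.2.le⟩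
      rw [hz t (fun h2 => absurd h2.2 (not_lt.mpr h1)), zero_add]
      exact hk t htJ _ (hafter t htJ)
  have hsum : StronglyMeasurable fun τ => h τ + k τ := hh.add hkm
  have hsumB : ∀ τ, ‖h τ + k τ‖ ≤ B + C := fun τ =>
    (norm_add_le _ _).trans (add_le_add (hB τ) (hkC τ))
  refine ⟨T + δ, by linarith, fun τ => h τ + k τ, B + C, hsum, hsumB, hbefore,
    fun t ht => (hfull t ht).1, ?_⟩
  have hcont : Continuous fun τ =>
      N (mulR (wt (-s)) (duhA ρ l A₀ B₀ (fun τ => h τ + k τ) τ)) :=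
    hN.continuous.comp ((mulR (wt (-s))).continuous.comp (H.continuous_duhA hsum hsumB))
  exact hcont.continuousOn.congr fun t ht => (hNC _ _ (hfull t ht).1 (hfull t ht).2).2

end Admissible

end NonlocalWave

theorem theorem4p1 (ρ s : ℝ) (hρ : 2 ≤ ρ) (hs : 1 / 2 < s)
    (l : ℝ → ℝ) (hl_meas : Measurable l) (hl_even : ∀ ξ : ℝ, l (-ξ) = l ξ)
    (c₁ c₂ : ℝ) (hc₁ : 0 < c₁) (hc₂ : 0 < c₂)
    (hl_lower : ∀ ξ : ℝ, c₁ ^ 2 * (1 + ξ ^ 2) ^ (ρ / 2) ≤ l ξ)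
    (hl_upper : ∀ ξ : ℝ, l ξ ≤ c₂ ^ 2 * (1 + ξ ^ 2) ^ (ρ / 2))
    (g : ℝ → ℝ) (hg : ContDiff ℝ ((⌊s⌋₊ + 1 : ℕ) : WithTop ℕ∞) g)
    (φ ψ : 𝓢'(ℝ, ℂ)) (hφ : NonlocalWave.MemH s φ)
    (hψ : NonlocalWave.MemH (s - 1 - ρ / 2) ψ)
    (Tmax : EReal) (u ut : ℝ → 𝓢'(ℝ, ℂ))
    (hu : NonlocalWave.IsMaximalSolution ρ s l g φ ψ Tmax u ut)
    (hTmax : Tmax < ⊤) :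
    limsup (fun t : ℝ => NonlocalWave.sobolevENorm s (u t)
        + NonlocalWave.sobolevENorm (s - 1 - ρ / 2) (ut t)) (𝓝[<] Tmax.toReal) = ∞ := by
  by_contra hlim
  obtain ⟨hpos, hsol, hmax⟩ := hu
  have H : NonlocalWave.Admissible ρ l c₁ c₂ :=
    ⟨hρ, hl_meas, hl_even, hc₁, hc₂, hl_lower, hl_upper⟩
  have hcoe : ((Tmax.toReal : ℝ) : EReal) = Tmax :=
    EReal.coe_toReal hTmax.ne (bot_le.trans_lt hpos).ne'
  set T := Tmax.toReal with hT
  rw [← hcoe] at hpos hsol hmax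
  have hT0 : 0 < T := by exact_mod_cast hpos
  rw [NonlocalWave.timeInterval_coe] at hsol hmax
  obtain ⟨R, hR⟩ := NonlocalWave.exists_bound_of_limsup_ne_top hsol.continuousOn hlim
  obtain ⟨A₀, B₀, h, B, hA₀, hB₀, hφA, hψB, hh, hB, hz, hsol'⟩ :=
    H.exists_mild_of_isSolutionOn hs hg hT0 hsol hR
  obtain ⟨T', hTT', h', B', hh', hB', heq, hnl, hc⟩ :=
    H.exists_extension hs hg hT0 hA₀ hB₀ hh hB hz fun t ht => (hsol' t ht).2
  have hnew := H.isSolutionOn_of_mild hs hh' hB' hc hnl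
  rw [← hφA, ← hψB, ← NonlocalWave.timeInterval_coe] at hnew
  refine hmax T' (by exact_mod_cast hTT') ⟨_, _, hnew, fun t ht => ?_⟩
  simp only [heq t ht, (hsol' t ht).1]
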